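/- Let $\mathbb K$ be an algebraically closed field, $k\ge 2$, $d=2k-1$, and let $u_0,u_1,u_2\in\mathbb K[T_0,T_1]=\mathbb K[\underline T]$ be homogeneous of degree $d$ without common factors; write $\underline u=(u_0,u_1,u_2)$ and $I=\langle u_0,u_1,u_2\rangle$. Let $\mathcal K$ be the kernel of the $\mathbb K[\underline T]$-algebra map $\mathbb K[\underline T][X_0,X_1,X_2]\to \mathrm{Rees}(I)=\bigoplus_{n\ge0}I^nZ^n$, $X_i\mapsto u_iZ$. Let $\mu$ be the least degree of a nonzero homogeneous syzygy of $(u_0,u_1,u_2)$ and suppose $\mu=2$ (this forces $k\ge3$). Suppose that $\phi=(u_0:u_1:u_2):\mathbb P^1\to\mathbb P^2$ is proper, i.e. birational onto its image $\mathrm C$, and that $\mathrm C$ has a very singular point $\mathbf p$, i.e. a point of multiplicity greater than $\mu=2$. Let $\mathcal E_d\in\mathbb K[\underline X]$ be an implicit equation of $\mathrm C$, i.e. a generator of the ideal of all polynomials $G(\underline X)$ with $G(\underline u(\underline T))=0$. Let $x_0,x_1$ be linearly independent linear forms in $\underline X$ vanishing at $\mathbf p$ (if $\mathbf p=(0:0:1)$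 one may take $x_0=X_0$, $x_1=X_1$). Let $F_{2,1}=\sum_i P_iX_i$ and $F_{d-2,1}=F_{2(k-1)-1,1}=\sum_i Q_iX_i$, where $(P,Q)$ is a basis of the syzygy module of $(u_0,u_1,u_2)$ over $\mathbb K[\underline T]$ with $P,Q$ homogeneous of degrees $2$ and $d-2$. Such $\mathcal E_d$, $x_0,x_1$ and $(P,Q)$ exist, and for any choice of them $\mathcal E_d$ is irreducible and homogeneous of degree $d$, and the following construction can be carried out: * Write $F_{2,1}=p^1(\underline T)x_0-p^0(\underline T)x_1$ with $p^0,p^1\in\mathbb K[\underline T]$ homogeneous of degree $2$. * For $j=2,\dots,k-1$ write $F_{2(k-j+1)-1,\,j-1}=p^0G^0+p^1G^1$ with $G^0,G^1\in\mathbb K[\underline T,\underline X]$ bihomogeneous of bidegree $(2(k-j)-1,\,j-1)$, and set $F_{2(k-j)-1,\,j}:=x_0G^0+x_1G^1$. * Let $F_{1,k}$ be a Sylvester form of $F_{1,k-1}$ and $F_{2,1}$: write $F_{2,1}=T_0G+T_1H$ with $G,H$ bihomogeneous of bidegree $(1,1)$, write $F_{1,k-1}=T_0\mathcal F^1(\underline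 X)-T_1\mathcal F^0(\underline X)$ with $\mathcal F^0,\mathcal F^1\in\mathbb K[\underline X]$ homogeneous of degree $k-1$, and set $F_{1,k}:=\mathcal F^0G+\mathcal F^1H$. Then, for every choice made in this construction, each $F_{i,j}$ is bihomogeneous of bidegree $(i,j)$ in $(\underline T,\underline X)$, and the $k+2=\frac{d+5}{2}$ polynomials $$\mathcal E_d,\quad F_{2,1},\quad F_{2(k-1)-1,1},\ F_{2(k-2)-1,2},\ \dots,\ F_{1,k-1},\quad F_{1,k}$$ are pairwise distinct and form a minimal set of generators of $\mathcal K$: they generate $\mathcal K$, and no proper subset of them does. -/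

import Mathlib

open MvPolynomial

noncomputable section

/-- `R = 𝕂[T₀, T₁]`. -/
abbrev RingT (K : Type*) [Field K] := MvPolynomial (Fin 2) K

/-- `𝕂[X₀, X₁, X₂]`. -/
abbrev RingX (K : Type*) [Field K] := MvPolynomial (Fin 3) K

/-- `𝕂[T₀, T₁][X₀, X₁, X₂]`. -/
abbrev RingTX (K : Type*) [Field K] := MvPolynomial (Fin 3) (RingT K)

/-- The variable `Tₐ`, seen in `𝕂[T][X]`. -/
def varT (K : Type*) [Field K] (a : Fin 2) : RingTX K := C (X a)

/-- The inclusion `𝕂[X] ⊆ 𝕂[T][X]`. -/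
def embX {K : Type*} [Field K] : RingX K →+* RingTX K := MvPolynomial.map C

/-- `G ∈ 𝕂[T, X]` is bihomogeneous of bidegree `(i, j)`: degree `i` in `T`, degree `j` in `X`. -/
def IsBihomogeneous {K : Type*} [Field K] (i j : ℕ) (G : RingTX K) : Prop :=
  G.IsHomogeneous j ∧ ∀ m, (G.coeff m).IsHomogeneous i

/-- The map of `𝕂[T]`-algebras `Φ : 𝕂[T][X] → Rees(I)`, `Xᵢ ↦ uᵢ(T) Z`, where
`I = ⟨u₀, u₁, u₂⟩` and `Rees(I) = ⨁ Iⁿ Zⁿ ⊆ 𝕂[T][Z]`. -/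
def reesMap {K : Type*} [Field K] (u : Fin 3 → RingT K) :
    RingTX K →ₐ[RingT K] reesAlgebra (Ideal.span (Set.range u)) :=
  aeval fun i => ⟨Polynomial.monomial 1 (u i),
    (reesAlgebra.monomial_mem).2 (by
      rw [pow_one]; exact Ideal.subset_span (Set.mem_range_self i))⟩

/-- The defining ideal `𝒦 = ker Φ` of the Rees algebra. -/
def reesIdeal {K : Type*} [Field K] (u : Fin 3 → RingT K) : Ideal (RingTX K) :=
  RingHom.ker (reesMap u)

/-- The syzygy module of `(u₀, u₁, u₂)`. -/
def syzygies {K : Type*} [Field K] (u : Fin 3 → RingT K) :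
    Submodule (RingT K) (Fin 3 → RingT K) :=
  LinearMap.ker (Fintype.linearCombination (RingT K) u)

/-- `μ`: the least degree of a nonzero homogeneous syzygy of `(u₀, u₁, u₂)`. -/
def muDegree {K : Type*} [Field K] (u : Fin 3 → RingT K) : ℕ :=
  sInf {m | ∃ s ∈ syzygies u, s ≠ 0 ∧ ∀ i, (s i).IsHomogeneous m}

/-- `(P, Q)` is a basis of the module of syzygies of the forms `u` of degree `d`,
with `P` homogeneous of degree `μ` and `Q` homogeneous of degree `d - μ`. -/
structure IsMuBasis {K : Type*} [Field K] (u : Fin 3 → RingT K) (d μ : ℕ)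
    (P Q : Fin 3 → RingT K) : Prop where
  homP : ∀ i, (P i).IsHomogeneous μ
  homQ : ∀ i, (Q i).IsHomogeneous (d - μ)
  indep : LinearIndependent (RingT K) ![P, Q]
  span_eq : Submodule.span (RingT K) {P, Q} = syzygies u

/-- The element `s₀(T) X₀ + s₁(T) X₁ + s₂(T) X₂` of `𝕂[T, X]` given by `s = (s₀, s₁, s₂)`. -/
def movingLine {K : Type*} [Field K] (s : Fin 3 → RingT K) : RingTX K :=
  ∑ i, C (s i) * X i

/-- The parametrization `φ : ℙ¹ → ℙ²` given by `u` is proper, i.e. birational onto its image: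
there is a rational map `(A : B)` from the image to `ℙ¹` (`A`, `B` forms of the same degree that
do not both vanish identically on the image) with `(A(u(T)) : B(u(T))) = (T₀ : T₁)`. -/
def IsProperParam {K : Type*} [Field K] (u : Fin 3 → RingT K) : Prop :=
  ∃ (n : ℕ) (A B : RingX K), A.IsHomogeneous n ∧ B.IsHomogeneous n ∧
    ¬ (aeval u A = 0 ∧ aeval u B = 0) ∧
    X 0 * aeval u B = X 1 * aeval u A

/-- `E` is an implicit equation of the image of `φ`: it generates the ideal of all polynomials
in `𝕂[X₀, X₁, X₂]` that vanish identically on `(u₀(T), u₁(T), u₂(T))`. -/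
def IsImplicitEquation {K : Type*} [Field K] (u : Fin 3 → RingT K) (E : RingX K) : Prop :=
  Ideal.span {E} = RingHom.ker (aeval u : RingX K →ₐ[K] RingT K)

/-- The multiplicity at `p` of the curve with equation `E`: the order of vanishing of `E` at `p`,
that is, the least degree of a monomial in the Taylor expansion `E(X + p)`. -/
def multiplicityAt {K : Type*} [Field K] (E : RingX K) (p : Fin 3 → K) : ℕ∞ :=
  MvPowerSeries.order
    ((aeval (fun i => (X i + C (p i) : RingX K)) E : RingX K) : MvPowerSeries (Fin 3) K)

/-- The point with homogeneous coordinates `p` is very singular on the image of `φ`: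
its multiplicity exceeds `μ`. -/
def IsVerySingular {K : Type*} [Field K] (u : Fin 3 → RingT K) (p : Fin 3 → K) : Prop :=
  p ≠ 0 ∧ ∃ E, IsImplicitEquation u E ∧ (muDegree u : ℕ∞) < multiplicityAt E p

/-- The linear form `ℓ₀ X₀ + ℓ₁ X₁ + ℓ₂ X₂`, seen in `𝕂[T, X]`. -/
def linForm {K : Type*} [Field K] (l : Fin 3 → K) : RingTX K :=
  ∑ i, C (C (l i)) * X i

/-- `L 0`, `L 1` are (the coefficient vectors of) two linearly independent linear forms vanishing
at `p`. They are the first two coordinates of a linear coordinate system in which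
`p = (0 : 0 : 1)`. -/
def AreCoordsAt {K : Type*} [Field K] (p : Fin 3 → K) (L : Fin 2 → Fin 3 → K) : Prop :=
  LinearIndependent K L ∧ ∀ a, ∑ i, L a i * p i = 0

/-- `H` is a value of the operator `𝒟_T` (for the forms `p₀, p₁` and the linear coordinates
`x₀, x₁`) on `G`, where `G` has bidegree `(i + μ, j)`, `p₀, p₁` have degree `μ`: one can write
`G = p₀ G⁰ + p₁ G¹` with `G⁰, G¹` of bidegree `(i, j)` and then `H = x₀ G⁰ + x₁ G¹`. -/
def IsValueDT {K : Type*} [Field K] (p₀ p₁ : RingT K) (x₀ x₁ : RingTX K) (i j : ℕ)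
    (G H : RingTX K) : Prop :=
  ∃ G₀ G₁ : RingTX K, IsBihomogeneous i j G₀ ∧ IsBihomogeneous i j G₁ ∧
    G = C p₀ * G₀ + C p₁ * G₁ ∧ H = x₀ * G₀ + x₁ * G₁

/-- `S` is a Sylvester form of `F` (of bidegree `(1, n)`) and `P` (of bidegree `(2, 1)`):
`P = T₀ G + T₁ H`, `F = T₀ F¹(X) - T₁ F⁰(X)`, and `S = F⁰ G + F¹ H`. -/
def IsSylvesterForm {K : Type*} [Field K] (n : ℕ) (P F S : RingTX K) : Prop :=
  ∃ (G H : RingTX K) (F₀ F₁ : RingX K),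
    IsBihomogeneous 1 1 G ∧ IsBihomogeneous 1 1 H ∧
    F₀.IsHomogeneous n ∧ F₁.IsHomogeneous n ∧
    P = varT K 0 * G + varT K 1 * H ∧
    F = varT K 0 * embX F₁ - varT K 1 * embX F₀ ∧
    S = embX F₀ * G + embX F₁ * H

/-- Let `d = 2k - 1`, `(P, Q)` a `μ`-basis with `μ = 2`, and `L` linear coordinates at the
very singular point. The predicate says that `F j = F_{2(k-j)-1, j}`, `1 ≤ j ≤ k - 1`, and
`S = F_{1,k}` have been produced by the recursive construction:
`P = p₁ x₀ - p₀ x₁`; `F 1 = Q`; `F j` is a value of `𝒟_T` on `F (j-1)`;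
`S` is a Sylvester form of `F (k-1) = F_{1,k-1}` and `P = F_{2,1}`. -/
structure IsSpecialFamily {K : Type*} [Field K] (k : ℕ) (L : Fin 2 → Fin 3 → K)
    (P Q : Fin 3 → RingT K) (p₀ p₁ : RingT K) (F : ℕ → RingTX K) (S : RingTX K) : Prop where
  hom₀ : p₀.IsHomogeneous 2
  hom₁ : p₁.IsHomogeneous 2
  axial : movingLine P = C p₁ * linForm (L 0) - C p₀ * linForm (L 1)
  start : F 1 = movingLine Q
  step : ∀ j, 2 ≤ j → j ≤ k - 1 →
    IsValueDT p₀ p₁ (linForm (L 0)) (linForm (L 1)) (2 * (k - j) - 1) (j - 1) (F (j - 1)) (F j)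
  sylvester : IsSylvesterForm (k - 1) (movingLine P) (F (k - 1)) S

/-- The set `{𝓔_d, F_{2,1}, F_{2(k-1)-1,1}, …, F_{1,k-1}, F_{1,k}}`. -/
def familySet {K : Type*} [Field K] (k : ℕ) (E : RingX K) (P : Fin 3 → RingT K)
    (F : ℕ → RingTX K) (S : RingTX K) : Set (RingTX K) :=
  {embX E, movingLine P, S} ∪ F '' Set.Icc 1 (k - 1)

/-- `A` generates the ideal `J`, and no proper subset of `A` does. -/
def IsMinimalGeneratingSet {B : Type*} [CommRing B] (J : Ideal B) (A : Set B) : Prop :=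
  Minimal (fun A' : Set B => Ideal.span A' = J) A

end

/-! ### Homogeneous components and homogeneous factors -/

section Homogeneous

variable {σ A : Type*} [CommRing A]

/-! Write `R = 𝕂[T₀, T₁]` and let `x₀, x₁, x₂` be linear coordinates with `p = (0 : 0 : 1)`.

Multiplicity at least 3 at `p` makes the implicit equation of degree at most `d - 3` in `x₂`. Since
`φ` is birational, the projection from `p` then has degree at most `d - 3`
(`max_natDegree_le_of_aeval_eq_zero`), which gives a nonzero syzygy of degree below `d - 2`. It must
be a multiple of `P`, so the moving line `P` passes through `p` and `F_{2,1} = p₁x₀ - p₀x₁` with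
`p₀, p₁` coprime (`sum_mul_eq_zero_of_isVerySingular`, `exists_axial`).

The main tool is the substitution `ψ = axialMap : R[X] → R[z]`, `x₀ ↦ p₀z`, `x₁ ↦ p₁z`, `x₂ ↦ 1`. On
forms in `X` its kernel is generated by `F_{2,1}` (`dvd_of_axialMap_eq_zero`), and every form in `𝒦`
is sent to a multiple of the linear polynomial `ψ(Q)` (`dvd_axialMap`). The operator `𝒟_T` becomes
multiplication by `z`, so `ψ(F_j) = z^(j-1) ψ(Q)`. The Sylvester form satisfies `ψ(S) = ε z^(k-2)
ψ(Q)`, where `ε = Jz + c₀` and `J` is a quadratic form outside the span of `p₀, p₁`.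

Generation in positive `T`-degree thus reduces to lifting each monomial `c zⁱ` of the quotient by
`ψ(Q)`. Give `z` the weight `-2`; then the degree of `c` is known. For `i ≤ k - 2` a multiple of
`F_{i+1}` suffices. Beyond that, factors `p₀, p₁` are split off `c` and replaced by `x₀, x₁`: every
form of degree at least 3 lies in `⟨p₀, p₁⟩`, and the one obstruction, in degree 2, is removed by
`J` (`exists_lift_of_le`). In `T`-degree 0 the implicit equation `E` generates by definition.

For the degree of `E`, each `T_a E` is a combination of `F_{1,k-1}` and `F_{1,k}` over `𝕂[X]`. Hence
their `2 × 2` determinant, of degree `d`, divides `E²`, and `d` is odd (`totalDegree_eq`).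
Minimality follows by comparing bidegrees; the two cases bidegrees leave open are settled by `ψ(F_j)
≠ 0` and by `ε` not being the image of a form of bidegree `(0, 1)` (`familyGen_notMem_span`). -/

lemma homogeneousComponent_mul_of_isHomogeneous (x : MvPolynomial σ A) {f : MvPolynomial σ A}
    {a : ℕ} (hf : f.IsHomogeneous a) (s : ℕ) :
    homogeneousComponent s (x * f) = if a ≤ s then homogeneousComponent (s - a) x * f else 0 := by
  conv_lhs => rw [← sum_homogeneousComponent x, Finset.sum_mul, map_sum]
  have key : ∀ j, homogeneousComponent s (homogeneousComponent j x * f) =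
      if s = j + a then homogeneousComponent j x * f else 0 := fun j =>
    homogeneousComponent_of_mem ((homogeneousComponent_isHomogeneous j x).mul hf)
  simp_rw [key]
  split_ifs with h
  · obtain ⟨b, rfl⟩ := Nat.exists_eq_add_of_le h
    have : ∀ j, (a + b = j + a) ↔ (b = j) := fun j => by omega
    simp_rw [this, Nat.add_sub_cancel_left]
    rw [Finset.sum_ite_eq]
    split_ifs with hb
    · rfl
    · rw [homogeneousComponent_eq_zero, zero_mul]
      simpa using hb
  · exact Finset.sum_eq_zero fun j _ => if_neg (by omega)

/-- Multiplication by `f` shifts components by `a` and is injective, so only the component of `x` in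
degree `N - a` survives. The alternative `x = 0` covers `N < a`. -/
lemma MvPolynomial.IsHomogeneous.of_mul_left [IsDomain A] {x f : MvPolynomial σ A} {a N : ℕ}
    (hf : f.IsHomogeneous a) (hf0 : f ≠ 0) (h : (f * x).IsHomogeneous N) :
    x = 0 ∨ ∃ e, e + a = N ∧ x.IsHomogeneous e := by
  have hN : homogeneousComponent N (x * f) = x * f :=
    homogeneousComponent_eq_self (by rwa [mul_comm])
  rw [homogeneousComponent_mul_of_isHomogeneous x hf] at hN
  split_ifs at hN with haN
  · refine Or.inr ⟨N - a, by omega, ?_⟩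
    rw [← mul_right_cancel₀ hf0 hN]
    exact homogeneousComponent_isHomogeneous _ _
  · exact Or.inl ((mul_eq_zero.1 hN.symm).resolve_right hf0)

lemma MvPolynomial.IsHomogeneous.aeval_mul {B : Type*} [CommRing B] [Algebra A B]
    {f : MvPolynomial σ A} {n : ℕ} (hf : f.IsHomogeneous n) (c : B) (v : σ → B) :
    MvPolynomial.aeval (fun i => c * v i) f = c ^ n * MvPolynomial.aeval v f := by
  rw [aeval_def, aeval_def, eval₂_eq, eval₂_eq, Finset.mul_sum]
  refine Finset.sum_congr rfl fun m hm => ?_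
  simp_rw [mul_pow]
  rw [Finset.prod_mul_distrib, Finset.prod_pow_eq_pow_sum,
    ← hf.degree_eq_sum_deg_support hm]
  ring

end Homogeneous

/-! ### Dimensions of spaces of forms, and multiples of primitive vectors -/

lemma finrank_homogeneousSubmodule (K : Type*) [Field K] (N n : ℕ) :
    Module.finrank K (homogeneousSubmodule (Fin N) K n) = (N + n - 1).choose n := by
  classical
  rw [homogeneousSubmodule_eq_finsupp_supported,
    (AddMonoidAlgebra.supportedEquivFinsupp (R := K) {d : Fin N →₀ ℕ | d.degree = n}).finrank_eq]
  have e : {d : Fin N →₀ ℕ | d.degree = n} ≃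
      (Finset.univ.finsuppAntidiag n : Finset (Fin N →₀ ℕ)) :=
    Equiv.setCongr (by ext x; simp [Finset.mem_finsuppAntidiag, Finsupp.degree_eq_sum])
  have : Fintype {d : Fin N →₀ ℕ | d.degree = n} := Fintype.ofEquiv _ e.symm
  rw [Module.finrank_finsupp_self, Fintype.card_congr e, Fintype.card_coe,
    Finset.card_finsuppAntidiag_nat_eq_choose, Finset.card_univ, Fintype.card_fin]

instance (K : Type*) [Field K] (N n : ℕ) :
    Module.Finite K (homogeneousSubmodule (Fin N) K n) :=
  Module.Finite.of_fg (homogeneousSubmodule_fg _ K n)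

/-- Each `u j` divides all `x j * u i`, hence `x j` times their gcd, which is a unit. This clears
denominators in a proportionality to a primitive vector. -/
lemma exists_smul_of_proportional {R ι : Type*} [CommRing R] [IsDomain R]
    [UniqueFactorizationMonoid R] [Fintype ι] {u x : ι → R}
    (hu : ∀ g, (∀ i, g ∣ u i) → IsUnit g) (h : ∀ i j, x i * u j = x j * u i) :
    ∃ b, ∀ i, x i = b * u i := by
  classical
  obtain ⟨inst⟩ : Nonempty (NormalizedGCDMonoid R) := inferInstance
  by_cases h0 : ∀ j, u j = 0
  · have := hu 0 (fun i => by rw [h0 i])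
    have := not_isUnit_zero this
    exact this.elim
  · push Not at h0
    obtain ⟨j, hj⟩ := h0
    have hg : IsUnit (Finset.univ.gcd u) := hu _ fun i => Finset.gcd_dvd (Finset.mem_univ i)
    have h1 : u j ∣ x j * Finset.univ.gcd u := by
      have : u j ∣ Finset.univ.gcd (fun i => x j * u i) :=
        Finset.dvd_gcd fun i _ => ⟨x i, by rw [mul_comm (u j), h]⟩
      exact this.trans (Finset.gcd_mul_left' Finset.univ u (x j)).dvd
    obtain ⟨b, hb⟩ := (hg.dvd_mul_right).1 h1
    refine ⟨b, fun i => mul_right_cancel₀ hj ?_⟩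
    rw [h, hb]; ring

/-! ### The bigrading of `𝕂[T][X]` -/

section Bigraded

variable {K : Type*} [Field K]

namespace IsBihomogeneous

variable {i j i' j' : ℕ} {F G : RingTX K}

lemma zero (i j : ℕ) : IsBihomogeneous i j (0 : RingTX K) :=
  ⟨isHomogeneous_zero _ _ _, fun m => by rw [coeff_zero]; exact isHomogeneous_zero _ _ _⟩

lemma add (hF : IsBihomogeneous i j F) (hG : IsBihomogeneous i j G) :
    IsBihomogeneous i j (F + G) :=
  ⟨hF.1.add hG.1, fun m => by rw [coeff_add]; exact (hF.2 m).add (hG.2 m)⟩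

lemma neg (hF : IsBihomogeneous i j F) : IsBihomogeneous i j (-F) :=
  ⟨hF.1.neg, fun m => by rw [coeff_neg]; exact (hF.2 m).neg⟩

lemma sub (hF : IsBihomogeneous i j F) (hG : IsBihomogeneous i j G) :
    IsBihomogeneous i j (F - G) := by
  rw [sub_eq_add_neg]; exact hF.add hG.neg

lemma mul (hF : IsBihomogeneous i j F) (hG : IsBihomogeneous i' j' G) :
    IsBihomogeneous (i + i') (j + j') (F * G) :=
  ⟨hF.1.mul hG.1, fun m => by
    rw [coeff_mul]
    exact IsHomogeneous.sum _ _ _ fun x _ => (hF.2 _).mul (hG.2 _)⟩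

lemma sum {ι : Type*} (s : Finset ι) (f : ι → RingTX K) (h : ∀ a ∈ s, IsBihomogeneous i j (f a)) :
    IsBihomogeneous i j (∑ a ∈ s, f a) :=
  Finset.sum_induction _ _ (fun _ _ => add) (zero i j) h

lemma of_C {c : RingT K} (hc : c.IsHomogeneous i) : IsBihomogeneous i 0 (C c : RingTX K) :=
  ⟨isHomogeneous_C _ _, fun m => by
    rw [coeff_C]; split_ifs; exacts [hc, isHomogeneous_zero _ _ _]⟩

lemma of_X (a : Fin 3) : IsBihomogeneous 0 1 (X a : RingTX K) :=
  ⟨isHomogeneous_X _ _, fun m => by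
    rw [coeff_X]; split_ifs; exacts [isHomogeneous_one _ _, isHomogeneous_zero _ _ _]⟩

lemma of_embX {f : RingX K} (hf : f.IsHomogeneous j) : IsBihomogeneous 0 j (embX f) :=
  ⟨hf.map _, fun m => by rw [embX, coeff_map]; exact isHomogeneous_C _ _⟩

lemma of_varT (a : Fin 2) : IsBihomogeneous 1 0 (varT K a) := of_C (isHomogeneous_X _ _)

lemma of_movingLine {s : Fin 3 → RingT K} (hs : ∀ a, (s a).IsHomogeneous i) :
    IsBihomogeneous i 1 (movingLine s) := by
  refine sum _ _ fun a _ => ?_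
  simpa using (of_C (hs a)).mul (of_X a)

lemma of_linForm (l : Fin 3 → K) : IsBihomogeneous 0 1 (linForm l) := by
  refine sum _ _ fun a _ => ?_
  simpa using (of_C (isHomogeneous_C (Fin 2) (l a))).mul (of_X a)

end IsBihomogeneous

lemma exists_sum_mul_of_mem_span_image {B ι : Type*} [CommRing B] {J : Finset ι} {gen : ι → B}
    {x : B} (h : x ∈ Ideal.span (gen '' J)) : ∃ c : ι → B, ∑ j ∈ J, c j * gen j = x := by
  classical
  obtain ⟨c, hc⟩ := (Submodule.mem_span_image_finset_iff_exists_fun _).1 h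
  refine ⟨fun j => if hj : j ∈ J then c ⟨j, hj⟩ else 0, ?_⟩
  rw [← hc, ← Finset.sum_coe_sort]
  exact Finset.sum_congr rfl fun j _ => by simp

/-- The bihomogeneous component of bidegree `(s, n)`. -/
noncomputable def bicomp (s n : ℕ) : RingTX K →+ RingTX K where
  toFun G := ∑ m ∈ (homogeneousComponent n G).support,
    monomial m (homogeneousComponent s (coeff m (homogeneousComponent n G)))
  map_zero' := by simp
  map_add' F G := by
    have key : ∀ (H : RingTX K) (m : Fin 3 →₀ ℕ), coeff m (∑ m ∈ H.support,
        monomial m (homogeneousComponent s (coeff m H))) = homogeneousComponent s (coeff m H) := by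
      intro H m
      rw [coeff_sum]
      simp only [coeff_monomial, Finset.sum_ite_eq']
      split_ifs with h
      · rfl
      · rw [notMem_support_iff.1 h, map_zero]
    ext1 m
    rw [coeff_add, key, key, key, map_add, coeff_add, map_add]

lemma coeff_bicomp (s n : ℕ) (G : RingTX K) (m : Fin 3 →₀ ℕ) :
    coeff m (bicomp s n G) = homogeneousComponent s (coeff m (homogeneousComponent n G)) := by
  simp only [bicomp, AddMonoidHom.coe_mk, ZeroHom.coe_mk]
  rw [coeff_sum]
  simp only [coeff_monomial, Finset.sum_ite_eq']
  split_ifs with h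
  · rfl
  · rw [notMem_support_iff.1 h, map_zero]

lemma bicomp_isBihomogeneous (s n : ℕ) (G : RingTX K) : IsBihomogeneous s n (bicomp s n G) := by
  refine ⟨fun m hm => ?_, fun m => ?_⟩
  · rw [coeff_bicomp] at hm
    by_contra h
    rw [(homogeneousComponent_isHomogeneous n G).coeff_eq_zero, map_zero] at hm
    · exact hm rfl
    · rwa [Finsupp.degree_eq_weight_one]
  · rw [coeff_bicomp]; exact homogeneousComponent_isHomogeneous _ _

lemma bicomp_mul_of_isBihomogeneous {a b : ℕ} (x : RingTX K) {F : RingTX K}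
    (hF : IsBihomogeneous a b F) (s n : ℕ) :
    bicomp s n (x * F) = if a ≤ s ∧ b ≤ n then bicomp (s - a) (n - b) x * F else 0 := by
  ext1 m
  rw [coeff_bicomp, homogeneousComponent_mul_of_isHomogeneous x hF.1]
  by_cases hb : b ≤ n
  · rw [if_pos hb, coeff_mul, map_sum]
    simp_rw [homogeneousComponent_mul_of_isHomogeneous _ (hF.2 _)]
    by_cases ha : a ≤ s
    · rw [if_pos ⟨ha, hb⟩, coeff_mul]
      simp_rw [if_pos ha, coeff_bicomp]
    · rw [if_neg (fun h => ha h.1)]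
      simp [ha]
  · rw [if_neg hb, if_neg (fun h => hb h.2)]
    simp

lemma IsBihomogeneous.bicomp_self {s n : ℕ} {F : RingTX K} (hF : IsBihomogeneous s n F) :
    bicomp s n F = F := by
  ext1 m
  rw [coeff_bicomp, homogeneousComponent_eq_self hF.1, homogeneousComponent_eq_self (hF.2 m)]

/-- A polynomial is the sum of its bihomogeneous components. -/
lemma sum_bicomp (G : RingTX K) : ∃ N M : ℕ,
    G = ∑ n ∈ Finset.range N, ∑ s ∈ Finset.range M, bicomp s n G := by
  refine ⟨G.totalDegree + 1, (G.support.sup fun m => (coeff m G).totalDegree) + 1, ?_⟩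
  ext1 m
  simp_rw [coeff_sum, coeff_bicomp, coeff_homogeneousComponent]
  have h1 : ∀ n, ∑ s ∈ Finset.range ((G.support.sup fun m => (coeff m G).totalDegree) + 1),
      homogeneousComponent s (if m.degree = n then coeff m G else 0) =
      if m.degree = n then coeff m G else 0 := by
    intro n
    split_ifs with h
    · conv_rhs => rw [← sum_homogeneousComponent (coeff m G)]
      symm
      by_cases hm : m ∈ G.support
      · apply Finset.sum_subset
        · intro x hx
          have := Finset.le_sup (f := fun m => (coeff m G).totalDegree) hm
          simp only [Finset.mem_range] at hx ⊢
          omega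
        · intro x _ hx
          apply homogeneousComponent_eq_zero
          simpa using hx
      · rw [notMem_support_iff.1 hm]; simp
    · simp
  simp_rw [h1]
  rw [Finset.sum_ite_eq]
  split_ifs with h
  · rfl
  · refine notMem_support_iff.1 fun hm => h ?_
    rw [Finset.mem_range, Nat.lt_succ_iff, Finsupp.degree_apply]
    exact le_totalDegree hm

/-- A bihomogeneous element of an ideal generated by bihomogeneous elements is a combination of
these with bihomogeneous coefficients of the right bidegrees. -/
lemma IsBihomogeneous.exists_eq_sum {ι : Type*} {J : Finset ι} {gen : ι → RingTX K}
    {sd nd : ι → ℕ} (hgen : ∀ j ∈ J, IsBihomogeneous (sd j) (nd j) (gen j)) {s n : ℕ}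
    {G : RingTX K} (hG : IsBihomogeneous s n G) (h : G ∈ Ideal.span (gen '' J)) :
    ∃ c : ι → RingTX K, G = ∑ j ∈ J, c j * gen j ∧ ∀ j ∈ J, c j = 0 ∨
      (sd j ≤ s ∧ nd j ≤ n ∧ IsBihomogeneous (s - sd j) (n - nd j) (c j)) := by
  classical
  obtain ⟨c, hc⟩ := exists_sum_mul_of_mem_span_image h
  refine ⟨fun j => if sd j ≤ s ∧ nd j ≤ n then bicomp (s - sd j) (n - nd j) (c j) else 0, ?_, ?_⟩
  · rw [← hG.bicomp_self, ← hc, map_sum]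
    refine Finset.sum_congr rfl fun j hj => ?_
    rw [bicomp_mul_of_isBihomogeneous _ (hgen j hj)]
    simp only [ite_mul, zero_mul]
  · intro j _
    dsimp only
    split_ifs with h
    · exact Or.inr ⟨h.1, h.2, bicomp_isBihomogeneous _ _ _⟩
    · exact Or.inl rfl

lemma embX_injective : Function.Injective (embX (K := K)) :=
  map_injective _ (C_injective _ _)

lemma IsBihomogeneous.exists_embX {n : ℕ} {F : RingTX K} (h : IsBihomogeneous 0 n F) :
    ∃ f : RingX K, f.IsHomogeneous n ∧ F = embX f := by
  have hF : F ∈ Set.range (embX (K := K)) := by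
    rw [embX, mem_range_map_iff_coeffs_subset]
    intro x hx
    obtain ⟨m, _, rfl⟩ := mem_coeffs_iff.1 hx
    exact ⟨coeff 0 (coeff m F), by
      have := (totalDegree_zero_iff_isHomogeneous _).2 (h.2 m)
      exact (totalDegree_eq_zero_iff_eq_C.1 this).symm⟩
  obtain ⟨f, rfl⟩ := hF
  exact ⟨f, h.1.of_map (C_injective _ _), rfl⟩

/-- A form of positive degree in `T` is a combination of `T₀` and `T₁`. -/
lemma exists_eq_X_mul_add {e : ℕ} {c : RingT K} (hc : c.IsHomogeneous (e + 1)) :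
    ∃ a b : RingT K, a.IsHomogeneous e ∧ b.IsHomogeneous e ∧ c = X 0 * a + X 1 * b := by
  have h : c ∈ Ideal.span ((fun i : Fin 2 => (X i : RingT K)) '' (Finset.univ : Finset (Fin 2))) := by
    rw [c.as_sum]
    refine Ideal.sum_mem _ fun m hm => ?_
    have hdeg : m.degree = e + 1 := by
      rw [Finsupp.degree_eq_weight_one]; exact hc (mem_support_iff.1 hm)
    have : ∃ i, m i ≠ 0 := by
      by_contra hcon
      push Not at hcon
      have : m = 0 := Finsupp.ext hcon
      rw [this] at hdeg
      simp at hdeg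
    obtain ⟨i, hi⟩ := this
    have hdvd : (X i : RingT K) ∣ monomial m (coeff m c) := X_dvd_monomial.2 (Or.inr hi)
    exact Ideal.mem_of_dvd _ hdvd (Ideal.subset_span ⟨i, by simp, rfl⟩)
  obtain ⟨c', hc'⟩ := exists_sum_mul_of_mem_span_image h
  refine ⟨homogeneousComponent e (c' 0), homogeneousComponent e (c' 1),
    homogeneousComponent_isHomogeneous _ _, homogeneousComponent_isHomogeneous _ _, ?_⟩
  rw [← homogeneousComponent_eq_self hc, ← hc', map_sum, Fin.sum_univ_two]
  simp_rw [homogeneousComponent_mul_of_isHomogeneous _ (isHomogeneous_X K _)]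
  simp [mul_comm]

/-- A polynomial of bidegree `(i + 1, j)` is a combination of `T₀` and `T₁`. -/
lemma IsBihomogeneous.exists_split {i j : ℕ} {P : Fin 2 → RingT K} {r : ℕ}
    (hP : ∀ c : RingT K, c.IsHomogeneous (i + r) →
      ∃ a b : RingT K, a.IsHomogeneous i ∧ b.IsHomogeneous i ∧ c = P 0 * a + P 1 * b)
    {F : RingTX K} (hF : IsBihomogeneous (i + r) j F) :
    ∃ G H : RingTX K, IsBihomogeneous i j G ∧ IsBihomogeneous i j H ∧
      F = C (P 0) * G + C (P 1) * H := by
  -- The splitting is done on each `X`-coefficient. The pair `P` is `(T₀, T₁)` with `r = 1`, or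
  -- `(p₀, p₁)` with `r = 2`.
  choose a b ha hb hab using fun m => hP _ (hF.2 m)
  have hbi : ∀ f : (Fin 3 →₀ ℕ) → RingT K, (∀ m, (f m).IsHomogeneous i) →
      IsBihomogeneous i j (∑ m ∈ F.support, monomial m (f m)) := by
    intro f hf
    refine IsBihomogeneous.sum _ _ fun m hm => ⟨isHomogeneous_monomial _ ?_, fun m' => ?_⟩
    · rw [Finsupp.degree_eq_weight_one]; exact hF.1 (mem_support_iff.1 hm)
    · rw [coeff_monomial]; split_ifs; exacts [hf m, isHomogeneous_zero _ _ _]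
  refine ⟨_, _, hbi a ha, hbi b hb, ?_⟩
  conv_lhs => rw [F.as_sum]
  rw [Finset.mul_sum, Finset.mul_sum, ← Finset.sum_add_distrib]
  refine Finset.sum_congr rfl fun m _ => ?_
  rw [C_mul_monomial, C_mul_monomial, ← map_add, ← hab]

lemma varT_mul_embX_inj {a b a' b' : RingX K}
    (h : varT K 0 * embX a + varT K 1 * embX b = varT K 0 * embX a' + varT K 1 * embX b') :
    a = a' ∧ b = b' := by
  have key : ∀ m, (X 0 * C (coeff m a) + X 1 * C (coeff m b) : RingT K) =
      X 0 * C (coeff m a') + X 1 * C (coeff m b') := by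
    intro m
    simpa [varT, embX, coeff_C_mul, coeff_map] using congrArg (coeff m) h
  constructor
  · ext m
    have := congrArg (eval ![1, 0]) (key m)
    simpa using this
  · ext m
    have := congrArg (eval ![0, 1]) (key m)
    simpa using this

end Bigraded

/-! ### Binary forms modulo two coprime quadratic forms -/

section BinaryForms

variable {K : Type*} [Field K]

lemma MvPolynomial.IsHomogeneous.not_isUnit_of_pos {σ : Type*} {c : MvPolynomial σ K} {n : ℕ}
    (hc : c.IsHomogeneous (n + 1)) : ¬ IsUnit c := by
  intro hu
  obtain ⟨r, hr, rfl⟩ := MvPolynomial.isUnit_iff_eq_C_of_isReduced.1 hu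
  have h0 : (C r : MvPolynomial σ K) ≠ 0 := hu.ne_zero
  have := (isHomogeneous_C σ r).inj_right hc h0
  omega

lemma eq_zero_of_dvd_of_degree_lt {σ : Type*} {a b : MvPolynomial σ K} {m n : ℕ}
    (ha : a.IsHomogeneous m) (hb : b.IsHomogeneous n) (hnm : n < m) (h : a ∣ b) : b = 0 := by
  obtain ⟨t, rfl⟩ := h
  by_contra h0
  have ha0 := left_ne_zero_of_mul h0
  have ht0 := right_ne_zero_of_mul h0
  have h1 := hb.totalDegree h0
  rw [totalDegree_mul_of_isDomain ha0 ht0, ha.totalDegree ha0] at h1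
  omega

variable {p₀ p₁ : RingT K}

/-- Two coprime binary quadrics generate all forms of degree at least 3. In degree 3 a map between
spaces of dimension `2 + 2` and `4` is injective by coprimality; higher degrees follow by splitting
off a variable. -/
lemma exists_eq_mul_add_mul_of_isRelPrime (h0 : p₀.IsHomogeneous 2) (h1 : p₁.IsHomogeneous 2)
    (hrel : IsRelPrime p₀ p₁) {e : ℕ} {c : RingT K} (hc : c.IsHomogeneous (e + 1 + 2)) :
    ∃ a b : RingT K, a.IsHomogeneous (e + 1) ∧ b.IsHomogeneous (e + 1) ∧
      c = p₀ * a + p₁ * b := by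
  have hp0 : p₀ ≠ 0 := by
    rintro rfl
    exact h1.not_isUnit_of_pos (isRelPrime_zero_left.1 hrel)
  induction e generalizing c with
  | zero =>
    let f : (homogeneousSubmodule (Fin 2) K 1 × homogeneousSubmodule (Fin 2) K 1) →ₗ[K]
        homogeneousSubmodule (Fin 2) K 3 :=
      LinearMap.codRestrict _
        (((LinearMap.mulLeft K p₀).comp (Submodule.subtype _)).coprod
          ((LinearMap.mulLeft K p₁).comp (Submodule.subtype _)))
        (fun x => (h0.mul x.1.2).add (h1.mul x.2.2))
    have hfapp : ∀ x, (f x : RingT K) = p₀ * x.1 + p₁ * x.2 := fun x => rfl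
    have hinj : Function.Injective f := by
      rw [← LinearMap.ker_eq_bot, LinearMap.ker_eq_bot']
      intro x hx
      have hx' : p₀ * x.1 + p₁ * x.2 = 0 := by rw [← hfapp, hx]; rfl
      have hdvd : p₀ ∣ (x.2 : RingT K) :=
        hrel.dvd_of_dvd_mul_left ⟨-x.1, by linear_combination hx'⟩
      have h2 : (x.2 : RingT K) = 0 :=
        eq_zero_of_dvd_of_degree_lt h0 x.2.2 (by norm_num) hdvd
      have h3 : (x.1 : RingT K) = 0 := by
        rw [h2, mul_zero, add_zero] at hx'
        exact (mul_eq_zero.1 hx').resolve_left hp0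
      exact Prod.ext (Subtype.ext h3) (Subtype.ext h2)
    have hsurj : Function.Surjective f := by
      refine (LinearMap.injective_iff_surjective_of_finrank_eq_finrank ?_).1 hinj
      rw [Module.finrank_prod, finrank_homogeneousSubmodule, finrank_homogeneousSubmodule]
      rfl
    obtain ⟨x, hx⟩ := hsurj ⟨c, hc⟩
    refine ⟨x.1, x.2, x.1.2, x.2.2, ?_⟩
    rw [← hfapp, hx]
  | succ e ih =>
    obtain ⟨a, b, ha, hb, hab⟩ := exists_eq_X_mul_add (e := e + 1 + 2) (c := c) (by
      convert! hc using 1)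
    obtain ⟨a0, a1, ha0, ha1, haa⟩ := ih ha
    obtain ⟨b0, b1, hb0, hb1, hbb⟩ := ih hb
    refine ⟨X 0 * a0 + X 1 * b0, X 0 * a1 + X 1 * b1, ?_, ?_, ?_⟩
    · rw [add_comm (e + 1) 1]
      exact ((isHomogeneous_X K _).mul ha0).add ((isHomogeneous_X K _).mul hb0)
    · rw [add_comm (e + 1) 1]
      exact ((isHomogeneous_X K _).mul ha1).add ((isHomogeneous_X K _).mul hb1)
    · rw [hab, haa, hbb]; ring

/-- Degree 2 is where `⟨p₀, p₁⟩` misses one dimension: binary quadrics form a space of dimension 3,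
and any `J` outside the span of `p₀, p₁` completes a basis. -/
lemma exists_eq_combination_of_degree_two (h0 : p₀.IsHomogeneous 2) (h1 : p₁.IsHomogeneous 2)
    (hrel : IsRelPrime p₀ p₁) {J : RingT K} (hJ : J.IsHomogeneous 2)
    (hJ' : ∀ a b : K, J ≠ C a * p₀ + C b * p₁) {c : RingT K} (hc : c.IsHomogeneous 2) :
    ∃ a₀ a₁ a₂ : K, c = C a₀ * p₀ + C a₁ * p₁ + C a₂ * J := by
  let v : Fin 3 → homogeneousSubmodule (Fin 2) K 2 := ![⟨p₀, h0⟩, ⟨p₁, h1⟩, ⟨J, hJ⟩]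
  have hsum : ∀ a : Fin 3 → K, ((∑ i, a i • v i : homogeneousSubmodule (Fin 2) K 2) : RingT K) =
      C (a 0) * p₀ + C (a 1) * p₁ + C (a 2) * J := by
    intro a
    simp [v, Fin.sum_univ_three, MvPolynomial.smul_eq_C_mul]
  have hli : LinearIndependent K v := by
    rw [Fintype.linearIndependent_iff]
    intro a ha
    have ha' : C (a 0) * p₀ + C (a 1) * p₁ + C (a 2) * J = 0 := by rw [← hsum, ha]; rfl
    have h2 : a 2 = 0 := by
      by_contra h2
      have e : (C (a 2)⁻¹ * C (a 2) : RingT K) = 1 := by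
        rw [← C_mul, inv_mul_cancel₀ h2, C_1]
      refine hJ' (-((a 2)⁻¹ * a 0)) (-((a 2)⁻¹ * a 1)) ?_
      simp only [C_neg, C_mul]
      linear_combination C (a 2)⁻¹ * ha' - J * e
    rw [h2, C_0, zero_mul, add_zero] at ha'
    have h3 : a 0 = 0 := by
      by_contra h3
      have e : (C (a 0)⁻¹ * C (a 0) : RingT K) = 1 := by
        rw [← C_mul, inv_mul_cancel₀ h3, C_1]
      refine h1.not_isUnit_of_pos (hrel ⟨-C (a 0)⁻¹ * C (a 1), ?_⟩ dvd_rfl)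
      linear_combination C (a 0)⁻¹ * ha' - p₀ * e
    rw [h3, C_0, zero_mul, zero_add] at ha'
    have h4 : a 1 = 0 := by
      rcases mul_eq_zero.1 ha' with h | h
      · exact (C_eq_zero).1 h
      · rw [h] at hrel
        exact (h0.not_isUnit_of_pos (isRelPrime_zero_right.1 hrel)).elim
    intro i
    fin_cases i <;> assumption
  have htop := hli.span_eq_top_of_card_eq_finrank' (by
    rw [finrank_homogeneousSubmodule]; rfl)
  have hmem : (⟨c, hc⟩ : homogeneousSubmodule (Fin 2) K 2) ∈ Submodule.span K (Set.range v) := by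
    rw [htop]; trivial
  obtain ⟨a, ha⟩ := (Submodule.mem_span_range_iff_exists_fun K).1 hmem
  refine ⟨a 0, a 1, a 2, ?_⟩
  rw [← hsum, ha]

end BinaryForms

/-! ### Syzygies and the `μ`-basis -/

section Syzygies

variable {K : Type*} [Field K] {u : Fin 3 → RingT K}

lemma mem_syzygies_iff {s : Fin 3 → RingT K} : s ∈ syzygies u ↔ ∑ i, s i * u i = 0 := by
  simp [syzygies, Fintype.linearCombination_apply]

lemma movingLine_aeval (s : Fin 3 → RingT K) :
    aeval u (movingLine s) = ∑ i, s i * u i := by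
  simp [movingLine]

lemma homogeneousComponent_mem_syzygies {d : ℕ} (hu : ∀ i, (u i).IsHomogeneous d)
    {s : Fin 3 → RingT K} (hs : s ∈ syzygies u) (m : ℕ) :
    (fun i => homogeneousComponent m (s i)) ∈ syzygies u := by
  rw [mem_syzygies_iff] at hs ⊢
  have := congrArg (homogeneousComponent (m + d)) hs
  rw [map_sum, map_zero] at this
  simpa [homogeneousComponent_mul_of_isHomogeneous _ (hu _)] using this

lemma eq_zero_of_degree_lt_muDegree {s : Fin 3 → RingT K} (hs : s ∈ syzygies u) {m : ℕ}
    (hm : ∀ i, (s i).IsHomogeneous m) (hlt : m < muDegree u) : s = 0 := by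
  by_contra h
  exact Nat.notMem_of_lt_sInf hlt ⟨s, hs, h, hm⟩

lemma exists_of_muDegree_pos (h : 0 < muDegree u) :
    ∃ s ∈ syzygies u, s ≠ 0 ∧ ∀ i, (s i).IsHomogeneous (muDegree u) := by
  refine Nat.sInf_mem (s := {m | ∃ s ∈ syzygies u, s ≠ 0 ∧ ∀ i, (s i).IsHomogeneous m}) ?_
  by_contra hne
  rw [Set.not_nonempty_iff_eq_empty] at hne
  rw [muDegree, hne, Nat.sInf_empty] at h
  exact h.ne rfl

/-- A syzygy of minimal degree has coprime entries. -/
lemma isUnit_of_dvd_of_muDegree {d : ℕ} (hu : ∀ i, (u i).IsHomogeneous d) {P : Fin 3 → RingT K}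
    (hP : P ∈ syzygies u) (hP0 : P ≠ 0) (hhom : ∀ i, (P i).IsHomogeneous (muDegree u))
    {g : RingT K} (hg : ∀ i, g ∣ P i) : IsUnit g := by
  choose x hx using hg
  have hg0 : g ≠ 0 := by
    rintro rfl
    exact hP0 (funext fun i => by rw [hx, zero_mul]; rfl)
  have hxs : x ∈ syzygies u := by
    rw [mem_syzygies_iff] at hP ⊢
    simp_rw [hx, mul_assoc, ← Finset.mul_sum] at hP
    exact (mul_eq_zero.1 hP).resolve_left hg0
  by_contra hnu
  have hdeg : 0 < g.totalDegree := by
    rw [Nat.pos_iff_ne_zero]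
    intro h
    obtain ⟨r, rfl⟩ : ∃ r, g = C r := ⟨_, totalDegree_eq_zero_iff_eq_C.1 h⟩
    refine hnu (IsUnit.map C (IsUnit.mk0 r ?_))
    rintro rfl
    exact hg0 C_0
  refine hP0 (funext fun i => ?_)
  suffices x i = 0 by rw [hx, this, mul_zero]; rfl
  by_contra hxi
  have h1 : (P i).totalDegree = muDegree u :=
    (hhom i).totalDegree (by rw [hx]; exact mul_ne_zero hg0 hxi)
  rw [hx, totalDegree_mul_of_isDomain hg0 hxi] at h1
  refine hxi ?_
  -- A nonunit `g` has positive degree, so `x i` has degree below `μ`. Its components belong to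
  -- syzygies of degree below `μ`, which vanish.
  rw [← sum_homogeneousComponent (x i)]
  refine Finset.sum_eq_zero fun m hm => ?_
  rw [Finset.mem_range] at hm
  exact congrFun (eq_zero_of_degree_lt_muDegree (homogeneousComponent_mem_syzygies hu hxs m)
    (fun i => homogeneousComponent_isHomogeneous m (x i)) (by omega)) i

/-- There are at least `2 m + 2 - d` independent syzygies of degree `m`. -/
lemma exists_syzygy_notMem {d : ℕ} (hu : ∀ i, (u i).IsHomogeneous d) (m : ℕ)
    (V : Submodule K (Fin 3 → homogeneousSubmodule (Fin 2) K m))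
    (hV : Module.finrank K V + (m + d + 1) < 3 * (m + 1)) :
    ∃ s : Fin 3 → homogeneousSubmodule (Fin 2) K m,
      (fun i => (s i : RingT K)) ∈ syzygies u ∧ s ∉ V := by
  let f : (Fin 3 → homogeneousSubmodule (Fin 2) K m) →ₗ[K]
      homogeneousSubmodule (Fin 2) K (m + d) :=
    LinearMap.codRestrict _
      (∑ i, (LinearMap.mulRight K (u i)).comp ((Submodule.subtype _).comp (LinearMap.proj i)))
      (fun s => by
        rw [LinearMap.sum_apply]
        exact Submodule.sum_mem _ fun i _ => (s i).2.mul (hu i))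
  have hfapp : ∀ s, (f s : RingT K) = ∑ i, (s i : RingT K) * u i := by
    intro s
    simp [f, LinearMap.sum_apply]
  have h1 := LinearMap.finrank_range_add_finrank_ker f
  have h2 : Module.finrank K (LinearMap.range f) ≤ m + d + 1 := by
    refine (Submodule.finrank_le _).trans ?_
    rw [finrank_homogeneousSubmodule]
    have : (2 + (m + d) - 1) = (m + d) + 1 := by omega
    rw [this, Nat.choose_succ_self_right]
  have h3 : Module.finrank K (Fin 3 → homogeneousSubmodule (Fin 2) K m) = 3 * (m + 1) := by
    rw [Module.finrank_pi_fintype, Finset.sum_const, finrank_homogeneousSubmodule]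
    have : (2 + m - 1) = m + 1 := by omega
    rw [this, Nat.choose_succ_self_right]
    simp
  -- The syzygies of degree `m` form the kernel, of dimension at least `3(m+1) - (m+d+1)`, which
  -- exceeds that of the subspace `V` to be avoided.
  have h4 : ¬ LinearMap.ker f ≤ V := fun hle => by
    have := Submodule.finrank_mono hle
    omega
  obtain ⟨s, hs, hsV⟩ := SetLike.not_le_iff_exists.1 h4
  refine ⟨s, mem_syzygies_iff.2 ?_, hsV⟩
  rw [← hfapp, LinearMap.mem_ker.1 hs]
  rfl

lemma proportional_of_cross_eq_zero {v w : Fin 3 → RingT K} (h0 : v 1 * w 2 - v 2 * w 1 = 0)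
    (h1 : v 2 * w 0 - v 0 * w 2 = 0) (h2 : v 0 * w 1 - v 1 * w 0 = 0) (i j : Fin 3) :
    v i * w j = v j * w i := by
  have e : ∀ i j, (i = 0 ∧ j = 1) ∨ (i = 0 ∧ j = 2) ∨ (i = 1 ∧ j = 2) →
      v i * w j = v j * w i := by
    rintro i j (⟨rfl, rfl⟩ | ⟨rfl, rfl⟩ | ⟨rfl, rfl⟩)
    · linear_combination h2
    · linear_combination - h1
    · linear_combination h0
  rcases lt_trichotomy i j with h | rfl | h
  · exact e i j (by omega)
  · rfl
  · exact (e j i (by omega)).symm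

/-- In rank 3, the cross product of two syzygies is orthogonal to everything they are orthogonal to,
hence proportional to `u`, and `u` is primitive. -/
lemma exists_cross_eq (hcop : ∀ g : RingT K, (∀ i, g ∣ u i) → IsUnit g) {v w : Fin 3 → RingT K}
    (hv : v ∈ syzygies u) (hw : w ∈ syzygies u) :
    ∃ b, v 1 * w 2 - v 2 * w 1 = b * u 0 ∧ v 2 * w 0 - v 0 * w 2 = b * u 1 ∧
      v 0 * w 1 - v 1 * w 0 = b * u 2 := by
  rw [mem_syzygies_iff, Fin.sum_univ_three] at hv hw
  obtain ⟨b, hb⟩ := exists_smul_of_proportional hcop (proportional_of_cross_eq_zero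
    (v := ![v 1 * w 2 - v 2 * w 1, v 2 * w 0 - v 0 * w 2, v 0 * w 1 - v 1 * w 0]) (w := u)
    (by dsimp; linear_combination w 0 * hv - v 0 * hw)
    (by dsimp; linear_combination w 1 * hv - v 1 * hw)
    (by dsimp; linear_combination w 2 * hv - v 2 * hw))
  exact ⟨b, hb 0, hb 1, hb 2⟩

/-- For `k = 2`, triples of linear forms have dimension 6 and quartics dimension 5, so a linear
syzygy would exist. -/
lemma three_le_of_muDegree {k d : ℕ} (hk : 2 ≤ k) (hd : d = 2 * k - 1)
    (hu : ∀ i, (u i).IsHomogeneous d) (hμ : muDegree u = 2) : 3 ≤ k := by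
  by_contra hlt
  have hk2 : k = 2 := by omega
  subst hk2
  obtain ⟨s, hs, hs0⟩ := exists_syzygy_notMem hu 1 ⊥ (by rw [finrank_bot]; omega)
  refine hs0 ?_
  rw [Submodule.mem_bot]
  have := eq_zero_of_degree_lt_muDegree hs (fun i => (s i).2) (by omega)
  exact funext fun i => Subtype.ext (congrFun this i)

/-- `P` is a syzygy of minimal degree and `Q` one of degree `d - 2` that is not a multiple of `P`.
By degrees `P × Q` is a nonzero constant times `u`, which forces `P, Q` to be a basis. -/
lemma exists_isMuBasis {d : ℕ} (hd : 5 ≤ d) (hu : ∀ i, (u i).IsHomogeneous d)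
    (hcop : ∀ g : RingT K, (∀ i, g ∣ u i) → IsUnit g) (hμ : muDegree u = 2) :
    ∃ P Q, IsMuBasis u d 2 P Q := by
  obtain ⟨P, hP, hP0, hPhom⟩ := exists_of_muDegree_pos (u := u) (by omega)
  have hPprim : ∀ g : RingT K, (∀ i, g ∣ P i) → IsUnit g :=
    fun g hg => isUnit_of_dvd_of_muDegree hu hP hP0 hPhom hg
  rw [hμ] at hPhom
  obtain ⟨e, rfl⟩ : ∃ e, d = e + 4 := ⟨d - 4, by omega⟩
  let f : homogeneousSubmodule (Fin 2) K e →ₗ[K] (Fin 3 → homogeneousSubmodule (Fin 2) K (e + 2)) :=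
    LinearMap.pi fun i => LinearMap.codRestrict _
      ((LinearMap.mulRight K (P i)).comp (Submodule.subtype _)) (fun h => h.2.mul (hPhom i))
  -- With `d = e + 4`, the multiples of `P` in degree `e + 2` have dimension at most `e + 1`, and
  -- the syzygies at least `e + 2`.
  obtain ⟨s, hs, hsf⟩ := exists_syzygy_notMem hu (e + 2) (LinearMap.range f) (by
    have h1 := LinearMap.finrank_range_le f
    rw [finrank_homogeneousSubmodule] at h1
    have h2 : 2 + e - 1 = e + 1 := by omega
    rw [h2, Nat.choose_succ_self_right] at h1
    omega)
  set Q : Fin 3 → RingT K := fun i => (s i : RingT K) with hQdef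
  have hQhom : ∀ i, (Q i).IsHomogeneous (e + 2) := fun i => (s i).2
  have hnot : ¬ ∃ b, ∀ i, Q i = b * P i := by
    rintro ⟨b, hb⟩
    refine hsf ⟨⟨homogeneousComponent e b, homogeneousComponent_isHomogeneous _ _⟩, ?_⟩
    refine funext fun i => Subtype.ext ?_
    change homogeneousComponent e b * P i = Q i
    have := homogeneousComponent_mul_of_isHomogeneous b (hPhom i) (e + 2)
    rw [← hb, homogeneousComponent_eq_self (hQhom i), if_pos (by omega), Nat.add_sub_cancel] at this
    exact this.symm
  obtain ⟨c, hc0, hc1, hc2⟩ := exists_cross_eq hcop hP hs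
  have hcne : c ≠ 0 := by
    rintro rfl
    rw [zero_mul] at hc0 hc1 hc2
    refine hnot (exists_smul_of_proportional hPprim fun i j => ?_)
    have := proportional_of_cross_eq_zero hc0 hc1 hc2 j i
    linear_combination this
  -- Both `P × Q` and `u` have degree `e + 4`, so `c` has degree 0.
  have hcu : ∃ r, r * c = 1 := by
    have hne : ∃ i, u i ≠ 0 := by
      by_contra hcon
      push Not at hcon
      exact not_isUnit_zero (hcop 0 fun i => by rw [hcon i])
    obtain ⟨i, hi⟩ := hne
    have hhom : (u i * c).IsHomogeneous (e + 4) := by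
      rw [mul_comm]
      have hm : ∀ a b, (P a * Q b).IsHomogeneous (e + 4) := fun a b => by
        have := (hPhom a).mul (hQhom b)
        rwa [show 2 + (e + 2) = e + 4 by ring] at this
      fin_cases i
      · exact hc0 ▸ (hm 1 2).sub (hm 2 1)
      · exact hc1 ▸ (hm 2 0).sub (hm 0 2)
      · exact hc2 ▸ (hm 0 1).sub (hm 1 0)
    rcases (hu i).of_mul_left hi hhom with h | ⟨e', he', h⟩
    · exact (hcne h).elim
    · have he0 : e' = 0 := by omega
      subst he0
      have h2 := totalDegree_eq_zero_iff_eq_C.1 ((totalDegree_zero_iff_isHomogeneous _).2 h)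
      have h3 : coeff 0 c ≠ 0 := fun h4 => hcne (by rw [h2, h4, C_0])
      refine ⟨C (coeff 0 c)⁻¹, ?_⟩
      conv_lhs => rw [h2]
      rw [← C_mul, coeff_C, if_pos rfl, inv_mul_cancel₀ h3, C_1]
  obtain ⟨r, hr⟩ := hcu
  refine ⟨P, Q, hPhom, fun i => ?_, ?_, le_antisymm ?_ ?_⟩
  · simpa using hQhom i
  · rw [LinearIndependent.pair_iff]
    intro a b hab
    have hab' : ∀ i, a * P i + b * Q i = 0 := fun i => congrFun hab i
    have hne : ∃ i, u i ≠ 0 := by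
      by_contra hcon
      push Not at hcon
      exact not_isUnit_zero (hcop 0 fun i => by rw [hcon i])
    have ha : ∀ i, a * (c * u i) = 0 := by
      intro i
      fin_cases i
      · exact hc0 ▸ (by linear_combination Q 2 * hab' 1 - Q 1 * hab' 2)
      · exact hc1 ▸ (by linear_combination Q 0 * hab' 2 - Q 2 * hab' 0)
      · exact hc2 ▸ (by linear_combination Q 1 * hab' 0 - Q 0 * hab' 1)
    have hb : ∀ i, b * (c * u i) = 0 := by
      intro i
      fin_cases i
      · exact hc0 ▸ (by linear_combination - P 2 * hab' 1 + P 1 * hab' 2)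
      · exact hc1 ▸ (by linear_combination - P 0 * hab' 2 + P 2 * hab' 0)
      · exact hc2 ▸ (by linear_combination - P 1 * hab' 0 + P 0 * hab' 1)
    obtain ⟨i, hi⟩ := hne
    exact ⟨(mul_eq_zero.1 (ha i)).resolve_right (mul_ne_zero hcne hi),
      (mul_eq_zero.1 (hb i)).resolve_right (mul_ne_zero hcne hi)⟩
  · rw [Submodule.span_le]
    rintro x (rfl | rfl)
    · exact hP
    · exact hs
  · intro t ht
    -- If `t × P = b u` then `t + b r Q` has zero cross product with `P`, since `Q × P = -c u` and
    -- `r c = 1`. It is thus a multiple of the primitive vector `P`.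
    obtain ⟨b, hb0, hb1, hb2⟩ := exists_cross_eq hcop ht hP
    obtain ⟨h, hh⟩ := exists_smul_of_proportional (u := P) (x := fun i => t i + b * r * Q i) hPprim
      (proportional_of_cross_eq_zero (v := fun i => t i + b * r * Q i)
        (by linear_combination hb0 - b * r * hc0 - b * u 0 * hr)
        (by linear_combination hb1 - b * r * hc1 - b * u 1 * hr)
        (by linear_combination hb2 - b * r * hc2 - b * u 2 * hr))
    rw [Submodule.mem_span_pair]
    refine ⟨h, -(b * r), funext fun i => ?_⟩
    simp only [Pi.add_apply, Pi.smul_apply, smul_eq_mul]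
    linear_combination - hh i

namespace IsMuBasis

variable {d μ : ℕ} {P Q : Fin 3 → RingT K}

lemma mem_left (h : IsMuBasis u d μ P Q) : P ∈ syzygies u := by
  rw [← h.span_eq]; exact Submodule.subset_span (by simp)

lemma mem_right (h : IsMuBasis u d μ P Q) : Q ∈ syzygies u := by
  rw [← h.span_eq]; exact Submodule.subset_span (by simp)

lemma exists_combination (h : IsMuBasis u d μ P Q) {s : Fin 3 → RingT K} (hs : s ∈ syzygies u) :
    ∃ a b, ∀ i, s i = a * P i + b * Q i := by
  rw [← h.span_eq, Submodule.mem_span_pair] at hs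
  obtain ⟨a, b, rfl⟩ := hs
  exact ⟨a, b, fun i => rfl⟩

lemma combination_eq_zero (h : IsMuBasis u d μ P Q) {a b : RingT K}
    (hab : ∀ i, a * P i + b * Q i = 0) : a = 0 ∧ b = 0 :=
  LinearIndependent.pair_iff.1 h.indep a b (funext hab)

lemma left_ne_zero (h : IsMuBasis u d μ P Q) : P ≠ 0 := h.indep.ne_zero (0 : Fin 2)

/-- Dividing `P` by `g` leaves a syzygy `aP + bQ`, and independence of `P, Q` gives `g a = 1`. -/
lemma isUnit_of_dvd (h : IsMuBasis u d μ P Q) {g : RingT K} (hg : ∀ i, g ∣ P i) : IsUnit g := by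
  choose x hx using hg
  have hg0 : g ≠ 0 := by
    rintro rfl
    exact h.left_ne_zero (funext fun i => by rw [hx, zero_mul]; rfl)
  have hxs : x ∈ syzygies u := by
    have hP := h.mem_left
    rw [mem_syzygies_iff] at hP ⊢
    simp_rw [hx, mul_assoc, ← Finset.mul_sum] at hP
    exact (mul_eq_zero.1 hP).resolve_left hg0
  obtain ⟨a, b, hab⟩ := h.exists_combination hxs
  have := (h.combination_eq_zero (a := g * a - 1) (b := g * b) fun i => by
    linear_combination - g * hab i - hx i).1
  exact IsUnit.of_mul_eq_one a (by linear_combination this)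

/-- Syzygies of degree less than `d - μ` are multiples of `P`. -/
lemma exists_eq_mul_of_degree_lt (h : IsMuBasis u d μ P Q) {s : Fin 3 → RingT K}
    (hs : s ∈ syzygies u) {m : ℕ} (hm : ∀ i, (s i).IsHomogeneous m) (hlt : m < d - μ) :
    ∃ a, ∀ i, s i = a * P i := by
  obtain ⟨a, b, hab⟩ := h.exists_combination hs
  have key : ∀ i, s i = if μ ≤ m then homogeneousComponent (m - μ) a * P i else 0 := by
    intro i
    have h1 := congrArg (homogeneousComponent m) (hab i)
    rw [homogeneousComponent_eq_self (hm i), map_add,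
      homogeneousComponent_mul_of_isHomogeneous _ (h.homP i),
      homogeneousComponent_mul_of_isHomogeneous _ (h.homQ i), if_neg (not_le.2 hlt), add_zero] at h1
    exact h1
  by_cases hμm : μ ≤ m
  · exact ⟨_, fun i => by rw [key, if_pos hμm]⟩
  · exact ⟨0, fun i => by rw [key, if_neg hμm, zero_mul]⟩

end IsMuBasis

end Syzygies

/-! ### Linear coordinates at a point -/

section Coordinates

variable {K : Type*} [Field K] {p : Fin 3 → K}

lemma exists_areCoordsAt (hp : p ≠ 0) : ∃ L, AreCoordsAt p L := by
  let f : (Fin 3 → K) →ₗ[K] K := Fintype.linearCombination K p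
  have hf : ∀ x, f x = ∑ i, x i * p i := fun x => by
    simp [f, Fintype.linearCombination_apply]
  have hf0 : f ≠ 0 := by
    intro h
    obtain ⟨i, hi⟩ := Function.ne_iff.1 hp
    have h1 := hf (Pi.single i 1)
    rw [h] at h1
    simp [Pi.single_apply] at h1
    exact hi h1.symm
  have h1 := LinearMap.finrank_range_add_finrank_ker f
  rw [LinearMap.range_eq_top.2 (LinearMap.surjective hf0), finrank_top, Module.finrank_self,
    Module.finrank_fin_fun] at h1
  let b := Module.finBasisOfFinrankEq K (LinearMap.ker f) (n := 2) (by omega)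
  refine ⟨fun a => (b a : Fin 3 → K), ?_, fun a => ?_⟩
  · exact b.linearIndependent.map' (Submodule.subtype _) (Submodule.ker_subtype _)
  · rw [← hf]; exact (b a).2

/-- Linear coordinates vanishing at `p` are part of a coordinate system. -/
lemma AreCoordsAt.exists_dual {L : Fin 2 → Fin 3 → K} (hL : AreCoordsAt p L) (hp : p ≠ 0) :
    ∃ (w : Fin 2 → Fin 3 → K) (l : Fin 3 → K),
      (∀ a b, ∑ i, L a i * w b i = if a = b then 1 else 0) ∧ ∑ i, l i * p i = 1 ∧
      (∀ b, ∑ i, l i * w b i = 0) ∧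
      ∀ i j, w 0 i * L 0 j + w 1 i * L 1 j + p i * l j = if i = j then 1 else 0 := by
  obtain ⟨hind, hLp⟩ := hL
  obtain ⟨j, hj⟩ := Function.ne_iff.1 hp
  -- A third linear form with value 1 at `p`. The inverse `B` of the matrix of the three forms has
  -- the dual basis as columns, the last one being `p`.
  let l : Fin 3 → K := Pi.single j (p j)⁻¹
  have hlp : ∑ i, l i * p i = 1 := by
    simp only [l, Pi.single_apply, ite_mul, zero_mul, Finset.sum_ite_eq', Finset.mem_univ, if_true]
    exact inv_mul_cancel₀ hj
  let A : Matrix (Fin 3) (Fin 3) K := Matrix.of ![L 0, L 1, l]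
  have hA : LinearIndependent K A.row := by
    rw [Fintype.linearIndependent_iff]
    intro c hc
    have hc' : ∀ i, c 0 * L 0 i + c 1 * L 1 i + c 2 * l i = 0 := by
      intro i
      have := congrFun hc i
      simpa [Fin.sum_univ_three, A, Matrix.row] using this
    have h2 : c 2 = 0 := by
      have : ∑ i, (c 0 * L 0 i + c 1 * L 1 i + c 2 * l i) * p i =
          c 0 * ∑ i, L 0 i * p i + c 1 * ∑ i, L 1 i * p i + c 2 * ∑ i, l i * p i := by
        simp only [Fin.sum_univ_three]; ring
      rw [hLp, hLp, hlp] at this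
      simp_rw [hc'] at this
      simpa using this.symm
    have h01 := Fintype.linearIndependent_iff.1 hind ![c 0, c 1] (by
      ext i
      have := hc' i
      simpa [Fin.sum_univ_two, h2] using this)
    intro i
    fin_cases i
    · exact h01 0
    · exact h01 1
    · exact h2
  have hU := Matrix.linearIndependent_rows_iff_isUnit.1 hA
  obtain ⟨B, hAB, hBA⟩ : ∃ B, A * B = 1 ∧ B * A = 1 :=
    ⟨A⁻¹, Matrix.mul_nonsing_inv A ((Matrix.isUnit_iff_isUnit_det A).1 hU),
      Matrix.nonsing_inv_mul A ((Matrix.isUnit_iff_isUnit_det A).1 hU)⟩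
  have hAp : A.mulVec p = ![0, 0, 1] := by
    ext i
    fin_cases i
    · exact hLp 0
    · exact hLp 1
    · exact hlp
  have hBp : ∀ i, p i = B i 2 := by
    intro i
    have : (B * A).mulVec p = B.mulVec ![0, 0, 1] := by rw [← Matrix.mulVec_mulVec, hAp]
    rw [hBA, Matrix.one_mulVec] at this
    rw [this]
    simp [Matrix.mulVec, dotProduct, Fin.sum_univ_three]
  have hent : ∀ i j, ∑ m, A i m * B m j = if i = j then 1 else 0 := by
    intro i j
    rw [← Matrix.mul_apply, hAB, Matrix.one_apply]
  refine ⟨fun a i => B i (Fin.castSucc a), l, ?_, hlp, ?_, ?_⟩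
  · intro a b
    have := hent (Fin.castSucc a) (Fin.castSucc b)
    fin_cases a <;> fin_cases b <;> simpa [A] using this
  · intro b
    have := hent 2 (Fin.castSucc b)
    fin_cases b <;> simpa [A] using this
  · intro i j
    have : (B * A) i j = if i = j then 1 else 0 := by rw [hBA, Matrix.one_apply]
    rw [Matrix.mul_apply, Fin.sum_univ_three] at this
    rw [hBp]
    exact this

end Coordinates

/-! ### The Rees ideal as a bigraded ideal -/

section ReesIdeal

variable {K : Type*} [Field K] {u : Fin 3 → RingT K}

lemma coe_reesMap (G : RingTX K) : (reesMap u G : Polynomial (RingT K)) =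
    aeval (fun i => Polynomial.X * Polynomial.C (u i)) G := by
  have : (Subalgebra.val _).comp (reesMap u) =
      aeval (fun i => Polynomial.X * Polynomial.C (u i)) := by
    refine algHom_ext fun i => ?_
    simp [reesMap, Polynomial.X_mul_C, Polynomial.C_mul_X_eq_monomial]
  exact DFunLike.congr_fun this G

lemma coe_reesMap_of_isHomogeneous {n : ℕ} {G : RingTX K} (hG : G.IsHomogeneous n) :
    (reesMap u G : Polynomial (RingT K)) = Polynomial.X ^ n * Polynomial.C (aeval u G) := by
  rw [coe_reesMap, hG.aeval_mul]
  congr 1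
  have : aeval (fun i => Polynomial.C (u i)) = (Algebra.ofId (RingT K) _).comp (aeval u) :=
    algHom_ext fun i => by simp [Algebra.ofId_apply]
  rw [this]
  simp [Algebra.ofId_apply]

lemma mem_reesIdeal_iff_of_isHomogeneous {n : ℕ} {G : RingTX K} (hG : G.IsHomogeneous n) :
    G ∈ reesIdeal u ↔ aeval u G = 0 := by
  rw [reesIdeal, RingHom.mem_ker, ← Subtype.coe_inj]
  change (reesMap u G : Polynomial (RingT K)) = 0 ↔ _
  rw [coe_reesMap_of_isHomogeneous hG]
  simp

lemma aeval_homogeneousComponent_eq_zero {G : RingTX K} (hG : G ∈ reesIdeal u) (n : ℕ) :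
    aeval u (homogeneousComponent n G) = 0 := by
  have h0 : (reesMap u G : Polynomial (RingT K)) = 0 := by
    have : reesMap u G = 0 := hG
    rw [this]; rfl
  rw [← sum_homogeneousComponent G, map_sum, AddSubmonoidClass.coe_finsetSum] at h0
  have h1 := congrArg (fun q => Polynomial.coeff q n) h0
  simp only [Polynomial.finsetSum_coeff, Polynomial.coeff_zero] at h1
  simp_rw [coe_reesMap_of_isHomogeneous (homogeneousComponent_isHomogeneous _ G),
    Polynomial.coeff_mul_C, Polynomial.coeff_X_pow, ite_mul, one_mul, zero_mul] at h1
  rw [Finset.sum_ite_eq] at h1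
  split_ifs at h1 with h
  · exact h1
  · rw [homogeneousComponent_eq_zero, map_zero]
    simpa using h

variable {d : ℕ} (hu : ∀ i, (u i).IsHomogeneous d)
include hu

/-- Substituting forms of degree `d` sends bidegree `(s, n)` to `T`-degree `s + dn`. With `n` fixed,
distinct `s` stay apart, which is why `𝒦` is bigraded. -/
lemma aeval_bicomp (G : RingTX K) (s n : ℕ) :
    aeval u (bicomp s n G) =
      homogeneousComponent (s + d * n) (aeval u (homogeneousComponent n G)) := by
  conv_rhs => rw [aeval_def, eval₂_eq, map_sum]
  simp only [bicomp, AddMonoidHom.coe_mk, ZeroHom.coe_mk]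
  rw [map_sum]
  refine Finset.sum_congr rfl fun m hm => ?_
  have hprod : (∏ i ∈ m.support, u i ^ m i).IsHomogeneous (d * n) := by
    have h1 := IsHomogeneous.prod m.support (fun i => u i ^ m i) (fun i => d * m i)
      (fun i _ => (hu i).pow _)
    rwa [← Finset.mul_sum,
      ← (homogeneousComponent_isHomogeneous n G).degree_eq_sum_deg_support hm] at h1
  rw [homogeneousComponent_mul_of_isHomogeneous _ hprod, if_pos (by omega), Nat.add_sub_cancel,
    aeval_monomial]
  rfl

lemma bicomp_mem_reesIdeal {G : RingTX K} (hG : G ∈ reesIdeal u) (s n : ℕ) :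
    bicomp s n G ∈ reesIdeal u := by
  rw [mem_reesIdeal_iff_of_isHomogeneous (bicomp_isBihomogeneous s n G).1, aeval_bicomp hu,
    aeval_homogeneousComponent_eq_zero hG, map_zero]

end ReesIdeal

/-! ### The implicit equation: homogeneous, prime, of degree at most `d` -/

section Implicit

variable {K : Type*} [Field K] {u : Fin 3 → RingT K}

lemma aeval_embX (f : RingX K) : aeval u (embX f) = aeval u f := by
  rw [embX, aeval_def, eval₂_map, aeval_def]
  rfl

lemma IsImplicitEquation.aeval_eq_zero_iff {E : RingX K} (hE : IsImplicitEquation u E)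
    {f : RingX K} : aeval u f = 0 ↔ E ∣ f := by
  rw [← Ideal.mem_span_singleton, hE, RingHom.mem_ker]

variable {d : ℕ} (hu : ∀ i, (u i).IsHomogeneous d)
include hu

lemma MvPolynomial.IsHomogeneous.aeval_forms {f : RingX K} {n : ℕ} (hf : f.IsHomogeneous n) :
    (MvPolynomial.aeval u f).IsHomogeneous (d * n) :=
  hf.aeval _ hu

lemma aeval_homogeneousComponent_of_pos (hd : 0 < d) {f : RingX K} (hf : aeval u f = 0) (n : ℕ) :
    aeval u (homogeneousComponent n f) = 0 := by
  have h1 := congrArg (homogeneousComponent (d * n)) hf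
  rw [← sum_homogeneousComponent f, map_sum, map_sum, map_zero] at h1
  have h2 : ∀ i, homogeneousComponent (d * n) (aeval u (homogeneousComponent i f)) =
      if n = i then aeval u (homogeneousComponent i f) else 0 := by
    intro i
    rw [homogeneousComponent_of_mem
      ((homogeneousComponent_isHomogeneous i f).aeval_forms hu)]
    simp [hd.ne']
  simp_rw [h2] at h1
  rw [Finset.sum_ite_eq] at h1
  split_ifs at h1 with h
  · exact h1
  · rw [homogeneousComponent_eq_zero, map_zero]
    simpa using h

/-- The top component of `E` also vanishes on `u`, so it is a multiple of `E`; equality of degrees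
makes the cofactor a constant. -/
lemma IsImplicitEquation.isHomogeneous (hd : 0 < d) {E : RingX K} (hE : IsImplicitEquation u E) :
    E.IsHomogeneous E.totalDegree := by
  by_cases h0 : E = 0
  · rw [h0]; exact isHomogeneous_zero _ _ _
  obtain ⟨c, hc⟩ := hE.aeval_eq_zero_iff.1
    (aeval_homogeneousComponent_of_pos hu hd (hE.aeval_eq_zero_iff.2 dvd_rfl) E.totalDegree)
  have hne : homogeneousComponent E.totalDegree E ≠ 0 := by
    obtain ⟨m, hm, hmE⟩ := E.support.exists_mem_eq_sup (Finsupp.support_nonempty_iff.2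
      (fun h => h0 (by ext m; exact DFunLike.congr_fun h m))) (fun m => m.sum fun _ e => e)
    intro h
    have h1 := congrArg (coeff m) h
    rw [coeff_homogeneousComponent, if_pos, coeff_zero] at h1
    · exact (mem_support_iff.1 hm) h1
    · rw [Finsupp.degree_apply]; exact hmE.symm
  have hc0 : c ≠ 0 := by rintro rfl; exact hne (by rw [hc, mul_zero])
  have hdeg := (homogeneousComponent_isHomogeneous E.totalDegree E).totalDegree hne
  rw [hc, totalDegree_mul_of_isDomain h0 hc0] at hdeg
  have hC := totalDegree_eq_zero_iff_eq_C.1 (show c.totalDegree = 0 by omega)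
  have hc1 : coeff 0 c ≠ 0 := fun h => hc0 (by rw [hC, h, C_0])
  have : E = C (coeff 0 c)⁻¹ * homogeneousComponent E.totalDegree E := by
    have e1 : (C (coeff 0 c)⁻¹ * c : RingX K) = 1 := by
      conv_lhs => rw [hC]
      rw [coeff_C, if_pos rfl, ← C_mul, inv_mul_cancel₀ hc1, C_1]
    rw [hc]
    linear_combination - E * e1
  have h2 := (homogeneousComponent_isHomogeneous E.totalDegree E).C_mul (coeff 0 c)⁻¹
  rwa [← this] at h2

/-- Rank-nullity for evaluation at `u` on ternary forms of degree `D + M`: the kernel lies in `E`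
times forms of degree `M`, and the target has dimension `d(D + M) + 1`. All dimensions are doubled
to avoid division. -/
lemma finrank_forms_le {E : RingX K} (hE : IsImplicitEquation u E) (hE0 : E ≠ 0) {D : ℕ}
    (hD : E.IsHomogeneous D) (M : ℕ) :
    (D + M + 2) * (D + M + 1) ≤ 2 * (d * (D + M) + 1) + (M + 2) * (M + 1) := by
  have hch : ∀ n : ℕ, 2 * (3 + n - 1).choose n = (n + 2) * (n + 1) := by
    intro n
    have h1 : 3 + n - 1 = n + 2 := by omega
    rw [h1, Nat.choose_symm_add, Nat.choose_two_right]
    exact Nat.mul_div_cancel' ((Nat.even_mul_pred_self (n + 2)).two_dvd)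
  let f : homogeneousSubmodule (Fin 3) K (D + M) →ₗ[K]
      homogeneousSubmodule (Fin 2) K (d * (D + M)) :=
    LinearMap.codRestrict _ ((aeval u : RingX K →ₐ[K] RingT K).toLinearMap.comp
      (Submodule.subtype _)) (fun x => x.2.aeval_forms hu)
  let g : homogeneousSubmodule (Fin 3) K M →ₗ[K] homogeneousSubmodule (Fin 3) K (D + M) :=
    LinearMap.codRestrict _ ((LinearMap.mulLeft K E).comp (Submodule.subtype _))
      (fun x => hD.mul x.2)
  have hker : LinearMap.ker f ≤ LinearMap.range g := by
    intro x hx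
    have hx' : aeval u (x : RingX K) = 0 := congrArg Subtype.val (LinearMap.mem_ker.1 hx)
    obtain ⟨c, hc⟩ := hE.aeval_eq_zero_iff.1 hx'
    have hxh : (x : RingX K).IsHomogeneous (D + M) := x.2
    rw [hc] at hxh
    have hch : c.IsHomogeneous M := by
      rcases hD.of_mul_left hE0 hxh with h | ⟨e, he, h⟩
      · rw [h]; exact isHomogeneous_zero _ _ _
      · have : e = M := by omega
        exact this ▸ h
    exact ⟨⟨c, hch⟩, Subtype.ext hc.symm⟩
  have h1 := LinearMap.finrank_range_add_finrank_ker f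
  have h2 := Submodule.finrank_le (LinearMap.range f)
  have h3 := (Submodule.finrank_mono hker).trans (LinearMap.finrank_range_le g)
  rw [finrank_homogeneousSubmodule] at h1 h2 h3
  have h4 : 2 + d * (D + M) - 1 = d * (D + M) + 1 := by omega
  rw [h4, Nat.choose_succ_self_right] at h2
  have h5 := hch (D + M)
  have h6 := hch M
  omega

/-- Already in degree `2d` there are more ternary forms than binary forms of degree `2d²`. -/
lemma IsImplicitEquation.ne_zero (hd : 0 < d) {E : RingX K} (hE : IsImplicitEquation u E) :
    E ≠ 0 := by
  rintro rfl
  have hch : 2 * (3 + 2 * d - 1).choose (2 * d) = (2 * d + 2) * (2 * d + 1) := by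
    have h1 : 3 + 2 * d - 1 = 2 * d + 2 := by omega
    rw [h1, Nat.choose_symm_add, Nat.choose_two_right]
    exact Nat.mul_div_cancel' ((Nat.even_mul_pred_self (2 * d + 2)).two_dvd)
  let f : homogeneousSubmodule (Fin 3) K (2 * d) →ₗ[K]
      homogeneousSubmodule (Fin 2) K (d * (2 * d)) :=
    LinearMap.codRestrict _ ((aeval u : RingX K →ₐ[K] RingT K).toLinearMap.comp
      (Submodule.subtype _)) (fun x => x.2.aeval_forms hu)
  have hinj : Function.Injective f := by
    rw [← LinearMap.ker_eq_bot, LinearMap.ker_eq_bot']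
    intro x hx
    have hx' : aeval u (x : RingX K) = 0 := congrArg Subtype.val hx
    exact Subtype.ext (zero_dvd_iff.1 (hE.aeval_eq_zero_iff.1 hx'))
  have h1 := LinearMap.finrank_le_finrank_of_injective hinj
  rw [finrank_homogeneousSubmodule, finrank_homogeneousSubmodule] at h1
  have h4 : 2 + d * (2 * d) - 1 = d * (2 * d) + 1 := by omega
  rw [h4, Nat.choose_succ_self_right] at h1
  nlinarith

lemma IsImplicitEquation.totalDegree_le (hd : 0 < d) {E : RingX K}
    (hE : IsImplicitEquation u E) : E.totalDegree ≤ d := by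
  by_contra hlt
  -- As `M` grows, the two sides of the inequality differ by about `2M(D - d)`; `M = dD` is large
  -- enough to contradict `D > d`.
  have h1 := finrank_forms_le hu hE (hE.ne_zero hu hd) (hE.isHomogeneous hu hd) (d * E.totalDegree)
  obtain ⟨a, ha⟩ := Nat.exists_eq_add_of_lt (not_le.1 hlt)
  rw [ha] at h1
  nlinarith [Nat.zero_le a, Nat.zero_le (d * a), Nat.zero_le (d * d), Nat.zero_le (a * a),
    Nat.zero_le (d * a * a), Nat.zero_le (d * d * a)]

lemma IsImplicitEquation.prime (hd : 0 < d) {E : RingX K} (hE : IsImplicitEquation u E) : Prime E := by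
  rw [← Ideal.span_singleton_prime (hE.ne_zero hu hd), hE]
  exact RingHom.ker_isPrime _

end Implicit

/-! ### Dehomogenization -/

section Dehomogenize

variable {K : Type*} [Field K]

/-- A linear functional need only be compared with `coeff m` on monomials of degree `n`. There the
degree recovers the exponent lost by setting a variable to 1. -/
lemma coeff_eq_of_isHomogeneous {σ : Type*} [DecidableEq σ] {f : MvPolynomial σ K} {n : ℕ}
    (hf : f.IsHomogeneous n) (φ : MvPolynomial σ K →ₗ[K] K) {m : σ →₀ ℕ}
    (hφ : ∀ m' : σ →₀ ℕ, m'.degree = n → φ (monomial m' 1) = if m' = m then 1 else 0) :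
    φ f = coeff m f := by
  have h1 : ∀ m' ∈ f.support, φ (monomial m' (coeff m' f)) =
      if m' = m then coeff m' f else 0 := by
    intro m' hm'
    have h2 : (monomial m' (coeff m' f) : MvPolynomial σ K) = coeff m' f • monomial m' 1 := by
      rw [smul_monomial, smul_eq_mul, mul_one]
    rw [h2, map_smul, hφ m' (by
      rw [Finsupp.degree_eq_weight_one]; exact hf (mem_support_iff.1 hm'))]
    simp
  conv_lhs => rw [f.as_sum]
  rw [map_sum, Finset.sum_congr rfl h1, Finset.sum_ite_eq']
  split_ifs with h
  · rfl
  · exact (notMem_support_iff.1 h).symm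

lemma coeff_aeval_dehomogenize {f : RingX K} {D : ℕ} (hf : f.IsHomogeneous D)
    {m : Fin 3 →₀ ℕ} (hm : m.degree = D) :
    coeff (Finsupp.single 0 (m 0) + Finsupp.single 1 (m 1))
      (aeval ![(X 0 : RingT K), X 1, 1] f) = coeff m f := by
  classical
  refine coeff_eq_of_isHomogeneous hf ((lcoeff K _).comp
    (aeval ![(X 0 : RingT K), X 1, 1]).toLinearMap) fun m' hm' => ?_
  have h1 : aeval ![(X 0 : RingT K), X 1, 1] (monomial m' (1 : K)) =
      monomial (Finsupp.single 0 (m' 0) + Finsupp.single 1 (m' 1)) 1 := by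
    rw [aeval_monomial, Finsupp.prod_fintype _ _ (fun _ => pow_zero _), Fin.prod_univ_three]
    simp [X_pow_eq_monomial, monomial_mul]
  simp only [LinearMap.comp_apply, AlgHom.toLinearMap_apply, h1, lcoeff_apply, coeff_monomial]
  congr 1
  rw [eq_iff_iff]
  constructor
  · intro h
    have h2 := DFunLike.congr_fun h 0
    have h3 := DFunLike.congr_fun h 1
    simp at h2 h3
    rw [← hm, Finsupp.degree_eq_sum, Finsupp.degree_eq_sum, Fin.sum_univ_three,
      Fin.sum_univ_three] at hm'
    ext i
    fin_cases i
    · exact h2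
    · exact h3
    · change m' 2 = m 2
      omega
  · rintro rfl; rfl

lemma coeff_coeff_aeval_dehomogenize {f : RingX K} {D : ℕ} (hf : f.IsHomogeneous D)
    {m : Fin 3 →₀ ℕ} (hm : m.degree = D) :
    ((aeval ![Polynomial.C Polynomial.X, (1 : Polynomial (Polynomial K)), Polynomial.X] f).coeff
      (m 2)).coeff (m 0) = coeff m f := by
  classical
  refine coeff_eq_of_isHomogeneous hf ((Polynomial.lcoeff K (m 0)).comp
    (((Polynomial.lcoeff (Polynomial K) (m 2)).restrictScalars K).comp
    (aeval ![Polynomial.C Polynomial.X, (1 : Polynomial (Polynomial K)),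
      Polynomial.X]).toLinearMap)) fun m' hm' => ?_
  have h1 : aeval ![Polynomial.C Polynomial.X, (1 : Polynomial (Polynomial K)), Polynomial.X]
      (monomial m' (1 : K)) =
      Polynomial.C (Polynomial.X ^ (m' 0)) * Polynomial.X ^ (m' 2) := by
    rw [aeval_monomial, Finsupp.prod_fintype _ _ (fun _ => pow_zero _), Fin.prod_univ_three]
    simp
  simp only [LinearMap.comp_apply, AlgHom.toLinearMap_apply, h1, LinearMap.restrictScalars_apply,
    Polynomial.lcoeff_apply, Polynomial.coeff_C_mul_X_pow]
  rw [← hm, Finsupp.degree_eq_sum, Finsupp.degree_eq_sum, Fin.sum_univ_three,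
      Fin.sum_univ_three] at hm'
  by_cases h2 : m 2 = m' 2
  · rw [if_pos h2, Polynomial.coeff_X_pow]
    congr 1
    rw [eq_iff_iff]
    constructor
    · intro h
      ext i
      fin_cases i
      · exact h.symm
      · change m' 1 = m 1
        omega
      · exact h2.symm
    · rintro rfl; rfl
  · rw [if_neg h2, if_neg (fun h : m' = m => h2 (by rw [h])), Polynomial.coeff_zero]

/-- The substitution `T₀ ↦ t`, `T₁ ↦ 1` with values in `𝕂(t)`. -/
noncomputable def dehomT (K : Type*) [Field K] : RingT K →ₐ[K] RatFunc K :=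
  (Algebra.algHom K (Polynomial K) (RatFunc K)).comp (aeval ![Polynomial.X, 1])

lemma dehomT_X_zero : dehomT K (X 0) = RatFunc.X := by
  change algebraMap (Polynomial K) (RatFunc K) (aeval ![Polynomial.X, 1] (X 0)) = _
  simp

lemma dehomT_X_one : dehomT K (X 1) = 1 := by simp [dehomT]

lemma dehomT_eq_zero {c : RingT K} {n : ℕ} (hc : c.IsHomogeneous n) (h : dehomT K c = 0) :
    c = 0 := by
  have h1 : aeval ![Polynomial.X, (1 : Polynomial K)] c = 0 := by
    refine RatFunc.algebraMap_injective K ?_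
    rw [map_zero]; exact h
  rw [← Polynomial.homogenize_eq_of_isHomogeneous hc h1, Polynomial.homogenize_zero]

lemma dehomT_homogenize {q : Polynomial K} {n : ℕ} (hq : q.natDegree ≤ n) :
    dehomT K (q.homogenize n) = algebraMap (Polynomial K) (RatFunc K) q := by
  change algebraMap (Polynomial K) (RatFunc K) (aeval ![Polynomial.X, 1] (q.homogenize n)) = _
  rw [Polynomial.aeval_homogenize_X_one q hq]

end Dehomogenize

/-! ### Multiplicity and the degree in the last coordinate -/

section Order

variable {K : Type*} [Field K]

/-- A polynomial vanishing to order at least `r` at `p`, homogeneous of degree `D`, has degree at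
most `D - r` in a coordinate that does not vanish at `p`, when the others do. -/
lemma add_le_of_mem_support {E : RingX K} {D : ℕ} (hE : E.IsHomogeneous D) {p : Fin 3 → K}
    {r : ℕ} (hr : (r : ℕ∞) ≤ multiplicityAt E p) (w : Fin 2 → Fin 3 → K) {m : Fin 3 →₀ ℕ}
    (hm : m ∈ (aeval (fun i => C (w 0 i) * X 0 + C (w 1 i) * X 1 + C (p i) * X 2 :
      Fin 3 → RingX K) E).support) : m 2 + r ≤ D := by
  set F := aeval (fun i => C (w 0 i) * X 0 + C (w 1 i) * X 1 + C (p i) * X 2 :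
      Fin 3 → RingX K) E with hF
  have hFhom : F.IsHomogeneous D := by
    have := hE.aeval (fun i => C (w 0 i) * X 0 + C (w 1 i) * X 1 + C (p i) * X 2 :
      Fin 3 → RingX K) (n := 1) (fun i => ((isHomogeneous_C_mul_X _ _).add
        (isHomogeneous_C_mul_X _ _)).add (isHomogeneous_C_mul_X _ _))
    rwa [one_mul] at this
  have hmD : m.degree = D := by
    rw [Finsupp.degree_eq_weight_one]; exact hFhom (mem_support_iff.1 hm)
  have hc := coeff_aeval_dehomogenize hFhom hmD
  set G : RingX K := aeval (fun i => X i + C (p i) : Fin 3 → RingX K) E with hG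
  let χ : Fin 3 → RingT K := fun i => C (w 0 i) * X 0 + C (w 1 i) * X 1
  -- Setting the last coordinate to 1 gives the Taylor expansion of `E` at `p` along `w 0, w 1`. It
  -- has no terms of degree below `r`, while the monomial `m` contributes degree `D - m 2`.
  have hFG : aeval ![(X 0 : RingT K), X 1, 1] F = aeval χ G := by
    rw [hF, hG, ← AlgHom.comp_apply, ← AlgHom.comp_apply, comp_aeval, comp_aeval]
    congr 2
    funext i
    simp [χ, algebraMap_eq]
  have hGlow : ∀ j < r, homogeneousComponent j G = 0 := by
    intro j hj
    ext n
    rw [coeff_homogeneousComponent, coeff_zero]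
    split_ifs with h
    · have := MvPowerSeries.coeff_of_lt_order (f := (G : MvPowerSeries (Fin 3) K)) (d := n)
        (lt_of_lt_of_le (by rw [h]; exact_mod_cast hj) hr)
      rwa [coeff_coe] at this
    · rfl
  by_contra hlt
  rw [Finsupp.degree_eq_sum, Fin.sum_univ_three] at hmD
  rw [hFG, ← sum_homogeneousComponent G, map_sum, coeff_sum, Finset.sum_eq_zero] at hc
  · exact mem_support_iff.1 hm hc.symm
  · intro j _
    by_cases hj : j < r
    · simp [hGlow j hj]
    · have h1 := (homogeneousComponent_isHomogeneous j G).aeval χ (n := 1) (fun i =>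
        (isHomogeneous_C_mul_X _ _).add (isHomogeneous_C_mul_X _ _))
      refine h1.coeff_eq_zero ?_
      simp [Finsupp.degree_eq_sum, Fin.sum_univ_two]
      omega

end Order

/-! ### The degree of the projection from a point -/

section Projection

variable {K : Type*} [Field K]

open scoped IntermediateField

/-- If `(v₀ : v₁ : v₂)` is a proper parametrization and `F(v₀, v₁, v₂) = 0` with `F` of degree at
most `N` in the last variable, then the projection `(v₀ : v₁)` has degree at most `N`. -/
lemma max_natDegree_le_of_aeval_eq_zero {v : Fin 3 → RingT K} {F : RingX K} {D N : ℕ}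
    (hF : F.IsHomogeneous D) (hF0 : F ≠ 0) (hFv : aeval v F = 0)
    (hN : ∀ m ∈ F.support, m 2 ≤ N) (hv1 : dehomT K (v 1) ≠ 0)
    (hnc : ¬ ∃ c, dehomT K (v 0) / dehomT K (v 1) = RatFunc.C c)
    {n : ℕ} {A B : RingX K} (hA : A.IsHomogeneous n) (hB : B.IsHomogeneous n)
    (hB0 : dehomT K (aeval v B) ≠ 0) (hAB : X 0 * aeval v B = X 1 * aeval v A) :
    max (dehomT K (v 0) / dehomT K (v 1)).num.natDegree
      (dehomT K (v 0) / dehomT K (v 1)).denom.natDegree ≤ N := by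
  classical
  -- `f` and `y` are the affine coordinates `x₀/x₁` and `x₂/x₁` on the curve; `f` is the projection.
  set f : RatFunc K := dehomT K (v 0) / dehomT K (v 1) with hf
  set y : RatFunc K := dehomT K (v 2) / dehomT K (v 1) with hy
  let g : K⟮f⟯ := IntermediateField.AdjoinSimple.gen K f
  have hscale : ∀ {G : RingX K} {j : ℕ}, G.IsHomogeneous j →
      dehomT K (aeval v G) = dehomT K (v 1) ^ j * aeval ![f, 1, y] G := by
    intro G j hG
    rw [← hG.aeval_mul]
    have : (fun i => dehomT K (v 1) * ![f, 1, y] i) = fun i => dehomT K (v i) := by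
      funext i
      fin_cases i
      · exact mul_div_cancel₀ _ hv1
      · exact mul_one _
      · exact mul_div_cancel₀ _ hv1
    rw [this, ← AlgHom.comp_apply, comp_aeval]
  let Ψ₀ : Polynomial (Polynomial K) :=
    aeval ![Polynomial.C Polynomial.X, (1 : Polynomial (Polynomial K)), Polynomial.X] F
  -- This is `F(f, 1, Y)`, a polynomial in `Y` over `𝕂(f)` with root `y`. It is nonzero because `f`
  -- is transcendental over `𝕂`.
  let Ψ : Polynomial K⟮f⟯ := Ψ₀.map (Polynomial.aeval g : Polynomial K →ₐ[K] K⟮f⟯).toRingHom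
  have hΨ₀ : Ψ₀ ≠ 0 := by
    intro h
    obtain ⟨m, hm⟩ := ne_zero_iff.1 hF0
    have := coeff_coeff_aeval_dehomogenize hF (m := m) (by
      rw [Finsupp.degree_eq_weight_one]; exact hF hm)
    change (Ψ₀.coeff (m 2)).coeff (m 0) = _ at this
    rw [h] at this
    simp at this
    exact hm this.symm
  have hinj : Function.Injective (Polynomial.aeval g : Polynomial K →ₐ[K] K⟮f⟯).toRingHom := by
    have ht : Transcendental K f := f.transcendental_of_ne_C hnc
    have h1 := transcendental_iff_injective.1 ht
    intro a b hab
    refine h1 ?_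
    have h2 : ∀ q : Polynomial K, Polynomial.aeval f q = ((Polynomial.aeval g q : K⟮f⟯) : RatFunc K) :=
      fun q => by
        rw [← IntermediateField.coe_val, ← Polynomial.aeval_algHom_apply]; rfl
    rw [h2, h2]
    exact congrArg _ hab
  have hΨ : Ψ ≠ 0 := fun h => hΨ₀ ((Polynomial.map_eq_zero_iff hinj).1 h)
  have hdeg : Ψ.natDegree ≤ N := by
    refine Polynomial.natDegree_map_le.trans ?_
    change (aeval ![Polynomial.C Polynomial.X, (1 : Polynomial (Polynomial K)),
      Polynomial.X] F).natDegree ≤ N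
    rw [aeval_def, eval₂_eq']
    refine Polynomial.natDegree_sum_le_of_forall_le _ _ fun m hm => ?_
    have h1 : algebraMap K (Polynomial (Polynomial K)) (coeff m F) * ∏ i, ![Polynomial.C Polynomial.X,
        (1 : Polynomial (Polynomial K)), Polynomial.X] i ^ m i =
        Polynomial.C (Polynomial.C (coeff m F) * Polynomial.X ^ m 0) * Polynomial.X ^ m 2 := by
      rw [Fin.prod_univ_three]
      simp [Polynomial.algebraMap_apply, mul_assoc]
    rw [h1]
    exact (Polynomial.natDegree_C_mul_X_pow_le _ _).trans (hN m hm)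
  have hroot : Polynomial.aeval y Ψ = 0 := by
    have h1 : Polynomial.aeval y Ψ = aeval ![f, 1, y] F := by
      have h2 : Polynomial.aeval y Ψ = Polynomial.eval₂ (((algebraMap K⟮f⟯ (RatFunc K))).comp
          (Polynomial.aeval g : Polynomial K →ₐ[K] K⟮f⟯).toRingHom) y Ψ₀ := by
        rw [Polynomial.aeval_def, Polynomial.eval₂_map]
      rw [h2]
      change (Polynomial.eval₂RingHom _ y) (aeval _ F) = _
      rw [aeval_def, aeval_def, hom_eval₂]
      congr 1
      · ext c
        simp [Polynomial.algebraMap_apply]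
      · funext i
        fin_cases i
        · simp [g]
        · simp
        · simp
    have h3 := hscale hF
    rw [hFv, map_zero, eq_comm, mul_eq_zero] at h3
    rw [h1]
    exact h3.resolve_left (pow_ne_zero _ hv1)
  have halg : IsAlgebraic K⟮f⟯ y := ⟨Ψ, hΨ, hroot⟩
  have hint : IsIntegral K⟮f⟯ y := halg.isIntegral
  let M : IntermediateField K⟮f⟯ (RatFunc K) := IntermediateField.adjoin K⟮f⟯ {y}
  have hyM : y ∈ M := IntermediateField.mem_adjoin_simple_self _ y
  have hfM : f ∈ M := by
    have : algebraMap K⟮f⟯ (RatFunc K) g ∈ M := M.algebraMap_mem g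
    exact this
  have hMaeval : ∀ G : RingX K, aeval ![f, 1, y] G ∈ M := by
    intro G
    have h1 : ∀ i, ![f, 1, y] i ∈ M.restrictScalars K := by
      intro i
      fin_cases i
      · exact hfM
      · exact M.one_mem
      · exact hyM
    have h2 : aeval ![f, 1, y] G = (aeval (fun i => (⟨_, h1 i⟩ : M.restrictScalars K)) G :
        M.restrictScalars K) := by
      rw [← IntermediateField.coe_val, ← AlgHom.comp_apply, comp_aeval]
      rfl
    rw [h2]
    exact (aeval (fun i => (⟨_, h1 i⟩ : M.restrictScalars K)) G).2
  -- Properness enters here: the parameter `t` is `A/B` evaluated at `(f, 1, y)`, so `𝕂(f)(y)` is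
  -- all of `𝕂(t)`.
  have hXM : (RatFunc.X : RatFunc K) ∈ M := by
    have h1 := congrArg (dehomT K) hAB
    rw [map_mul, map_mul, dehomT_X_zero, dehomT_X_one, one_mul] at h1
    have hB1 : aeval ![f, 1, y] B ≠ 0 := by
      intro h
      rw [hscale hB, h, mul_zero] at hB0
      exact hB0 rfl
    have h2 : (RatFunc.X : RatFunc K) = aeval ![f, 1, y] A / aeval ![f, 1, y] B := by
      rw [eq_div_iff hB1]
      rw [hscale hA, hscale hB] at h1
      refine mul_left_cancel₀ (pow_ne_zero n hv1) ?_
      linear_combination h1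
    rw [h2]
    exact M.div_mem (hMaeval A) (hMaeval B)
  have hMtop : M = ⊤ := by
    rw [eq_top_iff, ← RatFunc.IntermediateField.adjoin_X K⟮f⟯]
    exact IntermediateField.adjoin_le_iff.2 (by simpa using hXM)
  -- The degree of `f` as a rational function is `[𝕂(t) : 𝕂(f)]`, which is the degree of the minimal
  -- polynomial of `y` over `𝕂(f)`.
  rw [← f.finrank_eq_max_natDegree, ← IntermediateField.finrank_top', ← hMtop,
    IntermediateField.adjoin.finrank hint]
  exact (Polynomial.natDegree_le_natDegree
    (minpoly.degree_le_of_ne_zero _ _ hΨ hroot)).trans hdeg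

end Projection

/-! ### The moving line of degree 2 passes through the very singular point -/

section Axial

variable {K : Type*} [Field K] {u : Fin 3 → RingT K} {d : ℕ}

/-- The moving line `P` of degree `2` passes through a very singular point. -/
lemma sum_mul_eq_zero_of_isVerySingular (hu : ∀ i, (u i).IsHomogeneous d) (hd : 5 ≤ d)
    (hμ : muDegree u = 2) (hprop : IsProperParam u) {p : Fin 3 → K} (hp : IsVerySingular u p)
    {P Q : Fin 3 → RingT K} (hPQ : IsMuBasis u d 2 P Q) : ∑ i, P i * C (p i) = 0 := by
  obtain ⟨hp0, E, hE, hmult⟩ := hp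
  rw [hμ] at hmult
  obtain ⟨L, hL⟩ := exists_areCoordsAt hp0
  obtain ⟨w, l, hLw, hlp, hlw, hid⟩ := hL.exists_dual hp0
  have hd0 : 0 < d := by omega
  have hEhom := hE.isHomogeneous hu hd0
  have hED := hE.totalDegree_le hu hd0
  set D := E.totalDegree with hD
  have hconst : ∀ a b : K, (∀ i, a * L 0 i + b * L 1 i = 0) → a = 0 ∧ b = 0 := by
    intro a b h
    have := Fintype.linearIndependent_iff.1 hL.1 ![a, b] (by
      ext i
      simpa [Fin.sum_univ_two] using h i)
    exact ⟨this 0, this 1⟩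
  -- Since `μ > 0` there is no constant syzygy, so the first two coordinates of the curve are
  -- independent over `𝕂`. Hence the projection is defined and not constant.
  have hsyz0 : ∀ a b : K, ∑ i, C (a * L 0 i + b * L 1 i) * u i = 0 → a = 0 ∧ b = 0 := by
    intro a b h
    refine hconst a b fun i => ?_
    have h1 := eq_zero_of_degree_lt_muDegree (s := fun i => C (a * L 0 i + b * L 1 i))
      (mem_syzygies_iff.2 h) (m := 0) (fun i => isHomogeneous_C _ _) (by omega)
    exact C_eq_zero.1 (congrFun h1 i)
  let v : Fin 3 → RingT K := ![∑ i, C (L 0 i) * u i, ∑ i, C (L 1 i) * u i, ∑ i, C (l i) * u i]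
  have hlin : ∀ c : Fin 3 → K, (∑ i, C (c i) * u i).IsHomogeneous d := fun c =>
    IsHomogeneous.sum _ _ _ fun i _ => (hu i).C_mul _
  have hv1 : v 1 ≠ 0 := by
    intro h
    have := (hsyz0 0 1 (by rw [← h]; simp [v])).2
    exact one_ne_zero this
  have hV1 : dehomT K (v 1) ≠ 0 := fun h => hv1 (dehomT_eq_zero (hlin (L 1)) h)
  have hnc : ¬ ∃ c, dehomT K (v 0) / dehomT K (v 1) = RatFunc.C c := by
    rintro ⟨c, hc⟩
    rw [div_eq_iff hV1] at hc
    have hCc : RatFunc.C c = dehomT K (C c) := by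
      rw [← MvPolynomial.algebraMap_eq, AlgHom.commutes]; rfl
    rw [hCc, ← map_mul, ← sub_eq_zero, ← map_sub] at hc
    have h1 := dehomT_eq_zero ((hlin (L 0)).sub ((hlin (L 1)).C_mul c)) hc
    refine one_ne_zero (hsyz0 1 (-c) ?_).1
    rw [← h1, Finset.mul_sum, ← Finset.sum_sub_distrib]
    refine Finset.sum_congr rfl fun i _ => ?_
    simp only [one_mul, C_add, C_mul, C_neg]; ring
  -- the equation in the coordinates at `p`
  let s : Fin 3 → RingX K := fun i => C (w 0 i) * X 0 + C (w 1 i) * X 1 + C (p i) * X 2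
  have hshom : ∀ i, (s i).IsHomogeneous 1 := fun i =>
    ((isHomogeneous_C_mul_X _ _).add (isHomogeneous_C_mul_X _ _)).add (isHomogeneous_C_mul_X _ _)
  have hFhom : ∀ {G : RingX K} {n : ℕ}, G.IsHomogeneous n → (aeval s G).IsHomogeneous n :=
    fun hG => by
      have := hG.aeval s hshom
      rwa [one_mul] at this
  have hsv : ∀ i, aeval v (s i) = u i := by
    intro i
    have h1 : ∀ j, (C (w 0 i) * C (L 0 j) + C (w 1 i) * C (L 1 j) + C (p i) * C (l j) : RingT K) =
        if i = j then 1 else 0 := by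
      intro j
      rw [← C_mul, ← C_mul, ← C_mul, ← C_add, ← C_add, hid]
      split_ifs <;> simp
    have h2 : aeval v (s i) = ∑ j, (C (w 0 i) * C (L 0 j) + C (w 1 i) * C (L 1 j) +
        C (p i) * C (l j)) * u j := by
      simp only [s, v, map_add, map_mul, aeval_X, algHom_C, algebraMap_eq, Fin.sum_univ_three,
        Matrix.cons_val_zero, Matrix.cons_val_one, Matrix.cons_val]
      ring
    rw [h2]
    simp [h1]
  have hFv : ∀ G : RingX K, aeval v (aeval s G) = aeval u G := by
    intro G
    rw [← AlgHom.comp_apply, comp_aeval]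
    simp_rw [hsv]
  have hF0 : aeval s E ≠ 0 := by
    let t : Fin 3 → RingX K := ![∑ i, C (L 0 i) * X i, ∑ i, C (L 1 i) * X i, ∑ i, C (l i) * X i]
    have hst : ∀ i, aeval t (s i) = X i := by
      intro i
      have h1 : ∀ j, (C (w 0 i) * C (L 0 j) + C (w 1 i) * C (L 1 j) + C (p i) * C (l j) :
          RingX K) = if i = j then 1 else 0 := by
        intro j
        rw [← C_mul, ← C_mul, ← C_mul, ← C_add, ← C_add, hid]
        split_ifs <;> simp
      have h2 : aeval t (s i) = ∑ j, (C (w 0 i) * C (L 0 j) + C (w 1 i) * C (L 1 j) +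
          C (p i) * C (l j)) * X j := by
        simp only [s, t, map_add, map_mul, aeval_X, algHom_C, algebraMap_eq, Fin.sum_univ_three,
          Matrix.cons_val_zero, Matrix.cons_val_one, Matrix.cons_val]
        ring
      rw [h2]
      simp [h1]
    intro h
    refine hE.ne_zero hu hd0 ?_
    have h3 : aeval t (aeval s E) = E := by
      rw [← AlgHom.comp_apply, comp_aeval]
      simp_rw [hst]
      rw [aeval_X_left, AlgHom.id_apply]
    rw [← h3, h, map_zero]
  have hsupp : ∀ m ∈ (aeval s E).support, m 2 + 3 ≤ D := fun m hm =>
    add_le_of_mem_support hEhom (Order.add_one_le_of_lt hmult) w hm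
  obtain ⟨n, A, B, hA, hB, hne, hAB⟩ := hprop
  have hB0 : dehomT K (aeval v (aeval s B)) ≠ 0 := by
    rw [hFv]
    intro h
    have h1 := dehomT_eq_zero (hB.aeval_forms hu) h
    rw [h1, mul_zero, eq_comm, mul_eq_zero] at hAB
    exact hne ⟨hAB.resolve_left (X_ne_zero _), h1⟩
  -- The bound is `D - 3 ≤ d - 3`; only the inequality `D ≤ d` is available at this stage.
  have hmax := max_natDegree_le_of_aeval_eq_zero (N := d - 3) (hFhom hEhom) hF0
    (by rw [hFv]; exact hE.aeval_eq_zero_iff.2 dvd_rfl)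
    (fun m hm => by have := hsupp m hm; omega) hV1 hnc (hFhom hA) (hFhom hB) hB0
    (by rw [hFv, hFv]; exact hAB)
  set f : RatFunc K := dehomT K (v 0) / dehomT K (v 1) with hf
  have hnum := (le_max_left _ _).trans hmax
  have hden := (le_max_right _ _).trans hmax
  -- The projection written as a quotient `a/b` of forms of degree `d - 3` gives the relation `b v₀
  -- = a v₁`, a syzygy of degree below `d - 2` whose entries are combinations of `L 0` and `L 1`.
  set a := f.num.homogenize (d - 3) with ha
  set b := f.denom.homogenize (d - 3) with hb
  have hab : b * v 0 - a * v 1 = 0 := by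
    refine dehomT_eq_zero (((Polynomial.isHomogeneous_homogenize _).mul (hlin (L 0))).sub
      ((Polynomial.isHomogeneous_homogenize _).mul (hlin (L 1)))) ?_
    rw [map_sub, map_mul, map_mul, dehomT_homogenize hnum, dehomT_homogenize hden]
    have h1 := f.num_div_denom
    have h2 : algebraMap (Polynomial K) (RatFunc K) f.denom ≠ 0 :=
      RatFunc.algebraMap_ne_zero f.denom_ne_zero
    rw [div_eq_iff h2, hf, div_mul_eq_mul_div, eq_div_iff hV1] at h1
    linear_combination - h1
  have hs : (fun i => b * C (L 0 i) - a * C (L 1 i)) ∈ syzygies u := by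
    rw [mem_syzygies_iff, ← hab]
    simp only [v, Fin.sum_univ_three, Matrix.cons_val_zero, Matrix.cons_val_one]
    ring
  obtain ⟨c, hc⟩ := hPQ.exists_eq_mul_of_degree_lt hs (m := d - 3) (fun i => by
    have h1 := (Polynomial.isHomogeneous_homogenize (n := d - 3) f.denom).mul
      (isHomogeneous_C (Fin 2) (L 0 i))
    have h2 := (Polynomial.isHomogeneous_homogenize (n := d - 3) f.num).mul
      (isHomogeneous_C (Fin 2) (L 1 i))
    exact h1.sub h2) (by omega)
  have hcne : c ≠ 0 := by
    rintro rfl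
    have hb0 : b = 0 := by
      have h1 : ∑ i, (b * C (L 0 i) - a * C (L 1 i)) * C (w 0 i) = 0 := by
        simp_rw [hc, zero_mul]; simp
      have h2 : ∑ i, (b * C (L 0 i) - a * C (L 1 i)) * C (w 0 i) =
          b * C (∑ i, L 0 i * w 0 i) - a * C (∑ i, L 1 i * w 0 i) := by
        simp only [Fin.sum_univ_three, C_add, C_mul]; ring
      rw [h2, hLw, hLw] at h1
      simpa using h1
    exact f.denom_ne_zero (Polynomial.eq_zero_of_homogenize_eq_zero hden hb0)
  -- That syzygy is `c P`, and pairing it with `p` gives 0 because `L 0` and `L 1` vanish there.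
  have hfin : c * ∑ i, P i * C (p i) = 0 := by
    rw [Finset.mul_sum]
    simp_rw [← mul_assoc, ← hc]
    have h2 : ∑ i, (b * C (L 0 i) - a * C (L 1 i)) * C (p i) =
        b * C (∑ i, L 0 i * p i) - a * C (∑ i, L 1 i * p i) := by
      simp only [Fin.sum_univ_three, C_add, C_mul]; ring
    rw [h2, hL.2, hL.2]
    simp
  exact (mul_eq_zero.1 hfin).resolve_left hcne

end Axial

/-! ### The substitution `ψ = axialMap`: kernel and image of `𝒦` -/

section Setup

variable {K : Type*} [Field K]

lemma coeff_single_movingLine (s : Fin 3 → RingT K) (i : Fin 3) :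
    coeff (Finsupp.single i 1) (movingLine s) = s i := by
  classical
  simp [movingLine, coeff_sum, coeff_C_mul, coeff_X, Finsupp.single_left_inj]

lemma movingLine_injective : Function.Injective (movingLine (K := K)) := fun s t h =>
  funext fun i => by rw [← coeff_single_movingLine s, h, coeff_single_movingLine]

/-- The data of a `μ`-basis with `μ = 2` whose first element passes through `p`, written in linear
coordinates `L 0, L 1, l` for which `p` is the last point of the dual basis `w 0, w 1, p`. -/
structure IsAxialBasis (u : Fin 3 → RingT K) (d : ℕ) (P Q : Fin 3 → RingT K) (p : Fin 3 → K)
    (L w : Fin 2 → Fin 3 → K) (l : Fin 3 → K) (p₀ p₁ : RingT K) : Prop where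
  hom : ∀ i, (u i).IsHomogeneous d
  five_le : 5 ≤ d
  coprime : ∀ g : RingT K, (∀ i, g ∣ u i) → IsUnit g
  mu : muDegree u = 2
  basis : IsMuBasis u d 2 P Q
  coords : AreCoordsAt p L
  Lw : ∀ a b, ∑ i, L a i * w b i = if a = b then 1 else 0
  lp : ∑ i, l i * p i = 1
  lw : ∀ b, ∑ i, l i * w b i = 0
  id : ∀ i j, w 0 i * L 0 j + w 1 i * L 1 j + p i * l j = if i = j then 1 else 0
  hom₀ : p₀.IsHomogeneous 2
  hom₁ : p₁.IsHomogeneous 2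
  axial : movingLine P = C p₁ * linForm (L 0) - C p₀ * linForm (L 1)

/-- The substitution `x₀ ↦ p₀ z`, `x₁ ↦ p₁ z`, `x₂ ↦ 1`. -/
noncomputable def axialMap (p : Fin 3 → K) (w : Fin 2 → Fin 3 → K) (p₀ p₁ : RingT K) :
    RingTX K →ₐ[RingT K] Polynomial (RingT K) :=
  aeval fun i => Polynomial.C (p₀ * C (w 0 i) + p₁ * C (w 1 i)) * Polynomial.X +
    Polynomial.C (C (p i))

lemma axialMap_C (p : Fin 3 → K) (w : Fin 2 → Fin 3 → K) (p₀ p₁ : RingT K) (c : RingT K) :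
    axialMap p w p₀ p₁ (C c) = Polynomial.C c := by
  rw [← algebraMap_eq, AlgHom.commutes]; rfl

lemma axialMap_movingLine (p : Fin 3 → K) (w : Fin 2 → Fin 3 → K) (p₀ p₁ : RingT K)
    (s : Fin 3 → RingT K) : axialMap p w p₀ p₁ (movingLine s) =
      Polynomial.C (∑ i, s i * (p₀ * C (w 0 i) + p₁ * C (w 1 i))) * Polynomial.X +
        Polynomial.C (∑ i, s i * C (p i)) := by
  rw [movingLine, map_sum]
  simp only [map_mul, axialMap_C]
  simp only [axialMap, aeval_X, Fin.sum_univ_three, map_add, map_mul]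
  ring

lemma linForm_eq_movingLine (l : Fin 3 → K) : linForm l = movingLine fun i => C (l i) := rfl

lemma axialMap_linForm (p : Fin 3 → K) (w : Fin 2 → Fin 3 → K) (p₀ p₁ : RingT K)
    (c : Fin 3 → K) : axialMap p w p₀ p₁ (linForm c) =
    Polynomial.C (p₀ * C (∑ i, c i * w 0 i) + p₁ * C (∑ i, c i * w 1 i)) * Polynomial.X +
      Polynomial.C (C (∑ i, c i * p i)) := by
  rw [linForm_eq_movingLine, axialMap_movingLine]
  simp only [Fin.sum_univ_three, map_add, map_mul]
  ring

namespace IsAxialBasis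

variable {u : Fin 3 → RingT K} {d : ℕ} {P Q : Fin 3 → RingT K} {p : Fin 3 → K}
  {L w : Fin 2 → Fin 3 → K} {l : Fin 3 → K} {p₀ p₁ : RingT K}
  (h : IsAxialBasis u d P Q p L w l p₀ p₁)
include h

lemma left_eq (i : Fin 3) : P i = p₁ * C (L 0 i) - p₀ * C (L 1 i) := by
  have h1 : movingLine P = movingLine fun i => p₁ * C (L 0 i) - p₀ * C (L 1 i) := by
    rw [h.axial]
    simp only [linForm, movingLine, Fin.sum_univ_three, C_sub, C_mul]
    ring
  exact congrFun (movingLine_injective h1) i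

lemma isRelPrime : IsRelPrime p₀ p₁ := fun e h0 h1 =>
  h.basis.isUnit_of_dvd fun i => by
    rw [h.left_eq]
    exact dvd_sub (h1.mul_right _) (h0.mul_right _)

lemma ne_zero₀ : p₀ ≠ 0 := fun h0 =>
  h.hom₁.not_isUnit_of_pos (isRelPrime_zero_left.1 (h0 ▸ h.isRelPrime))

lemma ne_zero₁ : p₁ ≠ 0 := fun h0 =>
  h.hom₀.not_isUnit_of_pos (isRelPrime_zero_right.1 (h0 ▸ h.isRelPrime))

lemma axialMap_zero : axialMap p w p₀ p₁ (linForm (L 0)) = Polynomial.C p₀ * Polynomial.X := by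
  rw [axialMap_linForm, h.Lw, h.Lw, h.coords.2]
  simp

lemma axialMap_one : axialMap p w p₀ p₁ (linForm (L 1)) = Polynomial.C p₁ * Polynomial.X := by
  rw [axialMap_linForm, h.Lw, h.Lw, h.coords.2]
  simp

lemma axialMap_two : axialMap p w p₀ p₁ (linForm l) = 1 := by
  rw [axialMap_linForm, h.lw, h.lw, h.lp]
  simp

lemma axialMap_left : axialMap p w p₀ p₁ (movingLine P) = 0 := by
  rw [h.axial, map_sub, map_mul, map_mul, axialMap_C, axialMap_C, h.axialMap_zero, h.axialMap_one]
  ring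

lemma isRelPrime_movingLine : IsRelPrime (C p₁ : RingTX K) (movingLine P) := by
  intro e he hP
  obtain ⟨e', _, rfl⟩ := (dvd_C_iff_exists h.ne_zero₁).1 he
  refine IsUnit.map C (h.basis.isUnit_of_dvd fun i => ?_)
  rw [← coeff_single_movingLine P i]
  exact C_dvd_iff_dvd_coeff _ _ |>.1 hP _

lemma X_eq (i : Fin 3) : (X i : RingTX K) =
    C (C (w 0 i)) * linForm (L 0) + C (C (w 1 i)) * linForm (L 1) + C (C (p i)) * linForm l := by
  have h1 : ∀ j, (C (C (w 0 i)) * C (C (L 0 j)) + C (C (w 1 i)) * C (C (L 1 j)) +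
      C (C (p i)) * C (C (l j)) : RingTX K) = if i = j then 1 else 0 := by
    intro j
    simp only [← C_mul, ← C_add]
    rw [h.id]
    split_ifs <;> simp
  have h2 : C (C (w 0 i)) * linForm (L 0) + C (C (w 1 i)) * linForm (L 1) +
      C (C (p i)) * linForm l = ∑ j, (C (C (w 0 i)) * C (C (L 0 j)) +
      C (C (w 1 i)) * C (C (L 1 j)) + C (C (p i)) * C (C (l j)) : RingTX K) * X j := by
    simp only [linForm, Fin.sum_univ_three]
    ring
  rw [h2]
  simp [h1]

/-- The kernel of `axialMap` on forms is generated by `F_{2,1}`. -/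
lemma dvd_of_axialMap_eq_zero {n : ℕ} {G : RingTX K} (hG : G.IsHomogeneous n)
    (h0 : axialMap p w p₀ p₁ G = 0) : movingLine P ∣ G := by
  -- Modulo `P` one has `p₁x₀ = p₀x₁`, so `Y` represents `p₁X`. In turn `Y i` is `p₁x₂` times `ψ(X
  -- i)` at `z = x₁/(p₁x₂)`, hence `G(Y) = 0` when `ψ(G) = 0`.
  let Y : Fin 3 → RingTX K := fun i => C p₁ * X i - movingLine P * C (C (w 0 i))
  have hY : ∀ i, Y i = C p₀ * linForm (L 1) * C (C (w 0 i)) + C p₁ * linForm (L 1) * C (C (w 1 i)) +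
      C p₁ * linForm l * C (C (p i)) := by
    intro i
    simp only [Y]
    conv_lhs => rw [h.X_eq i, h.axial]
    ring
  have hl0 : (linForm l : RingTX K) ≠ 0 := by
    intro hl
    have := h.axialMap_two
    rw [hl, map_zero] at this
    exact zero_ne_one this
  let ι : RingTX K →ₐ[RingT K] FractionRing (RingTX K) := Algebra.algHom _ _ _
  have hι : Function.Injective ι := IsFractionRing.injective (RingTX K) _
  have hc0 : ι (C p₁ * linForm l) ≠ 0 := by
    rw [Ne, map_eq_zero_iff ι hι]
    exact mul_ne_zero (C_ne_zero.2 h.ne_zero₁) hl0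
  let χ : Polynomial (RingT K) →ₐ[RingT K] FractionRing (RingTX K) :=
    Polynomial.aeval (ι (linForm (L 1)) / ι (C p₁ * linForm l))
  have hιC : ∀ c : RingT K, algebraMap (RingT K) (FractionRing (RingTX K)) c = ι (C c) := by
    intro c
    rw [← algebraMap_eq, AlgHom.commutes]
  have hYχ : ∀ i, ι (Y i) = ι (C p₁ * linForm l) * χ (axialMap p w p₀ p₁ (X i)) := by
    intro i
    have e1 := mul_div_cancel₀ (ι (linForm (L 1))) hc0
    simp only [χ, axialMap, aeval_X, map_add (Polynomial.aeval _), map_mul (Polynomial.aeval _),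
      Polynomial.aeval_X, Polynomial.aeval_C, hιC]
    rw [hY]
    simp only [C_add, C_mul, map_add ι, map_mul ι] at e1 ⊢
    linear_combination - (ι (C p₀) * ι (C (C (w 0 i))) + ι (C p₁) * ι (C (C (w 1 i)))) * e1
  have hY0 : aeval Y G = 0 := by
    refine hι ?_
    rw [map_zero, ← AlgHom.comp_apply, comp_aeval]
    simp_rw [hYχ]
    rw [hG.aeval_mul]
    have : aeval (fun i => χ (axialMap p w p₀ p₁ (X i))) = χ.comp (axialMap p w p₀ p₁) :=
      algHom_ext fun i => by simp
    rw [this, AlgHom.comp_apply, h0, map_zero, mul_zero]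
  have hdvd : movingLine P ∣ (C p₁) ^ n * G := by
    rw [← Ideal.mem_span_singleton, ← Ideal.Quotient.eq_zero_iff_mem]
    let π := Ideal.Quotient.mkₐ (RingT K) (Ideal.span {movingLine P})
    change π (C p₁ ^ n * G) = 0
    have h1 : C p₁ ^ n * G = aeval (fun i => C p₁ * (X i : RingTX K)) G := by
      rw [hG.aeval_mul, aeval_X_left, AlgHom.id_apply]
    have h2 : π (movingLine P) = 0 :=
      Ideal.Quotient.eq_zero_iff_mem.2 (Ideal.mem_span_singleton_self _)
    have h3 : π.comp (aeval fun i => C p₁ * (X i : RingTX K)) = π.comp (aeval Y) := by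
      refine algHom_ext fun i => ?_
      simp only [Y, AlgHom.comp_apply, aeval_X, map_sub, map_mul, h2, zero_mul, sub_zero]
    rw [h1, ← map_zero π, ← hY0]
    exact DFunLike.congr_fun h3 G
  -- The power of `p₁` introduced by the substitution is removed, `p₁` being coprime to the moving
  -- line.
  exact (h.isRelPrime_movingLine.pow_left.symm).dvd_of_dvd_mul_left hdvd

/-- Otherwise `P` would divide `Q` as moving lines, with a cofactor of `X`-degree 0, against their
independence. -/
lemma axialMap_right_ne_zero : axialMap p w p₀ p₁ (movingLine Q) ≠ 0 := by
  intro h0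
  have hP := (IsBihomogeneous.of_movingLine h.basis.homP).1
  have hQ := (IsBihomogeneous.of_movingLine h.basis.homQ).1
  obtain ⟨c, hc⟩ := h.dvd_of_axialMap_eq_zero hQ h0
  have hP0 : movingLine P ≠ 0 := by
    intro h1
    refine h.basis.left_ne_zero (movingLine_injective ?_)
    rw [h1]
    simp [movingLine]
  have hc' : ∃ c', c = C c' := by
    rw [hc] at hQ
    rcases hP.of_mul_left hP0 hQ with rfl | ⟨e, he, hce⟩
    · exact ⟨0, C_0.symm⟩
    · have : e = 0 := by omega
      subst this
      exact ⟨_, totalDegree_eq_zero_iff_eq_C.1 ((totalDegree_zero_iff_isHomogeneous _).2 hce)⟩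
  obtain ⟨c', rfl⟩ := hc'
  have h2 : Q = fun i => c' * P i := by
    refine movingLine_injective ?_
    rw [hc]
    simp only [movingLine, Fin.sum_univ_three, C_mul]
    ring
  have := (h.basis.combination_eq_zero (a := c') (b := -1) fun i => by
    rw [congrFun h2 i]; ring).2
  simp at this

/-- The syzygy `P` reads `p₁ (L 0 · u) = p₀ (L 1 · u)`; as `p₀, p₁` are coprime, `u` has coordinates
`(p₀g, p₁g, v)`. So `u` is `v` times the vector of the `ψ(X i)` at `z = g/v`. -/
lemma exists_factor : ∃ g v : RingT K, g ≠ 0 ∧ v ≠ 0 ∧ IsRelPrime g v ∧ g.IsHomogeneous (d - 2) ∧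
    ∀ i, u i = g * (p₀ * C (w 0 i) + p₁ * C (w 1 i)) + v * C (p i) := by
  have hlin : ∀ c : Fin 3 → K, (∑ i, C (c i) * u i).IsHomogeneous d := fun c =>
    IsHomogeneous.sum _ _ _ fun i _ => (h.hom i).C_mul _
  have hsyz : p₁ * ∑ i, C (L 0 i) * u i = p₀ * ∑ i, C (L 1 i) * u i := by
    have h1 := mem_syzygies_iff.1 h.basis.mem_left
    simp_rw [h.left_eq] at h1
    simp only [Fin.sum_univ_three] at h1 ⊢
    linear_combination h1
  obtain ⟨g, hg⟩ : p₀ ∣ ∑ i, C (L 0 i) * u i :=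
    h.isRelPrime.dvd_of_dvd_mul_left ⟨_, hsyz⟩
  have hg1 : ∑ i, C (L 1 i) * u i = p₁ * g := by
    refine mul_left_cancel₀ h.ne_zero₀ ?_
    rw [← hsyz, hg]; ring
  set v := ∑ i, C (l i) * u i with hv
  have hu : ∀ i, u i = g * (p₀ * C (w 0 i) + p₁ * C (w 1 i)) + v * C (p i) := by
    intro i
    have h1 : ∀ j, (C (w 0 i) * C (L 0 j) + C (w 1 i) * C (L 1 j) + C (p i) * C (l j) : RingT K) =
        if i = j then 1 else 0 := by
      intro j
      rw [← C_mul, ← C_mul, ← C_mul, ← C_add, ← C_add, h.id]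
      split_ifs <;> simp
    have h2 : u i = ∑ j, (C (w 0 i) * C (L 0 j) + C (w 1 i) * C (L 1 j) +
        C (p i) * C (l j)) * u j := by simp [h1]
    have h3 : u i = C (w 0 i) * ∑ j, C (L 0 j) * u j + C (w 1 i) * ∑ j, C (L 1 j) * u j +
        C (p i) * v := by
      rw [h2]
      simp only [hv, Fin.sum_univ_three]
      ring
    rw [h3, hg, hg1]; ring
  have hg0 : g ≠ 0 := by
    rintro rfl
    rw [mul_zero] at hg
    have h1 := eq_zero_of_degree_lt_muDegree (s := fun i => C (L 0 i))
      (mem_syzygies_iff.2 hg) (m := 0) (fun i => isHomogeneous_C _ _) (by rw [h.mu]; norm_num)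
    refine h.coords.1.ne_zero 0 (funext fun i => ?_)
    exact C_eq_zero.1 (congrFun h1 i)
  have hghom : g.IsHomogeneous (d - 2) := by
    have h1 := hlin (L 0)
    rw [hg] at h1
    rcases h.hom₀.of_mul_left h.ne_zero₀ h1 with h2 | ⟨e, he, h2⟩
    · exact (hg0 h2).elim
    · have : e = d - 2 := by omega
      exact this ▸ h2
  have hrel : IsRelPrime g v := fun e h1 h2 => h.coprime e fun i => by
    rw [hu]
    exact dvd_add (h1.mul_right _) (h2.mul_right _)
  refine ⟨g, v, hg0, fun hv0 => ?_, hrel, hghom, hu⟩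
  rw [hv0] at hrel
  have h5 := h.five_le
  have : g.IsHomogeneous (d - 3 + 1) := by
    convert! hghom using 1; omega
  exact this.not_isUnit_of_pos (isRelPrime_zero_right.1 hrel)

/-- The image of a moving curve is a multiple of the image of the moving line `Q`. -/
lemma dvd_axialMap {n : ℕ} {G : RingTX K} (hG : G.IsHomogeneous n) (h0 : aeval u G = 0) :
    axialMap p w p₀ p₁ (movingLine Q) ∣ axialMap p w p₀ p₁ G := by
  classical
  obtain ⟨g, v, hg0, hv0, hrel, hghom, hu⟩ := h.exists_factor
  obtain ⟨inst⟩ : Nonempty (NormalizedGCDMonoid (RingT K)) := inferInstance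
  -- Vanishing of `G` on `u` means that `ψ(G)` has the root `g/v`. The polynomial `vz - g` is
  -- primitive, so by Gauss's lemma it divides `ψ(G)` over `R`.
  let f : Polynomial (RingT K) := Polynomial.C v * Polynomial.X - Polynomial.C g
  have hfc0 : f.coeff 0 = -g := by simp [f]
  have hfc1 : f.coeff 1 = v := by simp [f]
  have hprim : f.IsPrimitive := by
    intro r hr
    rw [Polynomial.C_dvd_iff_dvd_coeff] at hr
    have h1 := hr 0
    have h2 := hr 1
    rw [hfc0, dvd_neg] at h1
    rw [hfc1] at h2
    exact hrel h1 h2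
  let F := FractionRing (RingT K)
  have hvF : algebraMap (RingT K) F v ≠ 0 := by
    rwa [Ne, map_eq_zero_iff _ (IsFractionRing.injective (RingT K) F)]
  have key : ∀ {n : ℕ} {G : RingTX K}, G.IsHomogeneous n → aeval u G = 0 →
      f ∣ axialMap p w p₀ p₁ G := by
    intro n G hG h0
    refine hprim.dvd_of_fraction_map_dvd_fraction_map (K := F) ?_
    have hroot : Polynomial.aeval (algebraMap (RingT K) F g / algebraMap (RingT K) F v)
        (axialMap p w p₀ p₁ G) = 0 := by
      set χ : Polynomial (RingT K) →ₐ[RingT K] F :=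
        Polynomial.aeval (algebraMap (RingT K) F g / algebraMap (RingT K) F v) with hχ
      have h1 : algebraMap (RingT K) F (aeval u G) = algebraMap (RingT K) F v ^ n *
          χ (axialMap p w p₀ p₁ G) := by
        have h2 : χ.comp (axialMap p w p₀ p₁) = aeval (fun i => χ (axialMap p w p₀ p₁ (X i))) :=
          algHom_ext fun i => by simp
        rw [← AlgHom.comp_apply, h2, ← hG.aeval_mul, ← aeval_algebraMap_apply]
        congr 2
        funext i
        have e1 := mul_div_cancel₀ (algebraMap (RingT K) F g) hvF
        simp only [hχ, axialMap, aeval_X, map_add, map_mul, Polynomial.aeval_X, Polynomial.aeval_C,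
          Function.comp_apply]
        rw [hu i]
        simp only [map_add, map_mul]
        linear_combination - (algebraMap (RingT K) F p₀ * algebraMap (RingT K) F (C (w 0 i)) +
          algebraMap (RingT K) F p₁ * algebraMap (RingT K) F (C (w 1 i))) * e1
      rw [h0, map_zero, eq_comm, mul_eq_zero] at h1
      exact h1.resolve_left (pow_ne_zero _ hvF)
    have h3 : f.map (algebraMap (RingT K) F) = Polynomial.C (algebraMap (RingT K) F v) *
        (Polynomial.X - Polynomial.C (algebraMap (RingT K) F g / algebraMap (RingT K) F v)) := by
      simp only [f, Polynomial.map_sub, Polynomial.map_mul, Polynomial.map_C, Polynomial.map_X]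
      rw [mul_sub, ← Polynomial.C_mul, mul_div_cancel₀ _ hvF]
    rw [h3, IsUnit.mul_left_dvd (Polynomial.isUnit_C.2 hvF.isUnit), Polynomial.dvd_iff_isRoot,
      Polynomial.IsRoot, Polynomial.eval_map_algebraMap]
    exact hroot
  obtain ⟨c, hc⟩ := key (IsBihomogeneous.of_movingLine h.basis.homQ).1 (by
    rw [movingLine_aeval]; exact mem_syzygies_iff.1 h.basis.mem_right)
  have hq0 := h.axialMap_right_ne_zero
  have hc0 : c ≠ 0 := by rintro rfl; exact hq0 (by rw [hc, mul_zero])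
  have hf0 : f ≠ 0 := fun hf => hv0 (by rw [← hfc1, hf, Polynomial.coeff_zero])
  have hfdeg : 1 ≤ f.natDegree := Polynomial.le_natDegree_of_ne_zero (by rwa [hfc1])
  have hcdeg : c.natDegree = 0 := by
    have h1 : (axialMap p w p₀ p₁ (movingLine Q)).natDegree ≤ 1 := by
      rw [axialMap_movingLine]
      exact Polynomial.natDegree_linear_le
    rw [hc, Polynomial.natDegree_mul hf0 hc0] at h1
    omega
  rw [Polynomial.natDegree_eq_zero] at hcdeg
  obtain ⟨r, rfl⟩ := hcdeg
  -- `ψ(Q)` itself is `r (vz - g)`; the constant coefficients both have degree `d - 2`, so `r` is a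
  -- nonzero constant.
  have hru : IsUnit r := by
    have h1 := congrArg (fun q => Polynomial.coeff q 0) hc
    simp only [axialMap_movingLine, Polynomial.coeff_mul_C, hfc0] at h1
    simp at h1
    have h2 : (g * r).IsHomogeneous (d - 2) := by
      have h3 : (∑ i, Q i * C (p i)).IsHomogeneous (d - 2) :=
        IsHomogeneous.sum _ _ _ fun i _ => by
          simpa using (h.basis.homQ i).mul (isHomogeneous_C (Fin 2) (p i))
      rw [h1] at h3
      simpa using h3.neg
    have hr0 : r ≠ 0 := by rintro rfl; exact hc0 Polynomial.C_0
    rcases hghom.of_mul_left hg0 h2 with h3 | ⟨e, he, h3⟩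
    · exact (hr0 h3).elim
    · have he0 : e = 0 := by omega
      subst he0
      have h4 := totalDegree_eq_zero_iff_eq_C.1 ((totalDegree_zero_iff_isHomogeneous _).2 h3)
      rw [h4] at hr0 ⊢
      exact IsUnit.map C (IsUnit.mk0 _ (C_ne_zero.1 hr0))
  rw [hc, (Polynomial.isUnit_C.2 hru).mul_right_dvd]
  exact key hG h0

end IsAxialBasis

end Setup

/-! ### Generation in positive `T`-degree -/

section Generation

variable {K : Type*} [Field K]

/-- `f` is homogeneous of weight `s` when the variable `z` has weight `-2`. -/
def HasWeight (s : ℕ) (f : Polynomial (RingT K)) : Prop :=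
  ∀ i, (f.coeff i).IsHomogeneous (s + 2 * i)

namespace HasWeight

lemma zero (s : ℕ) : HasWeight s (0 : Polynomial (RingT K)) := fun i => by
  rw [Polynomial.coeff_zero]; exact isHomogeneous_zero _ _ _

lemma add {s : ℕ} {f g : Polynomial (RingT K)} (hf : HasWeight s f) (hg : HasWeight s g) :
    HasWeight s (f + g) := fun i => by
  rw [Polynomial.coeff_add]; exact (hf i).add (hg i)

lemma mul {s t : ℕ} {f g : Polynomial (RingT K)} (hf : HasWeight s f) (hg : HasWeight t g) :
    HasWeight (s + t) (f * g) := fun i => by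
  rw [Polynomial.coeff_mul]
  refine IsHomogeneous.sum _ _ _ fun x hx => ?_
  have h1 := (hf x.1).mul (hg x.2)
  have h2 : s + t + 2 * i = s + 2 * x.1 + (t + 2 * x.2) := by
    rw [← Finset.HasAntidiagonal.mem_antidiagonal.1 hx]; ring
  rwa [h2]

lemma of_C {s : ℕ} {c : RingT K} (hc : c.IsHomogeneous s) : HasWeight s (Polynomial.C c) := by
  intro i
  rw [Polynomial.coeff_C]
  split_ifs with h
  · simpa [h] using hc
  · exact isHomogeneous_zero _ _ _

lemma prod_pow {ι : Type*} (J : Finset ι) (f : ι → Polynomial (RingT K)) (e : ι → ℕ)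
    (hf : ∀ i, HasWeight 0 (f i)) : HasWeight 0 (∏ i ∈ J, f i ^ e i) := by
  have h1 : HasWeight 0 (1 : Polynomial (RingT K)) := by
    rw [← Polynomial.C_1]; exact of_C (isHomogeneous_one _ _)
  refine Finset.prod_induction _ (HasWeight 0) (fun a b ha hb => ha.mul hb) h1 fun i _ => ?_
  induction e i with
  | zero => rw [pow_zero]; exact h1
  | succ n ih => rw [pow_succ]; exact ih.mul (hf i)

end HasWeight

lemma IsBihomogeneous.hasWeight_axialMap {p : Fin 3 → K} {w : Fin 2 → Fin 3 → K} {p₀ p₁ : RingT K}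
    (h0 : p₀.IsHomogeneous 2) (h1 : p₁.IsHomogeneous 2) {s n : ℕ} {G : RingTX K}
    (hG : IsBihomogeneous s n G) : HasWeight s (axialMap p w p₀ p₁ G) := by
  rw [G.as_sum, map_sum]
  refine Finset.sum_induction _ (HasWeight s) (fun _ _ => HasWeight.add) (HasWeight.zero s)
    fun m _ => ?_
  rw [axialMap, aeval_monomial]
  refine (HasWeight.of_C (hG.2 m)).mul (HasWeight.prod_pow _ _ _ fun i => ?_)
  intro j
  match j with
  | 0 => simpa using isHomogeneous_C (Fin 2) (p i)
  | 1 =>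
    simpa using (h0.mul (isHomogeneous_C (Fin 2) (w 0 i))).add
      (h1.mul (isHomogeneous_C (Fin 2) (w 1 i)))
  | j + 2 =>
    have : (Polynomial.C (p₀ * C (w 0 i) + p₁ * C (w 1 i)) * Polynomial.X +
        Polynomial.C (C (p i)) : Polynomial (RingT K)).coeff (j + 2) = 0 :=
      Polynomial.coeff_eq_zero_of_natDegree_lt
        (lt_of_le_of_lt Polynomial.natDegree_linear_le (by omega))
    rw [this]
    exact isHomogeneous_zero _ _ _

lemma natDegree_axialMap_le (p : Fin 3 → K) (w : Fin 2 → Fin 3 → K) (p₀ p₁ : RingT K) {n : ℕ}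
    {G : RingTX K} (hG : G.IsHomogeneous n) : (axialMap p w p₀ p₁ G).natDegree ≤ n := by
  conv_lhs => rw [G.as_sum, map_sum]
  refine Polynomial.natDegree_sum_le_of_forall_le _ _ fun m hm => ?_
  rw [axialMap, aeval_monomial]
  refine (Polynomial.natDegree_C_mul_le _ _).trans ?_
  rw [Finsupp.prod]
  refine (Polynomial.natDegree_prod_le _ _).trans ?_
  rw [hG.degree_eq_sum_deg_support hm]
  refine Finset.sum_le_sum fun i _ => ?_
  refine Polynomial.natDegree_pow_le.trans ?_
  exact (Nat.mul_le_mul_left _ Polynomial.natDegree_linear_le).trans (mul_one _).le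

namespace IsAxialBasis

variable {u : Fin 3 → RingT K} {d : ℕ} {P Q : Fin 3 → RingT K} {p : Fin 3 → K}
  {L w : Fin 2 → Fin 3 → K} {l : Fin 3 → K} {p₀ p₁ : RingT K}
  (h : IsAxialBasis u d P Q p L w l p₀ p₁)
include h

/-- With `ψ(Q) = q₁z + q₂`, the syzygy condition is `g q₁ + v q₂ = 0`. As `g, v` are nonzero, if one
coefficient vanished so would the other, and then `ψ(Q) = 0`. -/
lemma exists_linear : ∃ q₁ q₂ : RingT K, q₁ ≠ 0 ∧ q₂ ≠ 0 ∧ q₁.IsHomogeneous d ∧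
    q₂.IsHomogeneous (d - 2) ∧
    axialMap p w p₀ p₁ (movingLine Q) = Polynomial.C q₁ * Polynomial.X + Polynomial.C q₂ := by
  obtain ⟨g, v, hg0, hv0, -, -, hu⟩ := h.exists_factor
  have h5 := h.five_le
  refine ⟨_, _, ?_, ?_, ?_, ?_, axialMap_movingLine p w p₀ p₁ Q⟩
  rotate_left 2
  · refine IsHomogeneous.sum _ _ _ fun i _ => ?_
    have h1 := (h.basis.homQ i).mul ((h.hom₀.mul (isHomogeneous_C (Fin 2) (w 0 i))).add
      (h.hom₁.mul (isHomogeneous_C (Fin 2) (w 1 i))))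
    have h2 : d - 2 + (2 + 0) = d := by omega
    rwa [h2] at h1
  · refine IsHomogeneous.sum _ _ _ fun i _ => ?_
    exact (h.basis.homQ i).mul (isHomogeneous_C (Fin 2) (p i))
  all_goals
    have hne := h.axialMap_right_ne_zero
    rw [axialMap_movingLine] at hne
    have hsum : g * ∑ i, Q i * (p₀ * C (w 0 i) + p₁ * C (w 1 i)) + v * ∑ i, Q i * C (p i) = 0 := by
      rw [← mem_syzygies_iff.1 h.basis.mem_right]
      simp only [hu, Fin.sum_univ_three]
      ring
    intro h0
    rw [h0] at hsum hne
    simp only [mul_zero, zero_add, add_zero, mul_eq_zero, hg0, hv0, false_or] at hsum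
    rw [hsum] at hne
    simp at hne

/-- Quotients of polynomials with a weight by the image of `Q` have a weight. -/
lemma coeff_of_mul_eq {s : ℕ} {f x : Polynomial (RingT K)} (hf : HasWeight s f)
    (hx : axialMap p w p₀ p₁ (movingLine Q) * x = f) (i : ℕ) :
    x.coeff i = 0 ∨ ∃ e, e + (d - 2) = s + 2 * i ∧ (x.coeff i).IsHomogeneous e := by
  obtain ⟨q₁, q₂, -, hq₂, hh₁, hh₂, hq⟩ := h.exists_linear
  have h5 := h.five_le
  have hx' : f = Polynomial.C q₁ * (Polynomial.X * x) + Polynomial.C q₂ * x := by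
    rw [← hx, hq]; ring
  -- Coefficients are found from the bottom: `q₂ x_{i+1} = f_{i+1} - q₁ x_i`, with both terms on the
  -- right of the same degree.
  induction i with
  | zero =>
    have h1 := hf 0
    rw [hx'] at h1
    simp only [Polynomial.coeff_add, Polynomial.coeff_C_mul, Polynomial.coeff_X_mul_zero, mul_zero,
      zero_add] at h1
    exact hh₂.of_mul_left hq₂ h1
  | succ i ih =>
    have h1 := hf (i + 1)
    have h2 : q₂ * x.coeff (i + 1) = f.coeff (i + 1) - q₁ * x.coeff i := by
      rw [hx']
      simp only [Polynomial.coeff_add, Polynomial.coeff_C_mul, Polynomial.coeff_X_mul]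
      ring
    have h3 : (q₁ * x.coeff i).IsHomogeneous (s + 2 * (i + 1)) := by
      rcases ih with h4 | ⟨e, he, h4⟩
      · rw [h4, mul_zero]; exact isHomogeneous_zero _ _ _
      · have h5 := hh₁.mul h4
        have h6 : d + e = s + 2 * (i + 1) := by omega
        rwa [h6] at h5
    refine hh₂.of_mul_left hq₂ ?_
    rw [h2]
    exact h1.sub h3

end IsAxialBasis

/-- `F_{2,1}`, `F_{2(k-1)-1,1}, …, F_{1,k-1}`, `F_{1,k}` generate the part of positive degree
in `T`. -/
def positiveFamily (k : ℕ) (P : Fin 3 → RingT K) (F : ℕ → RingTX K) (S : RingTX K) :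
    Set (RingTX K) :=
  {movingLine P, S} ∪ F '' Set.Icc 1 (k - 1)

/-! ### The special family under `ψ` -/

section Family

variable {u : Fin 3 → RingT K} {d k : ℕ} {P Q : Fin 3 → RingT K} {p : Fin 3 → K}
  {L w : Fin 2 → Fin 3 → K} {l : Fin 3 → K} {p₀ p₁ : RingT K} {F : ℕ → RingTX K} {S : RingTX K}
  (h : IsAxialBasis u d P Q p L w l p₀ p₁) (hk : d = 2 * k - 1)
  (fam : IsSpecialFamily k L P Q p₀ p₁ F S)

include h hk fam

lemma IsSpecialFamily.isBihomogeneous {j : ℕ} (h1 : 1 ≤ j) (hj : j ≤ k - 1) :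
    IsBihomogeneous (2 * (k - j) - 1) j (F j) := by
  have h5 := h.five_le
  obtain rfl | h2 : j = 1 ∨ 2 ≤ j := by omega
  · rw [fam.start]
    have := IsBihomogeneous.of_movingLine h.basis.homQ
    have e : 2 * (k - 1) - 1 = d - 2 := by omega
    rwa [e]
  · obtain ⟨G₀, G₁, hG₀, hG₁, -, hF⟩ := fam.step j h2 hj
    rw [hF]
    have h3 := ((IsBihomogeneous.of_linForm (L 0)).mul hG₀).add
      ((IsBihomogeneous.of_linForm (L 1)).mul hG₁)
    have e1 : 0 + (2 * (k - j) - 1) = 2 * (k - j) - 1 := by omega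
    have e2 : 1 + (j - 1) = j := by omega
    rwa [e1, e2] at h3

lemma IsSpecialFamily.isBihomogeneous_sylvester : IsBihomogeneous 1 k S := by
  have h5 := h.five_le
  obtain ⟨G, H, F₀, F₁, hG, hH, hF₀, hF₁, -, -, rfl⟩ := fam.sylvester
  have h3 := ((IsBihomogeneous.of_embX hF₀).mul hG).add ((IsBihomogeneous.of_embX hF₁).mul hH)
  have e : k - 1 + 1 = k := by omega
  rwa [zero_add, e] at h3

omit hk in
-- Replacing `p₀, p₁` by `x₀, x₁` multiplies the image under `ψ` by `z`, whatever decomposition is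
-- chosen.
lemma IsSpecialFamily.axialMap_eq {j : ℕ} (h1 : 1 ≤ j) (hj : j ≤ k - 1) :
    axialMap p w p₀ p₁ (F j) =
      Polynomial.X ^ (j - 1) * axialMap p w p₀ p₁ (movingLine Q) := by
  induction j, h1 using Nat.le_induction with
  | base => rw [fam.start]; simp
  | succ j h1 ih =>
    obtain ⟨G₀, G₁, -, -, hG, hF⟩ := fam.step (j + 1) (by omega) hj
    have ih' := ih (by omega)
    rw [Nat.add_sub_cancel] at hG
    rw [hG, map_add, map_mul, map_mul, axialMap_C, axialMap_C] at ih'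
    have e : j = (j - 1) + 1 := by omega
    rw [hF, map_add, map_mul, map_mul, h.axialMap_zero, h.axialMap_one, Nat.add_sub_cancel]
    conv_rhs => rw [e, pow_succ', mul_assoc, ← ih']
    ring

omit hk fam in
lemma eq_zero_of_movingLine_dvd {n : ℕ} {B : RingTX K} (hB : IsBihomogeneous 1 n B)
    (hdvd : movingLine P ∣ B) : B = 0 := by
  obtain ⟨c, rfl⟩ := hdvd
  rw [← hB.bicomp_self, mul_comm,
    bicomp_mul_of_isBihomogeneous _ (IsBihomogeneous.of_movingLine h.basis.homP)]
  simp

/-- From `T₀ψ(G) + T₁ψ(H) = 0` one gets `ψ(H) = T₀ε` and `ψ(G) = -T₁ε`, so `ψ(S) = ε ψ(F_{1,k-1})`.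
The last clause makes `S` a new generator and supplies the missing quadric. -/
lemma IsSpecialFamily.exists_sylvester_image : ∃ ε : Polynomial (RingT K),
    HasWeight 0 ε ∧ ε.natDegree ≤ 1 ∧
    axialMap p w p₀ p₁ S =
      ε * (Polynomial.X ^ (k - 2) * axialMap p w p₀ p₁ (movingLine Q)) ∧
    ∀ B, IsBihomogeneous 0 1 B → axialMap p w p₀ p₁ B ≠ ε := by
  have h5 := h.five_le
  obtain ⟨G, H, F₀, F₁, hG, hH, -, -, hP, hF, hS⟩ := fam.sylvester
  have hψP := h.axialMap_left
  rw [hP, map_add, map_mul, map_mul, varT, varT, axialMap_C, axialMap_C] at hψP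
  have hrel : IsRelPrime (X 0 : RingT K) (X 1) :=
    (Irreducible.isRelPrime_iff_not_dvd (X_prime (R := K)).irreducible).2 (by
      rw [X_dvd_X]; simp)
  have hdvd : Polynomial.C (X 0 : RingT K) ∣ axialMap p w p₀ p₁ H := by
    rw [Polynomial.C_dvd_iff_dvd_coeff]
    intro i
    have h1 := congrArg (fun q => Polynomial.coeff q i) hψP
    simp only [Polynomial.coeff_add, Polynomial.coeff_C_mul, Polynomial.coeff_zero] at h1
    exact hrel.dvd_of_dvd_mul_left
      ⟨-(axialMap p w p₀ p₁ G).coeff i, by linear_combination h1⟩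
  obtain ⟨ε, hε⟩ := hdvd
  have hX0 : (Polynomial.C (X 0 : RingT K)) ≠ 0 := Polynomial.C_ne_zero.2 (X_ne_zero _)
  have hεG : axialMap p w p₀ p₁ G = - (Polynomial.C (X 1) * ε) := by
    refine mul_left_cancel₀ hX0 ?_
    rw [hε] at hψP
    linear_combination hψP
  refine ⟨ε, fun i => ?_, ?_, ?_, ?_⟩
  · have h1 := hH.hasWeight_axialMap (p := p) (w := w) h.hom₀ h.hom₁ i
    rw [hε, Polynomial.coeff_C_mul] at h1
    rcases (isHomogeneous_X K (0 : Fin 2)).of_mul_left (X_ne_zero _) h1 with h2 | ⟨e, he, h2⟩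
    · rw [h2]; exact isHomogeneous_zero _ _ _
    · have : e = 0 + 2 * i := by omega
      rwa [this] at h2
  · have h1 := natDegree_axialMap_le p w p₀ p₁ hH.1
    rwa [hε, Polynomial.natDegree_C_mul (X_ne_zero _)] at h1
  · have h2 := fam.axialMap_eq h (j := k - 1) (by omega) le_rfl
    have e : k - 1 - 1 = k - 2 := by omega
    rw [e] at h2
    rw [← h2, hS, hF]
    simp only [map_add, map_sub, map_mul, varT, axialMap_C]
    rw [hε, hεG]
    ring
  -- If `ε = ψ(B)`, then `H - T₀B` and `G + T₁B` lie in the kernel but have `T`-degree 1, so both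
  -- vanish and `P = T₀G + T₁H = 0`.
  · intro B hB hBε
    have hH0 : H - varT K 0 * B = 0 := by
      have hb : IsBihomogeneous 1 1 (H - varT K 0 * B) :=
        hH.sub (by simpa using (IsBihomogeneous.of_varT 0).mul hB)
      refine eq_zero_of_movingLine_dvd h hb (h.dvd_of_axialMap_eq_zero hb.1 ?_)
      rw [map_sub, map_mul, varT, axialMap_C, hBε, hε, sub_self]
    have hG0 : G + varT K 1 * B = 0 := by
      have hb : IsBihomogeneous 1 1 (G + varT K 1 * B) :=
        hG.add (by simpa using (IsBihomogeneous.of_varT 1).mul hB)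
      refine eq_zero_of_movingLine_dvd h hb (h.dvd_of_axialMap_eq_zero hb.1 ?_)
      rw [map_add, map_mul, varT, axialMap_C, hBε, hεG]; ring
    refine h.basis.left_ne_zero (movingLine_injective ?_)
    have : movingLine P = 0 := by
      rw [hP]; linear_combination varT K 1 * hH0 + varT K 0 * hG0
    rw [this]
    simp [movingLine]

/-- Starting from `F_{1,k-1}`, each extra power of `z` is paid for by a factor `p₀` or `p₁` of `c`,
turned into `x₀` or `x₁`. The bound `2m ≤ e` leaves enough degree for this. -/
lemma IsSpecialFamily.exists_lift_of_le (m : ℕ) : ∀ {e : ℕ} {c : RingT K}, c.IsHomogeneous e →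
    2 * m ≤ e → ∃ G ∈ Ideal.span (positiveFamily k P F S), G.IsHomogeneous (k - 1 + m) ∧
      axialMap p w p₀ p₁ G = axialMap p w p₀ p₁ (movingLine Q) *
        (Polynomial.C c * Polynomial.X ^ (k - 2 + m)) := by
  have h5 := h.five_le
  have hFk : F (k - 1) ∈ Ideal.span (positiveFamily k P F S) :=
    Ideal.subset_span (Or.inr ⟨k - 1, ⟨by omega, le_rfl⟩, rfl⟩)
  have hSmem : S ∈ Ideal.span (positiveFamily k P F S) :=
    Ideal.subset_span (Or.inl (by simp))
  have hFhom := (fam.isBihomogeneous h hk (j := k - 1) (by omega) le_rfl).1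
  have hψF := fam.axialMap_eq h (j := k - 1) (by omega) le_rfl
  have e1 : k - 1 - 1 = k - 2 := by omega
  rw [e1] at hψF
  have hlin : ∀ c : Fin 3 → K, (linForm c : RingTX K).IsHomogeneous 1 := fun c =>
    (IsBihomogeneous.of_linForm c).1
  induction m with
  | zero =>
    intro e c _ _
    refine ⟨C c * F (k - 1), Ideal.mul_mem_left _ _ hFk, hFhom.C_mul c, ?_⟩
    rw [map_mul, axialMap_C, hψF, add_zero]
    ring
  | succ m ih =>
    intro e c hc he
    obtain he2 | he3 : e = 2 ∨ 3 ≤ e := by omega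
    · subst he2
      have hm : m = 0 := by omega
      -- Here `c` is a quadric and need not lie in the span of `p₀, p₁`. The term `S - c₀ x₂
      -- F_{1,k-1}` has image `J z^(k-1) ψ(Q)` and provides the missing direction.
      subst hm
      obtain ⟨ε, hεw, hεd, hψS, hεn⟩ := fam.exists_sylvester_image h hk
      have hJ : (ε.coeff 1).IsHomogeneous 2 := by simpa using hεw 1
      have hε : ε = Polynomial.C (ε.coeff 1) * Polynomial.X + Polynomial.C (ε.coeff 0) :=
        Polynomial.eq_X_add_C_of_natDegree_le_one hεd
      obtain ⟨c₀, hc₀⟩ : ∃ c₀, ε.coeff 0 = C c₀ :=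
        ⟨_, totalDegree_eq_zero_iff_eq_C.1 ((totalDegree_zero_iff_isHomogeneous _).2
          (by simpa using hεw 0))⟩
      rw [hc₀] at hε
      have hCC : ∀ (a : K) (c : Fin 3 → K), IsBihomogeneous 0 1 (C (C a) * linForm c : RingTX K) :=
        fun a c => by
          simpa using (IsBihomogeneous.of_C (isHomogeneous_C (Fin 2) a)).mul
            (IsBihomogeneous.of_linForm c)
      -- If `J = a p₀ + b p₁`, then `ε` would be the image of `a x₀ + b x₁ + c₀ x₂`.
      have hJn : ∀ a b : K, ε.coeff 1 ≠ C a * p₀ + C b * p₁ := by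
        intro a b hab
        refine hεn (C (C a) * linForm (L 0) + C (C b) * linForm (L 1) + C (C c₀) * linForm l)
          (((hCC _ _).add (hCC _ _)).add (hCC _ _)) ?_
        rw [hε, hab]
        simp only [map_add, map_mul, axialMap_C, h.axialMap_zero, h.axialMap_one, h.axialMap_two]
        ring
      obtain ⟨a₀, a₁, a₂, ha⟩ :=
        exists_eq_combination_of_degree_two h.hom₀ h.hom₁ h.isRelPrime hJ hJn hc
      have hShom := (fam.isBihomogeneous_sylvester h hk).1
      have e2 : k - 1 + (0 + 1) = k := by omega
      have e3 : 1 + (k - 1) = k := by omega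
      have e4 : k - 2 + (0 + 1) = k - 2 + 1 := by omega
      have hFlin : ∀ (a : K) (c : Fin 3 → K),
          (C (C a) * linForm c * F (k - 1) : RingTX K).IsHomogeneous k := fun a c => by
        have := (hCC a c).1.mul hFhom
        rwa [e3] at this
      refine ⟨C (C a₀) * linForm (L 0) * F (k - 1) + C (C a₁) * linForm (L 1) * F (k - 1) +
        C (C a₂) * (S - C (C c₀) * linForm l * F (k - 1)), ?_, ?_, ?_⟩
      · exact Ideal.add_mem _ (Ideal.add_mem _ (Ideal.mul_mem_left _ _ hFk)
          (Ideal.mul_mem_left _ _ hFk)) (Ideal.mul_mem_left _ _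
            (Ideal.sub_mem _ hSmem (Ideal.mul_mem_left _ _ hFk)))
      · rw [e2]
        exact ((hFlin _ _).add (hFlin _ _)).add ((hShom.sub (hFlin _ _)).C_mul _)
      · simp only [map_add, map_sub, map_mul, axialMap_C, h.axialMap_zero, h.axialMap_one,
          h.axialMap_two, hψF, hψS, e4]
        conv_rhs => rw [ha]
        conv_lhs => rw [hε]
        simp only [map_add, map_mul]
        ring
    · obtain ⟨e', rfl⟩ : ∃ e', e = e' + 1 + 2 := ⟨e - 3, by omega⟩
      obtain ⟨a, b, ha, hb, rfl⟩ :=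
        exists_eq_mul_add_mul_of_isRelPrime h.hom₀ h.hom₁ h.isRelPrime hc
      obtain ⟨G₀, hG₀, hh₀, hψ₀⟩ := ih ha (by omega)
      obtain ⟨G₁, hG₁, hh₁, hψ₁⟩ := ih hb (by omega)
      refine ⟨linForm (L 0) * G₀ + linForm (L 1) * G₁,
        Ideal.add_mem _ (Ideal.mul_mem_left _ _ hG₀) (Ideal.mul_mem_left _ _ hG₁), ?_, ?_⟩
      · have e3 : k - 1 + (m + 1) = 1 + (k - 1 + m) := by omega
        rw [e3]
        exact ((hlin _).mul hh₀).add ((hlin _).mul hh₁)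
      · rw [map_add, map_mul, map_mul, hψ₀, hψ₁, h.axialMap_zero, h.axialMap_one]
        simp only [map_add, map_mul, ← add_assoc, pow_succ]
        ring

lemma IsSpecialFamily.exists_lift {s e i : ℕ} {c : RingT K} (hc : c.IsHomogeneous e)
    (he : e + (d - 2) = s + 2 * i) (hs : 1 ≤ s) :
    ∃ G ∈ Ideal.span (positiveFamily k P F S), G.IsHomogeneous (i + 1) ∧
      axialMap p w p₀ p₁ G = axialMap p w p₀ p₁ (movingLine Q) *
        (Polynomial.C c * Polynomial.X ^ i) := by
  have h5 := h.five_le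
  by_cases hi : i + 2 ≤ k
  · refine ⟨C c * F (i + 1), Ideal.mul_mem_left _ _
      (Ideal.subset_span (Or.inr ⟨i + 1, ⟨by omega, by omega⟩, rfl⟩)),
      (fam.isBihomogeneous h hk (by omega) (by omega)).1.C_mul c, ?_⟩
    rw [map_mul, axialMap_C, fam.axialMap_eq h (by omega) (by omega), Nat.add_sub_cancel]
    ring
  · obtain ⟨m, rfl⟩ : ∃ m, i = k - 2 + m := ⟨i - (k - 2), by omega⟩
    -- For `i = k - 2 + m` the weight relation reads `e = s - 1 + 2m`, so `2m ≤ e` holds exactly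
    -- because `s ≥ 1`.
    obtain ⟨G, hG, hh, hψ⟩ := fam.exists_lift_of_le h hk m hc (by omega)
    have e1 : k - 1 + m = k - 2 + m + 1 := by omega
    exact ⟨G, hG, e1 ▸ hh, hψ⟩

/-- Moving curves of positive degree in `T` are generated by the special family. -/
lemma IsSpecialFamily.mem_span_of_aeval_eq_zero {s n : ℕ} (hs : 1 ≤ s) {G : RingTX K}
    (hG : IsBihomogeneous s n G) (h0 : aeval u G = 0) :
    G ∈ Ideal.span (positiveFamily k P F S) := by
  have hPmem : ∀ {B : RingTX K}, movingLine P ∣ B → B ∈ Ideal.span (positiveFamily k P F S) :=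
    fun hB => Ideal.mem_of_dvd _ hB (Ideal.subset_span (Or.inl (by simp)))
  obtain ⟨x, hx⟩ := h.dvd_axialMap hG.1 h0
  by_cases hx0 : x = 0
  · rw [hx0, mul_zero] at hx
    exact hPmem (h.dvd_of_axialMap_eq_zero hG.1 hx)
  have hxdeg : x.natDegree < n := by
    obtain ⟨q₁, q₂, hq₁, -, -, -, hq⟩ := h.exists_linear
    have h1 := natDegree_axialMap_le p w p₀ p₁ hG.1
    rw [hx, Polynomial.natDegree_mul h.axialMap_right_ne_zero hx0, hq,
      Polynomial.natDegree_linear hq₁] at h1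
    omega
  have hlift : ∀ i, ∃ B ∈ Ideal.span (positiveFamily k P F S), B.IsHomogeneous (i + 1) ∧
      axialMap p w p₀ p₁ B = axialMap p w p₀ p₁ (movingLine Q) *
        (Polynomial.C (x.coeff i) * Polynomial.X ^ i) := by
    intro i
    rcases h.coeff_of_mul_eq (hG.hasWeight_axialMap h.hom₀ h.hom₁) hx.symm i with h1 | ⟨e, he, h1⟩
    · refine ⟨0, Ideal.zero_mem _, isHomogeneous_zero _ _ _, ?_⟩
      rw [h1]; simp
    · exact fam.exists_lift h hk h1 he hs
  choose B hBmem hBhom hBψ using hlift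
  -- Powers of `x₂`, which `ψ` sends to 1, bring all lifts to the common `X`-degree `n`; then `G -
  -- B'` is a form in the kernel of `ψ`.
  let B' : RingTX K := ∑ i ∈ Finset.range n, linForm l ^ (n - 1 - i) * B i
  have hB'mem : B' ∈ Ideal.span (positiveFamily k P F S) :=
    Ideal.sum_mem _ fun i _ => Ideal.mul_mem_left _ _ (hBmem i)
  have hB'hom : B'.IsHomogeneous n := by
    refine IsHomogeneous.sum _ _ _ fun i hi => ?_
    have h1 := ((IsBihomogeneous.of_linForm l).1.pow (n - 1 - i)).mul (hBhom i)
    have e : 1 * (n - 1 - i) + (i + 1) = n := by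
      have := Finset.mem_range.1 hi
      omega
    rwa [e] at h1
  have hB'ψ : axialMap p w p₀ p₁ (G - B') = 0 := by
    rw [map_sub, hx, map_sum]
    simp only [map_mul, map_pow, h.axialMap_two, one_pow, one_mul, hBψ]
    rw [← Finset.mul_sum]
    simp_rw [Polynomial.C_mul_X_pow_eq_monomial]
    rw [← x.as_sum_range' n hxdeg, sub_self]
  rw [← sub_add_cancel G B']
  exact Ideal.add_mem _ (hPmem (h.dvd_of_axialMap_eq_zero (hG.1.sub hB'hom) hB'ψ)) hB'mem

end Family

end Generation

/-! ### Degree of the implicit equation, membership in `𝒦` and minimality -/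

section Minimal

variable {K : Type*} [Field K]

lemma exists_eq_varT_mul_embX {n : ℕ} {G : RingTX K} (hG : IsBihomogeneous 1 n G) :
    ∃ a b : RingX K, a.IsHomogeneous n ∧ b.IsHomogeneous n ∧
      G = varT K 0 * embX a + varT K 1 * embX b := by
  obtain ⟨A, B, hA, hB, h⟩ := IsBihomogeneous.exists_split (i := 0) (r := 1) (P := X)
    (fun c hc => exists_eq_X_mul_add hc) hG
  obtain ⟨a, ha, rfl⟩ := hA.exists_embX
  obtain ⟨b, hb, rfl⟩ := hB.exists_embX
  exact ⟨a, b, ha, hb, h⟩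

/-- The special family, in the order `𝓔_d`, `F_{2(k-1)-1,1}, …, F_{1,k-1}`, `F_{1,k}`, `F_{2,1}`. -/
noncomputable def familyGen (k : ℕ) (E : RingX K) (P : Fin 3 → RingT K) (F : ℕ → RingTX K)
    (S : RingTX K) (j : ℕ) : RingTX K :=
  if j = 0 then embX E else if j ≤ k - 1 then F j else if j = k then S else movingLine P

/-- The degree in `T` of `familyGen`. -/
def familyDegT (k j : ℕ) : ℕ :=
  if j = 0 then 0 else if j ≤ k - 1 then 2 * (k - j) - 1 else if j = k then 1 else 2

/-- The degree in `X` of `familyGen`. -/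
def familyDegX (k D j : ℕ) : ℕ :=
  if j = 0 then D else if j ≤ k then j else 1

lemma image_familyGen {k : ℕ} (hk : 2 ≤ k) (E : RingX K) (P : Fin 3 → RingT K)
    (F : ℕ → RingTX K) (S : RingTX K) :
    familyGen k E P F S '' (Finset.range (k + 2)) = familySet k E P F S := by
  ext x
  simp only [Set.mem_image, Finset.coe_range, Set.mem_Iio, familySet, Set.mem_union,
    Set.mem_insert_iff, Set.mem_singleton_iff, Set.mem_Icc]
  constructor
  · rintro ⟨j, hj, rfl⟩
    unfold familyGen
    split_ifs with h1 h2 h3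
    · exact Or.inl (Or.inl rfl)
    · exact Or.inr ⟨j, ⟨by omega, h2⟩, rfl⟩
    · exact Or.inl (Or.inr (Or.inr rfl))
    · exact Or.inl (Or.inr (Or.inl rfl))
  · rintro ((rfl | rfl | rfl) | ⟨j, hj, rfl⟩)
    · exact ⟨0, by omega, by simp [familyGen]⟩
    · refine ⟨k + 1, by omega, ?_⟩
      rw [familyGen, if_neg (by omega), if_neg (by omega), if_neg (by omega)]
    · refine ⟨k, by omega, ?_⟩
      rw [familyGen, if_neg (by omega), if_neg (by omega), if_pos rfl]
    · refine ⟨j, by omega, ?_⟩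
      rw [familyGen, if_neg (by omega), if_pos hj.2]

lemma image_familyGen_Icc {k : ℕ} (hk : 2 ≤ k) (E : RingX K) (P : Fin 3 → RingT K)
    (F : ℕ → RingTX K) (S : RingTX K) :
    familyGen k E P F S '' (Finset.Icc 1 (k + 1)) = positiveFamily k P F S := by
  ext x
  simp only [Set.mem_image, Finset.coe_Icc, Set.mem_Icc, positiveFamily, Set.mem_union,
    Set.mem_insert_iff, Set.mem_singleton_iff]
  constructor
  · rintro ⟨j, hj, rfl⟩
    unfold familyGen
    split_ifs with h1 h2 h3
    · omega
    · exact Or.inr ⟨j, ⟨by omega, h2⟩, rfl⟩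
    · exact Or.inl (Or.inr rfl)
    · exact Or.inl (Or.inl rfl)
  · rintro ((rfl | rfl) | ⟨j, hj, rfl⟩)
    · refine ⟨k + 1, by omega, ?_⟩
      rw [familyGen, if_neg (by omega), if_neg (by omega), if_neg (by omega)]
    · refine ⟨k, by omega, ?_⟩
      rw [familyGen, if_neg (by omega), if_neg (by omega), if_pos rfl]
    · refine ⟨j, by omega, ?_⟩
      rw [familyGen, if_neg (by omega), if_pos hj.2]

variable {u : Fin 3 → RingT K} {d k : ℕ} {P Q : Fin 3 → RingT K} {p : Fin 3 → K}
  {L w : Fin 2 → Fin 3 → K} {l : Fin 3 → K} {p₀ p₁ : RingT K} {F : ℕ → RingTX K} {S : RingTX K}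
  (h : IsAxialBasis u d P Q p L w l p₀ p₁) (hk : d = 2 * k - 1)
  (fam : IsSpecialFamily k L P Q p₀ p₁ F S)

include h hk fam

lemma IsSpecialFamily.isBihomogeneous_familyGen {E : RingX K} {D : ℕ} (hE : E.IsHomogeneous D)
    {j : ℕ} (hj : j < k + 2) :
    IsBihomogeneous (familyDegT k j) (familyDegX k D j) (familyGen k E P F S j) := by
  have h5 := h.five_le
  unfold familyDegT familyDegX familyGen
  by_cases h1 : j = 0
  · simp only [if_pos h1]; exact IsBihomogeneous.of_embX hE
  by_cases h2 : j ≤ k - 1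
  · simp only [if_neg h1, if_pos h2, if_pos (show j ≤ k by omega)]
    exact fam.isBihomogeneous h hk (by omega) h2
  by_cases h3 : j = k
  · simp only [if_neg h1, if_neg h2, if_pos h3, if_pos (show j ≤ k by omega)]
    rw [h3]
    exact fam.isBihomogeneous_sylvester h hk
  · simp only [if_neg h1, if_neg h2, if_neg h3, if_neg (show ¬ j ≤ k by omega)]
    exact IsBihomogeneous.of_movingLine h.basis.homP

/-- The implicit equation has degree `d`. -/
lemma IsSpecialFamily.totalDegree_eq {E : RingX K} (hE : IsImplicitEquation u E) :
    E.totalDegree = d := by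
  have h5 := h.five_le
  have hd0 : 0 < d := by omega
  have hEhom := hE.isHomogeneous h.hom hd0
  have hE0 := hE.ne_zero h.hom hd0
  have hprime := hE.prime h.hom hd0
  set D := E.totalDegree with hD
  obtain ⟨G, H, F₀, F₁, -, -, hF₀, hF₁, -, hF, -⟩ := fam.sylvester
  obtain ⟨S₀, S₁, hS₀, hS₁, hS⟩ := exists_eq_varT_mul_embX (fam.isBihomogeneous_sylvester h hk)
  -- Among the generators of positive `T`-degree only `F_{1,k-1}` and `F_{1,k}` have `T`-degree 1,
  -- so they alone contribute to `T_a E`.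
  have key : ∀ a : Fin 2, ∃ α β : RingX K,
      varT K a * embX E = embX α * F (k - 1) + embX β * S := by
    intro a
    have hb : IsBihomogeneous 1 D (varT K a * embX E) := by
      simpa using (IsBihomogeneous.of_varT a).mul (IsBihomogeneous.of_embX hEhom)
    have hmem := fam.mem_span_of_aeval_eq_zero h hk le_rfl hb (by
      rw [map_mul, aeval_embX, hE.aeval_eq_zero_iff.2 dvd_rfl, mul_zero])
    rw [← image_familyGen_Icc (by omega) E] at hmem
    obtain ⟨c, hc, hcd⟩ := hb.exists_eq_sum (sd := familyDegT k) (nd := familyDegX k D)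
      (fun j hj => fam.isBihomogeneous_familyGen h hk hEhom (by
        have := Finset.mem_Icc.1 hj; omega)) hmem
    have hc0 : ∀ j ∈ Finset.Icc 1 (k + 1), j ∉ ({k - 1, k} : Finset ℕ) →
        c j * familyGen k E P F S j = 0 := by
      intro j hj hj'
      simp only [Finset.mem_insert, Finset.mem_singleton, not_or] at hj'
      have hj2 := Finset.mem_Icc.1 hj
      rcases hcd j hj with h1 | ⟨h1, -⟩
      · rw [h1, zero_mul]
      · exfalso
        unfold familyDegT at h1
        split_ifs at h1 <;> omega
    have hcX : ∀ j ∈ ({k - 1, k} : Finset ℕ), ∃ f, c j = embX f := by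
      intro j hj
      simp only [Finset.mem_insert, Finset.mem_singleton] at hj
      rcases hcd j (Finset.mem_Icc.2 (by omega)) with h1 | ⟨-, -, h1⟩
      · exact ⟨0, by rw [h1, map_zero]⟩
      · have : 1 - familyDegT k j = 0 := by
          unfold familyDegT
          split_ifs <;> omega
        rw [this] at h1
        obtain ⟨f, -, hf⟩ := h1.exists_embX
        exact ⟨f, hf⟩
    have hsub : ({k - 1, k} : Finset ℕ) ⊆ Finset.Icc 1 (k + 1) := by
      intro j hj
      simp only [Finset.mem_insert, Finset.mem_singleton] at hj
      exact Finset.mem_Icc.2 (by omega)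
    rw [← Finset.sum_subset hsub hc0, Finset.sum_pair (by omega)] at hc
    obtain ⟨α, hα⟩ := hcX (k - 1) (by simp)
    obtain ⟨β, hβ⟩ := hcX k (by simp)
    refine ⟨α, β, ?_⟩
    rw [hc, hα, hβ]
    simp only [familyGen]
    rw [if_neg (by omega), if_pos le_rfl, if_neg (by omega), if_neg (by omega), if_pos trivial]
  obtain ⟨α, β, hαβ⟩ := key 0
  obtain ⟨α', β', hαβ'⟩ := key 1
  obtain ⟨e1, e2⟩ := varT_mul_embX_inj (a := E) (b := 0) (a' := α * F₁ + β * S₀)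
    (b' := - α * F₀ + β * S₁) (by
      simp only [map_add, map_mul, map_neg, map_zero, mul_zero, add_zero]
      rw [hαβ, hF, hS]; ring)
  obtain ⟨e3, e4⟩ := varT_mul_embX_inj (a := 0) (b := E) (a' := α' * F₁ + β' * S₀)
    (b' := - α' * F₀ + β' * S₁) (by
      simp only [map_add, map_mul, map_neg, map_zero, mul_zero, zero_add]
      rw [hαβ', hF, hS]; ring)
  -- The determinant of `F_{1,k-1} = T₀F₁ - T₁F₀` and `S = T₀S₀ + T₁S₁` in the basis `T₀, T₁`, of
  -- degree `(k - 1) + k = d`. The relations for `T₀E` and `T₁E` exhibit `E` times the identity as a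
  -- matrix product, whence `hdet`.
  set Δ := F₁ * S₁ + F₀ * S₀ with hΔ
  have hΔhom : Δ.IsHomogeneous d := by
    have e : k - 1 + k = d := by omega
    rw [← e]
    exact (hF₁.mul hS₁).add (hF₀.mul hS₀)
  have hdet : E ^ 2 = Δ * (α * β' - α' * β) := by
    rw [hΔ]
    linear_combination E * e4 + (- α' * F₀ + β' * S₁) * e1 - (α' * F₁ + β' * S₀) * e2
  obtain ⟨i, hi, ⟨r, hr⟩⟩ := (dvd_prime_pow hprime 2).1 ⟨_, hdet⟩
  have hΔ0 : Δ ≠ 0 := by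
    intro h0
    rw [h0, zero_mul] at hdet
    exact pow_ne_zero 2 hE0 hdet
  have hr0 : (r : RingX K).totalDegree = 0 := by
    obtain ⟨r', -, hr'⟩ := MvPolynomial.isUnit_iff_eq_C_of_isReduced.1 r.isUnit
    rw [hr', totalDegree_C]
  have hdeg := congrArg totalDegree hr
  rw [totalDegree_mul_of_isDomain hΔ0 r.ne_zero, hr0, add_zero, hΔhom.totalDegree hΔ0,
    (hEhom.pow i).totalDegree (pow_ne_zero i hE0)] at hdeg
  -- `Δ` is associated to `E^i` with `i ≤ 2`, so `d = i D`. As `d` is odd, `i = 1`.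
  interval_cases i <;> omega

/-- A generator can only be a combination of generators of smaller or equal bidegree. Nothing
qualifies for `E` and `F_{2,1}`, only `F_{2,1}` for each `F_j`, and only `F_{1,k-1}` for `F_{1,k}`.
-/
lemma IsSpecialFamily.familyGen_notMem_span {E : RingX K} (hE : E.IsHomogeneous d) (hE0 : E ≠ 0)
    {i : ℕ} (hi : i < k + 2) :
    familyGen k E P F S i ∉
      Ideal.span (familyGen k E P F S '' ((Finset.range (k + 2)).erase i)) := by
  have h5 := h.five_le
  intro hmem
  have hbi : ∀ {j}, j < k + 2 →
      IsBihomogeneous (familyDegT k j) (familyDegX k d j) (familyGen k E P F S j) :=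
    fun hj => fam.isBihomogeneous_familyGen h hk hE hj
  obtain ⟨c, hc, hcd⟩ := (hbi hi).exists_eq_sum (fun j hj => hbi (by
    have := Finset.mem_range.1 (Finset.mem_of_mem_erase hj); exact this)) hmem
  have hcd' : ∀ j ∈ (Finset.range (k + 2)).erase i,
      ¬ (familyDegT k j ≤ familyDegT k i ∧ familyDegX k d j ≤ familyDegX k d i) →
      c j * familyGen k E P F S j = 0 := by
    intro j hj hn
    rcases hcd j hj with h1 | ⟨h1, h2, -⟩
    · rw [h1, zero_mul]
    · exact (hn ⟨h1, h2⟩).elim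
  have hq := h.axialMap_right_ne_zero
  have hP0 : movingLine P ≠ 0 := by
    intro h1
    refine h.basis.left_ne_zero (movingLine_injective ?_)
    rw [h1]
    simp [movingLine]
  by_cases h1 : i = 0
  · subst h1
    rw [Finset.sum_eq_zero] at hc
    · simp only [familyGen, if_true] at hc
      exact hE0 (embX_injective (by rw [hc, map_zero]))
    · intro j hj
      refine hcd' j hj fun hn => ?_
      simp only [Finset.mem_erase, Finset.mem_range] at hj
      have := hn.1
      unfold familyDegT at this
      split_ifs at this <;> omega
  by_cases h4 : i = k + 1
  · rw [Finset.sum_eq_zero] at hc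
    · simp only [familyGen] at hc
      rw [if_neg (by omega), if_neg (by omega), if_neg (by omega)] at hc
      exact hP0 hc
    · intro j hj
      refine hcd' j hj fun hn => ?_
      simp only [Finset.mem_erase, Finset.mem_range] at hj
      obtain ⟨hn1, hn2⟩ := hn
      unfold familyDegT at hn1
      unfold familyDegX at hn2
      split_ifs at hn1 hn2 <;> omega
  by_cases h2 : i ≤ k - 1
  · have hsum : familyGen k E P F S i = c (k + 1) * familyGen k E P F S (k + 1) := by
      rw [hc]
      refine Finset.sum_eq_single_of_mem _ (by simp; omega) fun j hj hjk => ?_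
      refine hcd' j hj fun hn => ?_
      simp only [Finset.mem_erase, Finset.mem_range] at hj
      obtain ⟨hn1, hn2⟩ := hn
      unfold familyDegT at hn1
      unfold familyDegX at hn2
      split_ifs at hn1 hn2 <;> omega
    simp only [familyGen] at hsum
    rw [if_neg (by omega), if_pos (by omega), if_neg (by omega), if_neg (by omega),
      if_neg (by omega)] at hsum
    -- A multiple of `F_{2,1}` is killed by `ψ`, while `ψ(F_i) = z^(i-1) ψ(Q)` is nonzero.
    have h3 := fam.axialMap_eq h (j := i) (by omega) h2
    rw [hsum, map_mul, h.axialMap_left, mul_zero] at h3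
    exact mul_ne_zero (pow_ne_zero _ Polynomial.X_ne_zero) hq h3.symm
  · have hik : i = k := by omega
    subst hik
    have hmem1 : i - 1 ∈ (Finset.range (i + 2)).erase i := by simp; omega
    have hsum : familyGen i E P F S i = c (i - 1) * familyGen i E P F S (i - 1) := by
      rw [hc]
      refine Finset.sum_eq_single_of_mem _ hmem1 fun j hj hjk => ?_
      refine hcd' j hj fun hn => ?_
      simp only [Finset.mem_erase, Finset.mem_range] at hj
      obtain ⟨hn1, hn2⟩ := hn
      unfold familyDegT at hn1
      unfold familyDegX at hn2
      split_ifs at hn1 hn2 <;> omega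
    have hcb : IsBihomogeneous 0 1 (c (i - 1)) := by
      rcases hcd _ hmem1 with h3 | ⟨-, -, h3⟩
      · rw [h3]; exact IsBihomogeneous.zero _ _
      · have e1 : familyDegT i i - familyDegT i (i - 1) = 0 := by
          unfold familyDegT; split_ifs <;> omega
        have e2 : familyDegX i d i - familyDegX i d (i - 1) = 1 := by
          unfold familyDegX; split_ifs <;> omega
        rwa [e1, e2] at h3
    simp only [familyGen] at hsum
    rw [if_neg (by omega), if_neg (by omega), if_pos trivial, if_neg (by omega),
      if_pos le_rfl] at hsum
    -- If `S = c F_{1,k-1}`, cancelling `z^(k-2) ψ(Q)` gives `ψ(c) = ε` with `c` of bidegree `(0,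
    -- 1)`, which is excluded.
    obtain ⟨ε, -, -, hψ, hne⟩ := fam.exists_sylvester_image h hk
    have h3 := fam.axialMap_eq h (j := i - 1) (by omega) le_rfl
    have e3 : i - 1 - 1 = i - 2 := by omega
    rw [e3] at h3
    rw [hsum, map_mul, h3] at hψ
    exact hne _ hcb (mul_right_cancel₀
      (mul_ne_zero (pow_ne_zero _ Polynomial.X_ne_zero) hq) hψ)

omit hk in
-- On the curve `x₀ = p₀g` and `x₁ = p₁g`, so `𝒟_T` multiplies the value at `u` by `g`.
lemma IsSpecialFamily.aeval_eq_zero {j : ℕ} (h1 : 1 ≤ j) (hj : j ≤ k - 1) :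
    aeval u (F j) = 0 := by
  obtain ⟨g, v, -, -, -, -, hu⟩ := h.exists_factor
  have hlin : ∀ c : Fin 3 → K, aeval u (linForm c : RingTX K) =
      g * (p₀ * C (∑ i, c i * w 0 i) + p₁ * C (∑ i, c i * w 1 i)) + v * C (∑ i, c i * p i) := by
    intro c
    rw [linForm_eq_movingLine, movingLine_aeval]
    simp only [hu, Fin.sum_univ_three, map_add, map_mul]
    ring
  induction j, h1 using Nat.le_induction with
  | base =>
    rw [fam.start, movingLine_aeval]
    exact mem_syzygies_iff.1 h.basis.mem_right
  | succ j h1 ih =>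
    obtain ⟨G₀, G₁, -, -, hG, hF⟩ := fam.step (j + 1) (by omega) hj
    have ih' := ih (by omega)
    rw [Nat.add_sub_cancel] at hG
    rw [hG, map_add, map_mul, map_mul, algHom_C, algHom_C] at ih'
    rw [hF, map_add, map_mul, map_mul, hlin, hlin, h.Lw, h.Lw, h.Lw, h.Lw, h.coords.2, h.coords.2]
    simp only [if_true, if_neg (show (0 : Fin 2) ≠ 1 by decide),
      if_neg (show (1 : Fin 2) ≠ 0 by decide), C_0, C_1, mul_zero, mul_one, add_zero, zero_add]
    simp only [Algebra.algebraMap_self, RingHom.id_apply] at ih'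
    linear_combination g * ih'

omit hk in
-- The identity `T₀S = F₀ F_{2,1} + H F_{1,k-1}` puts `T₀S` in `𝒦`, and `T₀` can be cancelled.
lemma IsSpecialFamily.aeval_sylvester (hk3 : 3 ≤ k) : aeval u S = 0 := by
  obtain ⟨G, H, F₀, F₁, -, -, -, -, hP, hF, hS⟩ := fam.sylvester
  have h1 : aeval u (varT K 0 * S) = 0 := by
    have e : varT K 0 * S = embX F₀ * movingLine P + H * F (k - 1) := by
      rw [hS, hP, hF]; ring
    rw [e, map_add, map_mul, map_mul, fam.aeval_eq_zero h (by omega) le_rfl, movingLine_aeval,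
      mem_syzygies_iff.1 h.basis.mem_left, mul_zero, mul_zero, add_zero]
  rw [map_mul, mul_eq_zero, varT, algHom_C] at h1
  exact h1.resolve_left (X_ne_zero _)

/-- The special family generates the defining ideal of the Rees algebra. -/
lemma IsSpecialFamily.span_familySet {E : RingX K} (hE : IsImplicitEquation u E) :
    Ideal.span (familySet k E P F S) = reesIdeal u := by
  have h5 := h.five_le
  refine le_antisymm ?_ ?_
  · rw [Ideal.span_le]
    rintro x ((rfl | rfl | rfl) | ⟨j, hj, rfl⟩)
    · have hEhom := hE.isHomogeneous h.hom (by omega)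
      refine (mem_reesIdeal_iff_of_isHomogeneous (IsBihomogeneous.of_embX hEhom).1).2 ?_
      rw [aeval_embX]
      exact hE.aeval_eq_zero_iff.2 dvd_rfl
    · refine (mem_reesIdeal_iff_of_isHomogeneous
        (IsBihomogeneous.of_movingLine h.basis.homP).1).2 ?_
      rw [movingLine_aeval]
      exact mem_syzygies_iff.1 h.basis.mem_left
    · exact (mem_reesIdeal_iff_of_isHomogeneous (fam.isBihomogeneous_sylvester h hk).1).2
        (fam.aeval_sylvester h (by omega))
    · exact (mem_reesIdeal_iff_of_isHomogeneous (fam.isBihomogeneous h hk hj.1 hj.2).1).2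
        (fam.aeval_eq_zero h hj.1 hj.2)
  · intro G hG
    obtain ⟨N, M, hsum⟩ := sum_bicomp G
    rw [hsum]
    refine Ideal.sum_mem _ fun n _ => Ideal.sum_mem _ fun s _ => ?_
    have hb := bicomp_isBihomogeneous s n G
    have h0 := (mem_reesIdeal_iff_of_isHomogeneous hb.1).1 (bicomp_mem_reesIdeal h.hom hG s n)
    obtain rfl | hs : s = 0 ∨ 1 ≤ s := by omega
    · obtain ⟨f, -, hf⟩ := hb.exists_embX
      rw [hf, aeval_embX, hE.aeval_eq_zero_iff] at h0
      rw [hf]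
      exact Ideal.mem_of_dvd _ (map_dvd embX h0) (Ideal.subset_span (Or.inl (by simp)))
    · refine Ideal.span_mono ?_ (fam.mem_span_of_aeval_eq_zero h hk hs hb h0)
      refine Set.union_subset_union_left _ ?_
      rintro x (rfl | rfl)
      · exact Or.inr (Or.inl rfl)
      · exact Or.inr (Or.inr rfl)

end Minimal

/-! ### Existence of the special family -/

section Existence

variable {K : Type*} [Field K] {u : Fin 3 → RingT K} {d k : ℕ} {P Q : Fin 3 → RingT K}
  {p : Fin 3 → K} {L w : Fin 2 → Fin 3 → K} {l : Fin 3 → K}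

/-- Since `P` vanishes at `p`, its expansion in `L 0, L 1, l` has no `l`-term; the other
coefficients are the pairings of `P` with `w 0` and `w 1`. -/
lemma exists_axial {μ : ℕ} (hP : ∀ i, (P i).IsHomogeneous μ) (hPp : ∑ i, P i * C (p i) = 0)
    (hid : ∀ i j, w 0 i * L 0 j + w 1 i * L 1 j + p i * l j = if i = j then 1 else 0) :
    ∃ p₀ p₁ : RingT K, p₀.IsHomogeneous μ ∧ p₁.IsHomogeneous μ ∧
      movingLine P = C p₁ * linForm (L 0) - C p₀ * linForm (L 1) := by
  have hhom : ∀ c : Fin 3 → K, (∑ i, P i * C (c i)).IsHomogeneous μ := fun c =>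
    IsHomogeneous.sum _ _ _ fun i _ => by simpa using (hP i).mul (isHomogeneous_C (Fin 2) (c i))
  refine ⟨- ∑ i, P i * C (w 1 i), ∑ i, P i * C (w 0 i), (hhom _).neg, hhom _, ?_⟩
  have h1 : P = fun j => (∑ i, P i * C (w 0 i)) * C (L 0 j) +
      (∑ i, P i * C (w 1 i)) * C (L 1 j) := by
    funext j
    have h2 : ∀ i, (C (w 0 i) * C (L 0 j) + C (w 1 i) * C (L 1 j) + C (p i) * C (l j) : RingT K) =
        if i = j then 1 else 0 := by
      intro i
      rw [← C_mul, ← C_mul, ← C_mul, ← C_add, ← C_add, hid]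
      split_ifs <;> simp
    have h3 : P j = ∑ i, P i * (C (w 0 i) * C (L 0 j) + C (w 1 i) * C (L 1 j) +
        C (p i) * C (l j)) := by simp [h2]
    rw [h3]
    simp only [Fin.sum_univ_three] at hPp ⊢
    linear_combination C (l j) * hPp
  conv_lhs => rw [h1]
  simp only [movingLine, linForm]
  rw [Fin.sum_univ_three (fun i => C (C (L 0 i)) * X i),
    Fin.sum_univ_three (fun i => C (C (L 1 i)) * X i), Fin.sum_univ_three]
  simp only [C_add, C_mul, C_neg]
  ring

lemma IsAxialBasis.exists_isSpecialFamily {p₀ p₁ : RingT K}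
    (h : IsAxialBasis u d P Q p L w l p₀ p₁) (hk : d = 2 * k - 1) :
    ∃ F S, IsSpecialFamily k L P Q p₀ p₁ F S := by
  classical
  have h5 := h.five_le
  have hDT : ∀ {j : ℕ} {G : RingTX K}, 2 ≤ j → j ≤ k - 1 →
      IsBihomogeneous (2 * (k - (j - 1)) - 1) (j - 1) G →
      ∃ H, IsValueDT p₀ p₁ (linForm (L 0)) (linForm (L 1)) (2 * (k - j) - 1) (j - 1) G H := by
    intro j G hj1 hj2 hG
    obtain ⟨e, he⟩ : ∃ e, 2 * (k - j) - 1 = e + 1 := ⟨2 * (k - j) - 2, by omega⟩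
    have he2 : 2 * (k - (j - 1)) - 1 = e + 1 + 2 := by omega
    rw [he2] at hG
    obtain ⟨G₀, G₁, hG₀, hG₁, hGG⟩ := IsBihomogeneous.exists_split (P := ![p₀, p₁])
      (fun c hc => exists_eq_mul_add_mul_of_isRelPrime h.hom₀ h.hom₁ h.isRelPrime hc) hG
    rw [he]
    exact ⟨_, G₀, G₁, hG₀, hG₁, hGG, rfl⟩
  -- A value of `𝒟_T` exists only for arguments of the right bidegree. The default 0 is never used
  -- for `2 ≤ j ≤ k - 1`, as `hbi` and `hval` show together by induction.
  let step : ℕ → RingTX K → RingTX K := fun j G =>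
    if hH : ∃ H, IsValueDT p₀ p₁ (linForm (L 0)) (linForm (L 1)) (2 * (k - j) - 1) (j - 1) G H
    then hH.choose else 0
  let F' : ℕ → RingTX K := fun n => Nat.rec (movingLine Q) (fun n G => step (n + 2) G) n
  -- The recursion starts at 0 and the family at 1, hence the shift.
  let F : ℕ → RingTX K := fun j => F' (j - 1)
  have hF1 : F 1 = movingLine Q := rfl
  have hFstep : ∀ j, 2 ≤ j → F j = step j (F (j - 1)) := by
    intro j hj
    obtain ⟨n, rfl⟩ : ∃ n, j = n + 2 := ⟨j - 2, by omega⟩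
    rfl
  have hval : ∀ j, 2 ≤ j → j ≤ k - 1 → IsBihomogeneous (2 * (k - (j - 1)) - 1) (j - 1) (F (j - 1)) →
      IsValueDT p₀ p₁ (linForm (L 0)) (linForm (L 1)) (2 * (k - j) - 1) (j - 1) (F (j - 1))
        (F j) := by
    intro j hj1 hj2 hb
    have hex := hDT hj1 hj2 hb
    have : F j = hex.choose := by
      rw [hFstep j hj1]
      exact dif_pos hex
    rw [this]
    exact hex.choose_spec
  have hbi : ∀ j, 1 ≤ j → j ≤ k - 1 → IsBihomogeneous (2 * (k - j) - 1) j (F j) := by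
    intro j h1 hj
    induction j, h1 using Nat.le_induction with
    | base =>
      rw [hF1]
      have := IsBihomogeneous.of_movingLine h.basis.homQ
      have e : 2 * (k - 1) - 1 = d - 2 := by omega
      rwa [e]
    | succ j h1 ih =>
      obtain ⟨G₀, G₁, hG₀, hG₁, -, hF⟩ := hval (j + 1) (by omega) hj (ih (by omega))
      rw [hF]
      have h3 := ((IsBihomogeneous.of_linForm (L 0)).mul hG₀).add
        ((IsBihomogeneous.of_linForm (L 1)).mul hG₁)
      have e1 : 0 + (2 * (k - (j + 1)) - 1) = 2 * (k - (j + 1)) - 1 := by omega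
      have e2 : 1 + (j + 1 - 1) = j + 1 := by omega
      rwa [e1, e2] at h3
  have hlast : IsBihomogeneous 1 (k - 1) (F (k - 1)) := by
    have h1 := hbi (k - 1) (by omega) le_rfl
    have e : 2 * (k - (k - 1)) - 1 = 1 := by omega
    rwa [e] at h1
  obtain ⟨a, b, ha, hb, hab⟩ := exists_eq_varT_mul_embX hlast
  obtain ⟨G, H, hG, hH, hGH⟩ := IsBihomogeneous.exists_split (i := 1) (r := 1) (P := X)
    (fun c hc => exists_eq_X_mul_add hc) (IsBihomogeneous.of_movingLine h.basis.homP)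
  exact ⟨F, embX (-b) * G + embX a * H,
    { hom₀ := h.hom₀
      hom₁ := h.hom₁
      axial := h.axial
      start := hF1
      step := fun j hj1 hj2 => hval j hj1 hj2 (hbi (j - 1) (by omega) (by omega))
      sylvester := ⟨G, H, -b, a, hG, hH, hb.neg, ha, hGH, by rw [hab, map_neg]; ring, rfl⟩ }⟩

end Existence

theorem mainTheorem1 {K : Type*} [Field K] [IsAlgClosed K] (k d : ℕ) (hk : 2 ≤ k)
    (hd : d = 2 * k - 1) (u : Fin 3 → RingT K) (hu : ∀ i, (u i).IsHomogeneous d)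
    (hcop : ∀ g : RingT K, (∀ i, g ∣ u i) → IsUnit g)
    (hμ : muDegree u = 2) (hprop : IsProperParam u)
    (p : Fin 3 → K) (hp : IsVerySingular u p) :
    (∃ P Q, IsMuBasis u d 2 P Q) ∧
    (∃ L, AreCoordsAt p L) ∧
    ∀ (E : RingX K) (P Q : Fin 3 → RingT K) (L : Fin 2 → Fin 3 → K),
      IsImplicitEquation u E → IsMuBasis u d 2 P Q → AreCoordsAt p L →
      Irreducible E ∧ E.IsHomogeneous d ∧
      (∃ p₀ p₁ F S, IsSpecialFamily k L P Q p₀ p₁ F S) ∧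
      ∀ p₀ p₁ F S, IsSpecialFamily k L P Q p₀ p₁ F S →
        (∀ j ∈ Set.Icc 1 (k - 1), IsBihomogeneous (2 * (k - j) - 1) j (F j)) ∧
        IsBihomogeneous 1 k S ∧
        (familySet k E P F S).ncard = k + 2 ∧
        IsMinimalGeneratingSet (reesIdeal u) (familySet k E P F S) := by
  have hk3 := three_le_of_muDegree hk hd hu hμ
  have h5 : 5 ≤ d := by omega
  have hd0 : 0 < d := by omega
  refine ⟨exists_isMuBasis h5 hu hcop hμ, exists_areCoordsAt hp.1, fun E P Q L hE hPQ hL => ?_⟩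
  obtain ⟨w, l, hLw, hlp, hlw, hid⟩ := hL.exists_dual hp.1
  have hPp := sum_mul_eq_zero_of_isVerySingular hu h5 hμ hprop hp hPQ
  have hax : ∀ {p₀ p₁ : RingT K}, p₀.IsHomogeneous 2 → p₁.IsHomogeneous 2 →
      movingLine P = C p₁ * linForm (L 0) - C p₀ * linForm (L 1) →
      IsAxialBasis u d P Q p L w l p₀ p₁ := fun h0 h1 h2 =>
    ⟨hu, h5, hcop, hμ, hPQ, hL, hLw, hlp, hlw, hid, h0, h1, h2⟩
  obtain ⟨q₀, q₁, hq₀, hq₁, hq⟩ := exists_axial hPQ.homP hPp hid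
  obtain ⟨F', S', fam'⟩ := (hax hq₀ hq₁ hq).exists_isSpecialFamily hd
  have hEd : E.IsHomogeneous d := by
    have h1 := hE.isHomogeneous hu hd0
    rwa [fam'.totalDegree_eq (hax hq₀ hq₁ hq) hd hE] at h1
  refine ⟨(hE.prime hu hd0).irreducible, hEd, ⟨q₀, q₁, F', S', fam'⟩, fun p₀ p₁ F S fam => ?_⟩
  have h := hax fam.hom₀ fam.hom₁ fam.axial
  have hnot : ∀ {i}, i < k + 2 → familyGen k E P F S i ∉
      Ideal.span (familyGen k E P F S '' ((Finset.range (k + 2)).erase i)) :=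
    fun hi => fam.familyGen_notMem_span h hd hEd (hE.ne_zero hu hd0) hi
  refine ⟨fun j hj => fam.isBihomogeneous h hd hj.1 hj.2, fam.isBihomogeneous_sylvester h hd, ?_,
    fam.span_familySet h hd hE, ?_⟩
  · rw [← image_familyGen hk, Set.InjOn.ncard_image, Set.ncard_coe_finset, Finset.card_range]
    intro i hi j hj hij
    by_contra hne
    refine hnot (Finset.mem_range.1 hi) ?_
    rw [hij]
    exact Ideal.subset_span ⟨j, by simpa using ⟨Finset.mem_range.1 hj, Ne.symm hne⟩, rfl⟩
  -- A generator missing from a generating subset `A` would lie in the span of the remaining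
  -- generators, which `hnot` forbids. The same fact gave the cardinality: two equal members would
  -- each lie in the span of the others.
  · intro A hA hAle x hx
    by_contra hxA
    rw [← image_familyGen hk] at hx
    obtain ⟨i, hi, rfl⟩ := hx
    refine hnot (Finset.mem_range.1 hi) (Ideal.span_mono (s := A) ?_ ?_)
    · intro y hy
      have hy' := hAle hy
      rw [← image_familyGen hk] at hy'
      obtain ⟨j, hj, rfl⟩ := hy'
      refine ⟨j, ?_, rfl⟩
      simp only [Finset.coe_erase, Set.mem_sdiff, Set.mem_singleton_iff]
      refine ⟨hj, ?_⟩
      rintro rfl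
      exact hxA hy
    · rw [hA, ← fam.span_familySet h hd hE, ← image_familyGen hk]
      exact Ideal.subset_span ⟨i, hi, rfl⟩
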